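/- **Setting.** Let $\Omega\subset\mathbb R^d$ ($d\ge1$) be a bounded open set with $C^\infty$ boundary and unit outward normal $\mathbf n$; let $|\Omega|$, $|\partial\Omega|$ be its volume and surface area and $\mathcal U(\Omega)$, $\mathcal U(\partial\Omega)$ the uniform distributions. Let $0<c_0<c_1$, $P_{\mathcal A}(t)=\min(\max(c_0,t),c_1)$ and $q^\dagger\in\mathcal A=\{q\in H^1(\Omega): c_0\le q\le c_1\text{ a.e.}\}$. Let $f\in L^\infty(\Omega)$, $g\in L^\infty(\partial\Omega)$ and $z^\delta\in W^{1,\infty}(\Omega)$. For integers $L\ge 2$, $N\ge1$ and real $R\ge1$ let $\mathcal N(L,N,R)$ be the set of all functions $v^{(L)}:\mathbb R^d\to\mathbb R$ given by $v^{(0)}=x$, $v^{(\ell)}=\tanh(A^{(\ell)}v^{(\ell-1)}+b^{(\ell)})$ for $1\le\ell\le L-1$ (componentwise), $v^{(L)}=A^{(L)}v^{(L-1)}+b^{(L)}$ (arbitrary hidden widths), such that at most $N$ of all entries of the $A^{(\ell)},b^{(\ell)}$ are nonzero and all of them are at most $R$ in absolute value. Let $\mathcal N_q=\mathcal N(L_q,N_\theta,R_q)$,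 and let $\mathcal N_\sigma$ be the set of vector fields $\sigma:\mathbb R^d\to\mathbb R^d$ each of whose $d$ components lies in $\mathcal N(L_\sigma,N_\kappa,R_\sigma)$, with $L_q,L_\sigma\ge2$, $N_\theta,N_\kappa\ge1$, $R_q,R_\sigma\ge1$. Let $X_1,\dots,X_{n_r}$ be i.i.d. with law $\mathcal U(\Omega)$ and $Y_1,\dots,Y_{n_b}$ i.i.d. with law $\mathcal U(\partial\Omega)$, $n_r,n_b\ge1$. Put $$\begin{aligned} h_d&=\|\sigma-P_{\mathcal A}(q)\nabla z^\delta\|_{\ell^2}^2, & h_\sigma&=(\nabla\cdot\sigma+f)^2, & h_q&=\|\nabla q\|_{\ell^2}^2,\\ h_b&=(\sigma\cdot\mathbf n-g)^2, & h_{b'}&=\|\sigma-q^\dagger\nabla z^\delta\|_{\ell^2}^2, \end{aligned}$$ $$\mathcal E_i=|\Omega|\,\mathbb E_{X\sim\mathcal U(\Omega)}[h_i(X)],\quad \widehat{\mathcal E}_i=\frac{|\Omega|}{n_r}\sum_{j=1}^{n_r}h_i(X_j)\quad (i\in\{d,\sigma,q\}),$$ $$\mathcal E_i=|\partial\Omega|\,\mathbb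 E_{Y\sim\mathcal U(\partial\Omega)}[h_i(Y)],\quad \widehat{\mathcal E}_i=\frac{|\partial\Omega|}{n_b}\sum_{j=1}^{n_b}h_i(Y_j)\quad (i\in\{b,b'\}),$$ and let $\Delta\mathcal E_i=\sup|\mathcal E_i-\widehat{\mathcal E}_i|$, the supremum being over $\sigma\in\mathcal N_\sigma$ and $q\in\mathcal N_q$ (whichever occur). For $i=b'$ it is assumed that $q^\dagger$ and $\nabla z^\delta$ have traces on $\partial\Omega$, which are used in $h_{b'}$; here $w$ is the trace of $v$ if $w$ is measurable on $\partial\Omega$ and, for almost every $y\in\partial\Omega$, the mean of $\|v-w(y)\|$ over $\Omega\cap B(y,r)$ tends to $0$ as $r\to0$. **Theorem.** Fix $\tau\in(0,\frac18)$, and put $$\begin{aligned} e_d&=c\,\frac{R_\sigma^2N_\kappa^2(N_\kappa+N_\theta)^{1/2}\big(\log^{1/2}R_\sigma+\log^{1/2}N_\kappa+\log^{1/2}R_q+\log^{1/2}N_\theta+\log^{1/2}n_r\big)}{\sqrt{n_r}}+\tilde c\,R_\sigma^2N_\kappa^2\sqrt{\tfrac{\log(1/\tau)}{n_r}},\\ e_\sigma&=c\,\frac{R_\sigma^{2L_\sigma}N_\kappa^{2L_\sigma-3/2}\big(\log^{1/2}R_\sigma+\log^{1/2}N_\kappa+\log^{1/2}n_r\big)}{\sqrt{n_r}}+\tilde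 c\,R_\sigma^{2L_\sigma}N_\kappa^{2L_\sigma-2}\sqrt{\tfrac{\log(1/\tau)}{n_r}},\\ e_b=e_{b'}&=c\,\frac{R_\sigma^2N_\kappa^{5/2}\big(\log^{1/2}R_\sigma+\log^{1/2}N_\kappa+\log^{1/2}n_b\big)}{\sqrt{n_b}}+\tilde c\,R_\sigma^2N_\kappa^2\sqrt{\tfrac{\log(1/\tau)}{n_b}},\\ e_q&=c\,\frac{R_q^{2L_q}N_\theta^{2L_q-3/2}\big(\log^{1/2}R_q+\log^{1/2}N_\theta+\log^{1/2}n_r\big)}{\sqrt{n_r}}+\tilde c\,R_q^{2L_q}N_\theta^{2L_q-2}\sqrt{\tfrac{\log(1/\tau)}{n_r}}. \end{aligned}$$ There are universal polynomials $p,\tilde p$ such that, with $$c=p\big(|\Omega|,|\partial\Omega|,d,c_1,\|z^\delta\|_{W^{1,\infty}(\Omega)},\|f\|_{L^\infty(\Omega)},\|g\|_{L^\infty(\partial\Omega)},L_\sigma,L_q\big),$$ $$\tilde c=\tilde p\big(|\Omega|,|\partial\Omega|,d,c_1,\|z^\delta\|_{W^{1,\infty}(\Omega)},\|f\|_{L^\infty(\Omega)},\|g\|_{L^\infty(\partial\Omega)}\big),$$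 for each $i\in\{d,\sigma,b,b',q\}$ the bound $\Delta\mathcal E_i\le e_i$ holds with probability at least $1-\tau$. -/

import Mathlib

open MeasureTheory ProbabilityTheory Filter Topology Set
open scoped ENNReal ContDiff

noncomputable section

namespace FluxNet

/-- The Euclidean space `ℝ^d`. -/
abbrev Pt (d : ℕ) : Type := EuclideanSpace ℝ (Fin d)

/-! ### Networks -/

/-- Parameters `θ = (A^(ℓ), b^(ℓ))`, `ℓ = 1, …, L`, of a fully connected feedforward network of
depth `L` from `ℝ^a` to `ℝ^b`, with arbitrary hidden widths. The layers are listed from the input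
to the output. -/
inductive Param : ℕ → ℕ → ℕ → Type
  | output {a b : ℕ} (A : Matrix (Fin b) (Fin a) ℝ) (v : Fin b → ℝ) : Param 1 a b
  | hidden {L a k b : ℕ} (A : Matrix (Fin k) (Fin a) ℝ) (v : Fin k → ℝ) (rest : Param L k b) :
      Param (L + 1) a b

/-- The network realized by `θ`: affine layers, with `tanh` applied componentwise after every layer
but the last. -/
def Param.realize : {L a b : ℕ} → Param L a b → (Fin a → ℝ) → (Fin b → ℝ)
  | _, _, _, .output A v, x => A.mulVec x + v
  | _, _, _, .hidden A v rest, x => rest.realize (fun i => Real.tanh ((A.mulVec x + v) i))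

/-- Number of nonzero entries of a weight matrix and of a bias vector. -/
def layerNnz {a b : ℕ} (A : Matrix (Fin b) (Fin a) ℝ) (v : Fin b → ℝ) : ℕ :=
  Set.ncard {ij : Fin b × Fin a | A ij.1 ij.2 ≠ 0} + Set.ncard {i : Fin b | v i ≠ 0}

/-- `‖θ‖_{ℓ^0}`: the number of nonzero entries of all weight matrices and bias vectors. -/
def Param.nnz : {L a b : ℕ} → Param L a b → ℕ
  | _, _, _, .output A v => layerNnz A v
  | _, _, _, .hidden A v rest => layerNnz A v + rest.nnz

/-- `‖θ‖_{ℓ^∞} ≤ R`: all entries of all weight matrices and bias vectors are at most `R` in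
absolute value. -/
def Param.BoundedBy (R : ℝ) : {L a b : ℕ} → Param L a b → Prop
  | _, _, _, .output A v => (∀ i j, |A i j| ≤ R) ∧ ∀ i, |v i| ≤ R
  | _, _, _, .hidden A v rest => ((∀ i j, |A i j| ≤ R) ∧ ∀ i, |v i| ≤ R) ∧ rest.BoundedBy R

/-- The class `𝒩(L, N, R)` of scalar `tanh` networks on `ℝ^d` of depth `L` with at most `N` nonzero
parameters, all bounded by `R`. -/
def netClass (d L N : ℕ) (R : ℝ) : Set (Pt d → ℝ) :=
  {v | ∃ θ : Param L d 1, θ.nnz ≤ N ∧ θ.BoundedBy R ∧ ∀ x : Pt d, v x = θ.realize (fun i => x i) 0}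

/-- Vector fields on `ℝ^d` obtained by stacking `d` networks of the class `𝒩(L, N, R)`. -/
def fluxClass (d L N : ℕ) (R : ℝ) : Set (Pt d → Pt d) :=
  {σ | ∀ i, (fun x => σ x i) ∈ netClass d L N R}

/-! ### The domain and its boundary -/

/-- On the open set `U`, the set `Ω` is the sublevel set `{φ < 0}` of a smooth function without
critical points. -/
structure IsDefiningFunction {d : ℕ} (Ω U : Set (Pt d)) (φ : Pt d → ℝ) : Prop where
  isOpen : IsOpen U
  smooth : ContDiffOn ℝ ∞ φ U
  gradient_ne_zero : ∀ y ∈ U, gradient φ y ≠ 0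
  mem_iff : ∀ y ∈ U, y ∈ Ω ↔ φ y < 0

/-- `Ω` has a smooth (`C^∞`) boundary, and `ν` is its unit outward normal field: near each boundary
point, `ν = ∇φ / |∇φ|` on `∂Ω` for some smooth local defining function `φ` of `Ω`. -/
def IsUnitOutwardNormal {d : ℕ} (Ω : Set (Pt d)) (ν : Pt d → Pt d) : Prop :=
  ∀ y ∈ frontier Ω, ∃ (U : Set (Pt d)) (φ : Pt d → ℝ), y ∈ U ∧ IsDefiningFunction Ω U φ ∧
    ∀ y' ∈ frontier Ω ∩ U, ν y' = ‖gradient φ y'‖⁻¹ • gradient φ y'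

/-- Surface measure on `∂Ω`: the `(d-1)`-dimensional Hausdorff measure, normalized to agree with
Lebesgue measure on `ℝ^(d-1)`. -/
def surfaceMeasure {d : ℕ} (Ω : Set (Pt d)) : Measure (Pt d) :=
  (Measure.euclideanHausdorffMeasure (d - 1)).restrict (frontier Ω)

/-- `|Ω|`. -/
def vol {d : ℕ} (Ω : Set (Pt d)) : ℝ := (volume Ω).toReal

/-- `|∂Ω|`. -/
def area {d : ℕ} (Ω : Set (Pt d)) : ℝ := (surfaceMeasure Ω (frontier Ω)).toReal

/-- The uniform distribution on `Ω`. -/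
def uniformIn {d : ℕ} (Ω : Set (Pt d)) : Measure (Pt d) := cond volume Ω

/-- The uniform distribution on `∂Ω`. -/
def uniformBdry {d : ℕ} (Ω : Set (Pt d)) : Measure (Pt d) := cond (surfaceMeasure Ω) (frontier Ω)

/-! ### Function spaces -/

/-- `G` is (a representative of) the weak gradient of `z` in `Ω`. -/
def IsWeakGradient {d : ℕ} (Ω : Set (Pt d)) (z : Pt d → ℝ) (G : Pt d → Pt d) : Prop :=
  LocallyIntegrableOn z Ω ∧ LocallyIntegrableOn G Ω ∧
    ∀ φ : Pt d → ℝ, ContDiff ℝ ∞ φ → HasCompactSupport φ → tsupport φ ⊆ Ω → ∀ i,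
      ∫ x in Ω, z x * fderiv ℝ φ x (EuclideanSpace.single i 1) = -∫ x in Ω, G x i * φ x

/-- The `L^∞` norm of `v` with respect to `μ`. -/
def supNorm {d : ℕ} {F : Type*} [NormedAddCommGroup F] (v : Pt d → F) (μ : Measure (Pt d)) : ℝ :=
  (eLpNorm v ⊤ μ).toReal

/-- `z ∈ W^{1,∞}(Ω)` with weak gradient `G`. -/
def MemW1Inf {d : ℕ} (Ω : Set (Pt d)) (z : Pt d → ℝ) (G : Pt d → Pt d) : Prop :=
  MemLp z ⊤ (volume.restrict Ω) ∧ MemLp G ⊤ (volume.restrict Ω) ∧ IsWeakGradient Ω z G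

/-- `‖z‖_{W^{1,∞}(Ω)}`, for `z` with weak gradient `G`. -/
def normW1Inf {d : ℕ} (Ω : Set (Pt d)) (z : Pt d → ℝ) (G : Pt d → Pt d) : ℝ :=
  max (supNorm z (volume.restrict Ω)) (supNorm G (volume.restrict Ω))

/-- The admissible set `𝒜 = {q ∈ H^1(Ω) : c₀ ≤ q ≤ c₁ a.e. in Ω}`. -/
def admissibleSet {d : ℕ} (Ω : Set (Pt d)) (c₀ c₁ : ℝ) : Set (Pt d → ℝ) :=
  {q | MemLp q 2 (volume.restrict Ω) ∧
    (∃ G, IsWeakGradient Ω q G ∧ MemLp G 2 (volume.restrict Ω)) ∧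
    ∀ᵐ x ∂(volume.restrict Ω), c₀ ≤ q x ∧ q x ≤ c₁}

/-- `w` is the trace of `v` on `∂Ω`: at almost every boundary point `y`, the means of `|v - w(y)|`
over `Ω ∩ B(y, r)` tend to zero with `r`. -/
def HasTrace {d : ℕ} {F : Type*} [NormedAddCommGroup F] (Ω : Set (Pt d)) (v w : Pt d → F) : Prop :=
  AEStronglyMeasurable w (surfaceMeasure Ω) ∧
    ∀ᵐ y ∂(surfaceMeasure Ω),
      Tendsto (fun r : ℝ => ⨍⁻ x in Ω ∩ Metric.ball y r, ‖v x - w y‖ₑ ∂volume) (𝓝[>] 0) (𝓝 0)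

/-! ### Loss terms, their Monte Carlo approximations, and the quadrature errors -/

/-- The cutoff `P_𝒜(t) = min(max(c₀, t), c₁)`. -/
def cutoff (c₀ c₁ t : ℝ) : ℝ := min (max c₀ t) c₁

/-- The divergence of a vector field. -/
def divergence {d : ℕ} (σ : Pt d → Pt d) (x : Pt d) : ℝ :=
  ∑ i, fderiv ℝ (fun y => σ y i) x (EuclideanSpace.single i 1)

/-- `|Ω| 𝔼_{X ∼ 𝒰(Ω)}[h(X)]`. -/
def lossIn {d : ℕ} (Ω : Set (Pt d)) (h : Pt d → ℝ) : ℝ := vol Ω * ∫ x, h x ∂(uniformIn Ω)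

/-- `|∂Ω| 𝔼_{Y ∼ 𝒰(∂Ω)}[h(Y)]`. -/
def lossOn {d : ℕ} (Ω : Set (Pt d)) (h : Pt d → ℝ) : ℝ := area Ω * ∫ y, h y ∂(uniformBdry Ω)

/-- `n⁻¹ |Ω| ∑ⱼ h(xⱼ)`. -/
def empLossIn {d n : ℕ} (Ω : Set (Pt d)) (xs : Fin n → Pt d) (h : Pt d → ℝ) : ℝ :=
  (n : ℝ)⁻¹ * vol Ω * ∑ j, h (xs j)

/-- `n⁻¹ |∂Ω| ∑ⱼ h(yⱼ)`. -/
def empLossOn {d n : ℕ} (Ω : Set (Pt d)) (ys : Fin n → Pt d) (h : Pt d → ℝ) : ℝ :=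
  (n : ℝ)⁻¹ * area Ω * ∑ j, h (ys j)

/-- `|σ(x) - P_𝒜(q(x)) ∇z(x)|²`, with `G = ∇z`. -/
def resD {d : ℕ} (c₀ c₁ : ℝ) (G σ : Pt d → Pt d) (q : Pt d → ℝ) (x : Pt d) : ℝ :=
  ‖σ x - cutoff c₀ c₁ (q x) • G x‖ ^ 2

/-- `(∇·σ(x) + f(x))²`. -/
def resσ {d : ℕ} (f : Pt d → ℝ) (σ : Pt d → Pt d) (x : Pt d) : ℝ := (divergence σ x + f x) ^ 2

/-- `(σ(y)·ν(y) - g(y))²`. -/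
def resB {d : ℕ} (ν : Pt d → Pt d) (g : Pt d → ℝ) (σ : Pt d → Pt d) (y : Pt d) : ℝ :=
  (inner ℝ (σ y) (ν y) - g y) ^ 2

/-- `|σ(y) - q†(y) ∇z(y)|²`, with `qb` and `Gb` the boundary values of `q†` and `∇z`. -/
def resB' {d : ℕ} (qb : Pt d → ℝ) (Gb σ : Pt d → Pt d) (y : Pt d) : ℝ := ‖σ y - qb y • Gb y‖ ^ 2

/-- `|∇q(x)|²`. -/
def resQ {d : ℕ} (q : Pt d → ℝ) (x : Pt d) : ℝ := ‖gradient q x‖ ^ 2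

/-- `Δℰ_d`, the supremum of `|ℰ_d - ℰ̂_d|` over `σ ∈ 𝒩_σ` and `q ∈ 𝒩_q`. -/
def errD {d n : ℕ} (Ω : Set (Pt d)) (c₀ c₁ : ℝ) (G : Pt d → Pt d) (Nσ : Set (Pt d → Pt d))
    (Nq : Set (Pt d → ℝ)) (xs : Fin n → Pt d) : ℝ≥0∞ :=
  ⨆ σ ∈ Nσ, ⨆ q ∈ Nq,
    ENNReal.ofReal |lossIn Ω (resD c₀ c₁ G σ q) - empLossIn Ω xs (resD c₀ c₁ G σ q)|

/-- `Δℰ_σ`. -/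
def errσ {d n : ℕ} (Ω : Set (Pt d)) (f : Pt d → ℝ) (Nσ : Set (Pt d → Pt d))
    (xs : Fin n → Pt d) : ℝ≥0∞ :=
  ⨆ σ ∈ Nσ, ENNReal.ofReal |lossIn Ω (resσ f σ) - empLossIn Ω xs (resσ f σ)|

/-- `Δℰ_b`. -/
def errB {d n : ℕ} (Ω : Set (Pt d)) (ν : Pt d → Pt d) (g : Pt d → ℝ) (Nσ : Set (Pt d → Pt d))
    (ys : Fin n → Pt d) : ℝ≥0∞ :=
  ⨆ σ ∈ Nσ, ENNReal.ofReal |lossOn Ω (resB ν g σ) - empLossOn Ω ys (resB ν g σ)|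

/-- `Δℰ_{b'}`. -/
def errB' {d n : ℕ} (Ω : Set (Pt d)) (qb : Pt d → ℝ) (Gb : Pt d → Pt d)
    (Nσ : Set (Pt d → Pt d)) (ys : Fin n → Pt d) : ℝ≥0∞ :=
  ⨆ σ ∈ Nσ, ENNReal.ofReal |lossOn Ω (resB' qb Gb σ) - empLossOn Ω ys (resB' qb Gb σ)|

/-- `Δℰ_q`. -/
def errQ {d n : ℕ} (Ω : Set (Pt d)) (Nq : Set (Pt d → ℝ)) (xs : Fin n → Pt d) : ℝ≥0∞ :=
  ⨆ q ∈ Nq, ENNReal.ofReal |lossIn Ω (resQ q) - empLossIn Ω xs (resQ q)|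

/-! ### The bounds -/

/-- `log^{1/2} t`. -/
def sqrtLog (t : ℝ) : ℝ := √(Real.log t)

/-- The bound `e_d`. -/
def boundD (c c' Rσ Rq : ℝ) (Nκ Nθ n : ℕ) (τ : ℝ) : ℝ :=
  c * (Rσ ^ 2 * (Nκ : ℝ) ^ 2 * √((Nκ : ℝ) + Nθ) *
      (sqrtLog Rσ + sqrtLog Nκ + sqrtLog Rq + sqrtLog Nθ + sqrtLog n) / √(n : ℝ))
    + c' * Rσ ^ 2 * (Nκ : ℝ) ^ 2 * √(Real.log (1 / τ) / n)

/-- The bounds `e_σ` and `e_q`: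
`c R^{2L} N^{2L-3/2} (log^{1/2} R + log^{1/2} N + log^{1/2} n) / √n + c' R^{2L} N^{2L-2} √(log(1/τ)/n)`. -/
def boundDeriv (c c' : ℝ) (L : ℕ) (R : ℝ) (N n : ℕ) (τ : ℝ) : ℝ :=
  c * (R ^ (2 * L) * (N : ℝ) ^ (2 * (L : ℝ) - 3 / 2) *
      (sqrtLog R + sqrtLog N + sqrtLog n) / √(n : ℝ))
    + c' * R ^ (2 * L) * (N : ℝ) ^ (2 * (L : ℝ) - 2) * √(Real.log (1 / τ) / n)

/-- The bounds `e_b` and `e_{b'}`. -/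
def boundB (c c' R : ℝ) (N n : ℕ) (τ : ℝ) : ℝ :=
  c * (R ^ 2 * (N : ℝ) ^ (5 / 2 : ℝ) * (sqrtLog R + sqrtLog N + sqrtLog n) / √(n : ℝ))
    + c' * R ^ 2 * (N : ℝ) ^ 2 * √(Real.log (1 / τ) / n)

end FluxNet

end

open FluxNet

noncomputable section

namespace FluxNet

/-! ### Symmetrization -/

/-! Each loss is the integral of a squared residual `‖r θ x‖ ^ 2`, where `θ` is a network parameter
and the residual is bounded by some `ρ`. Suppose that on any `2n` points the residuals fall into at
most `K` classes of diameter `ρ / n`. Then, with probability at least `1 - τ`, the Monte Carlo error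
is at most of order `ρ ^ 2 * √(log (K / τ) / n)`, uniformly in `θ`. A single scale suffices, so no
chaining is needed.

The probabilistic half (`measure_exists_deviation_le`) is symmetrization at the level of exponential
moments. Jensen's inequality replaces the expectation by an independent second sample, and
exchanging the members of the pairs introduces random signs. For fixed points the supremum reduces
to `K` representatives, each giving a Rademacher sum with Gaussian moment generating function;
Markov's inequality concludes. Continuity in `θ` reduces the whole parameter space to a countable
dense subset (`measure_exists_residual_deviation_le`).

The other half bounds `K`. Sparsity leaves at most `N` active neurons per layer, so every network is
realized with hidden width `N` (`exists_sparseParam`). A plain covering in weight space would bring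
in the size of the points `x`, hence the position and diameter of the domain, which the constants
may not contain. The way around this is that `x` enters only through the first layer, where `tanh`
saturates: it is enough to compare each first preactivation with finitely many thresholds. These
comparisons are signs of affine functionals on an `N`-dimensional space of nonzero weights, and the
Sauer–Shelah lemma counts their patterns on the sample (`exists_sign_pattern`, `exists_classes`).
Close weights and close first layers give close outputs and close derivatives (`net_sub_le`),
because the derivative of the first layer depends on `x` only through that layer's output. The
outcome, `log_netCount_le`, is that `log K` is linear in `N` up to logarithms; its square root is
the extra factor `N ^ (1/2)` in the bounds.

The remaining powers come from the sizes of the residuals: `N * R` for network values, and `R ^ L *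
N ^ (L - 1)` for derivatives (`abs_net_le`, `abs_dnet_le`). `deviation_le_bound` turns all this into
explicit constants. -/

theorem exp_abs_le (x : ℝ) : Real.exp |x| ≤ Real.exp x + Real.exp (-x) := by
  rcases abs_cases x with ⟨h, _⟩ | ⟨h, _⟩ <;> rw [h]
  · linarith [Real.exp_pos (-x)]
  · linarith [Real.exp_pos x]

theorem sum_exp_signs {J : Type*} [Fintype J] [DecidableEq J] (a : J → ℝ) :
    ∑ ε : J → Bool, Real.exp (∑ j, if ε j then a j else -a j)
      = ∏ j, (2 * Real.cosh (a j)) := by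
  have h : ∀ j, 2 * Real.cosh (a j) = ∑ b : Bool, Real.exp (if b then a j else -a j) := by
    intro j
    rw [Real.cosh_eq]; simp; ring
  simp_rw [h]
  rw [Finset.prod_univ_sum, Fintype.piFinset_univ]
  exact Finset.sum_congr rfl fun ε _ => Real.exp_sum _ _

/-- The sum over signs factors into hyperbolic cosines, and `cosh t ≤ exp (t ^ 2 / 2)` makes each
factor subgaussian. -/
theorem sum_exp_signs_le {J : Type*} [Fintype J] [DecidableEq J] (a : J → ℝ) {A : ℝ}
    (ha : ∀ j, |a j| ≤ A) :
    ∑ ε : J → Bool, Real.exp (∑ j, if ε j then a j else -a j)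
      ≤ 2 ^ Fintype.card J * Real.exp (Fintype.card J * A ^ 2 / 2) := by
  rw [sum_exp_signs]
  calc ∏ j, (2 * Real.cosh (a j)) ≤ ∏ _j : J, (2 * Real.exp (A ^ 2 / 2)) := by
        refine Finset.prod_le_prod (fun j _ => by positivity) fun j _ => ?_
        have h1 := Real.cosh_le_exp_half_sq (a j)
        have h2 : a j ^ 2 ≤ A ^ 2 := sq_le_sq' (abs_le.1 (ha j)).1 (abs_le.1 (ha j)).2
        have h3 : Real.exp (a j ^ 2 / 2) ≤ Real.exp (A ^ 2 / 2) := Real.exp_le_exp.2 (by linarith)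
        linarith
    _ = _ := by
        rw [Finset.prod_const, Finset.card_univ, mul_pow, ← Real.exp_nat_mul]
        ring_nf

/-- The moment generating function of the modulus of a Rademacher sum. -/
theorem sum_exp_abs_signs_le {J : Type*} [Fintype J] [DecidableEq J] (a : J → ℝ) {A l : ℝ}
    (hl : 0 ≤ l) (ha : ∀ j, |a j| ≤ A) :
    ∑ ε : J → Bool, Real.exp (l * |∑ j, if ε j then a j else -a j|)
      ≤ 2 * (2 ^ Fintype.card J * Real.exp (Fintype.card J * (l * A) ^ 2 / 2)) := by
  have key : ∀ b : J → ℝ, (∀ j, |b j| ≤ A) →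
      ∑ ε : J → Bool, Real.exp (l * ∑ j, if ε j then b j else -b j)
        ≤ 2 ^ Fintype.card J * Real.exp (Fintype.card J * (l * A) ^ 2 / 2) := by
    intro b hb
    refine le_trans (le_of_eq (Finset.sum_congr rfl fun ε _ => ?_))
      (sum_exp_signs_le (fun j => l * b j) (A := l * A) fun j => ?_)
    · rw [Finset.mul_sum]
      congr 1
      exact Finset.sum_congr rfl fun j _ => by split_ifs <;> ring
    · rw [abs_mul, abs_of_nonneg hl]
      exact mul_le_mul_of_nonneg_left (hb j) hl
  have h1 := key a ha
  have h2 := key (fun j => -a j) fun j => by rw [abs_neg]; exact ha j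
  calc _ ≤ ∑ ε : J → Bool, (Real.exp (l * ∑ j, if ε j then a j else -a j)
          + Real.exp (l * ∑ j, if ε j then -a j else - -a j)) := by
        refine Finset.sum_le_sum fun ε _ => ?_
        rw [← abs_of_nonneg hl, ← abs_mul, abs_of_nonneg hl]
        refine (exp_abs_le _).trans (le_of_eq ?_)
        congr 2
        rw [← mul_neg, ← Finset.sum_neg_distrib]
        congr 1
        exact Finset.sum_congr rfl fun j _ => by split_ifs <;> ring
    _ ≤ _ := by rw [Finset.sum_add_distrib]; linarith

section Symmetrization

variable {X ι J : Type*} [Fintype J]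

/-- Exchange of the two members of the pairs selected by `ε`. -/
def swapPairs (ε : J → Bool) (w : J → X × X) : J → X × X :=
  fun j => if ε j then w j else (w j).swap

/-- The difference of the sums of `h` over the first and over the second sample. -/
def pairSum (h : X → ℝ) (w : J → X × X) : ℝ := ∑ j, (h (w j).1 - h (w j).2)

theorem pairSum_swapPairs (h : X → ℝ) (ε : J → Bool) (w : J → X × X) :
    pairSum h (swapPairs ε w)
      = ∑ j, if ε j then h (w j).1 - h (w j).2 else -(h (w j).1 - h (w j).2) := by
  refine Finset.sum_congr rfl fun j _ => ?_
  unfold swapPairs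
  split_ifs <;> simp

/-- `sup_i exp(l |∑_j (h_i(x_j) - h_i(y_j))|)`. -/
def supExpPair (l : ℝ) (h : ι → X → ℝ) (w : J → X × X) : ℝ≥0∞ :=
  ⨆ i, ENNReal.ofReal (Real.exp (l * |pairSum (h i) w|))

/-- For fixed pairs, a function may be replaced by a representative of its class at a cost of `2 * n
* η` in the sum. The supremum over representatives is at most their sum, which gives the factor `K`,
and each term is a Rademacher sum with coefficients at most `B` because the functions take values in
`[0, B]`. -/
theorem sum_supExpPair_swapPairs_le [DecidableEq J] {l η B : ℝ} (hl : 0 ≤ l) {K : ℕ}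
    {h : ι → X → ℝ} (h0 : ∀ i x, 0 ≤ h i x) (hB : ∀ i x, h i x ≤ B) (w : J → X × X)
    (c : ι → Fin K)
    (hc : ∀ i i', c i = c i' → ∀ j, |h i (w j).1 - h i' (w j).1| ≤ η ∧
      |h i (w j).2 - h i' (w j).2| ≤ η) :
    ∑ ε : J → Bool, supExpPair l h (swapPairs ε w)
      ≤ 2 ^ Fintype.card J * ENNReal.ofReal (2 * K * Real.exp (2 * Fintype.card J * (l * η)
          + Fintype.card J * (l * B) ^ 2 / 2)) := by
  classical
  set n := Fintype.card J
  have hcl : ∀ (ε : J → Bool) i i', c i = c i' →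
      |pairSum (h i) (swapPairs ε w)| ≤ |pairSum (h i') (swapPairs ε w)| + 2 * n * η := by
    intro ε i i' hi
    have : |pairSum (h i) (swapPairs ε w) - pairSum (h i') (swapPairs ε w)| ≤ 2 * n * η := by
      rw [pairSum, pairSum, ← Finset.sum_sub_distrib]
      refine (Finset.abs_sum_le_sum_abs _ _).trans ?_
      refine (Finset.sum_le_sum (g := fun _ => 2 * η) fun j _ => ?_).trans (le_of_eq ?_)
      · obtain ⟨h1, h2⟩ := hc i i' hi j
        rw [abs_le] at *
        rcases Bool.eq_false_or_eq_true (ε j) with hε | hε <;>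
          simp only [swapPairs, hε, if_true, Bool.false_eq_true, if_false, Prod.fst_swap,
            Prod.snd_swap] <;>
          constructor <;> linarith
      · rw [Finset.sum_const, Finset.card_univ, nsmul_eq_mul]; ring
    have := abs_sub_abs_le_abs_sub (pairSum (h i) (swapPairs ε w)) (pairSum (h i') (swapPairs ε w))
    linarith
  -- A class that contains no function gets the coefficients `0`; this is why the bound is `max B
  -- 0`, since `0 ≤ B` is not yet known.
  have hcK : ∀ k : Fin K, ∃ a : J → ℝ, (∀ j, |a j| ≤ max B 0) ∧ ∀ i, c i = k → ∀ ε : J → Bool,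
      |pairSum (h i) (swapPairs ε w)| ≤ |∑ j, if ε j then a j else -a j| + 2 * n * η := by
    intro k
    by_cases hk : ∃ i, c i = k
    · obtain ⟨i', rfl⟩ := hk
      refine ⟨fun j => h i' (w j).1 - h i' (w j).2, fun j => ?_, fun i hi ε => ?_⟩
      · have := h0 i' (w j).1; have := h0 i' (w j).2
        have := hB i' (w j).1; have := hB i' (w j).2
        refine le_trans ?_ (le_max_left _ _)
        rw [abs_le]; constructor <;> linarith
      · rw [← pairSum_swapPairs]; exact hcl ε i i' hi
    · exact ⟨0, fun j => by simp, fun i hi => absurd ⟨i, hi⟩ hk⟩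
  choose a ha hab using hcK
  by_cases hne : Nonempty ι
  swap
  · simp [supExpPair, not_nonempty_iff.1 hne]
  have hB0 : 0 ≤ B ∨ IsEmpty J := by
    by_cases hJ : Nonempty J
    · exact Or.inl ((h0 hne.some (w hJ.some).1).trans (hB _ _))
    · exact Or.inr (not_nonempty_iff.1 hJ)
  have hBB : n * (l * max B 0) ^ 2 / 2 = n * (l * B) ^ 2 / 2 := by
    rcases hB0 with h | h
    · rw [max_eq_left h]
    · simp [n]
  calc ∑ ε : J → Bool, supExpPair l h (swapPairs ε w)
      ≤ ∑ ε : J → Bool, ENNReal.ofReal (∑ k, Real.exp (2 * n * (l * η)) *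
          Real.exp (l * |∑ j, if ε j then a k j else -a k j|)) := by
        refine Finset.sum_le_sum fun ε _ => iSup_le fun i => ENNReal.ofReal_le_ofReal ?_
        refine le_trans ?_ (Finset.single_le_sum (f := fun k => Real.exp (2 * n * (l * η)) *
          Real.exp (l * |∑ j, if ε j then a k j else -a k j|)) (fun k _ => by positivity)
          (Finset.mem_univ (c i)))
        rw [← Real.exp_add]
        refine Real.exp_le_exp.2 ?_
        have := mul_le_mul_of_nonneg_left (hab (c i) i rfl ε) hl
        linarith
    _ = ENNReal.ofReal (∑ k, Real.exp (2 * n * (l * η)) * ∑ ε : J → Bool,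
          Real.exp (l * |∑ j, if ε j then a k j else -a k j|)) := by
        rw [← ENNReal.ofReal_sum_of_nonneg fun ε _ => by positivity, Finset.sum_comm]
        simp_rw [Finset.mul_sum]
    _ ≤ ENNReal.ofReal (∑ _k : Fin K, Real.exp (2 * n * (l * η)) *
          (2 * (2 ^ n * Real.exp (n * (l * max B 0) ^ 2 / 2)))) := by
        refine ENNReal.ofReal_le_ofReal (Finset.sum_le_sum fun k _ => ?_)
        exact mul_le_mul_of_nonneg_left (sum_exp_abs_signs_le _ hl (ha k)) (by positivity)
    _ = _ := by
        rw [hBB, Finset.sum_const, Finset.card_univ, Fintype.card_fin, nsmul_eq_mul, Real.exp_add]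
        have : (2 : ℝ≥0∞) ^ n = ENNReal.ofReal (2 ^ n) := by
          rw [ENNReal.ofReal_pow (by norm_num)]; simp
        rw [this, ← ENNReal.ofReal_mul (by positivity)]
        congr 1; ring

variable [MeasurableSpace X]

theorem measurable_pairSum {h : X → ℝ} (hm : Measurable h) :
    Measurable (pairSum (J := J) h) := by
  unfold pairSum; fun_prop

/-- The two members of a pair are independent with the same law, so exchanging them coordinatewise
preserves the product measure. -/
theorem measurePreserving_swapPairs (μ : Measure X) [IsProbabilityMeasure μ] (ε : J → Bool) :
    MeasurePreserving (swapPairs ε) (Measure.pi fun _ : J => μ.prod μ)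
      (Measure.pi fun _ : J => μ.prod μ) := by
  refine measurePreserving_pi (fun _ => μ.prod μ) (fun _ => μ.prod μ)
    (f := fun j (x : X × X) => if ε j then x else x.swap) fun j => ?_
  by_cases h : ε j
  · simp only [h, if_true]; exact MeasurePreserving.id _
  · simp only [h]; exact Measure.measurePreserving_swap

theorem sum_lintegral_swapPairs [DecidableEq J] (μ : Measure X) [IsProbabilityMeasure μ]
    {F : (J → X × X) → ℝ≥0∞} (hF : Measurable F) :
    ∫⁻ w, ∑ ε : J → Bool, F (swapPairs ε w) ∂(Measure.pi fun _ : J => μ.prod μ)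
      = 2 ^ Fintype.card J * ∫⁻ w, F w ∂(Measure.pi fun _ : J => μ.prod μ) := by
  have hm := fun ε : J → Bool => hF.comp (measurePreserving_swapPairs μ ε).measurable
  refine (lintegral_finsetSum _ fun ε _ => hm ε).trans ?_
  simp [(measurePreserving_swapPairs μ _).lintegral_comp hF]

theorem measurable_supExpPair [Countable ι] (l : ℝ) {h : ι → X → ℝ} (hm : ∀ i, Measurable (h i)) :
    Measurable (supExpPair (J := J) l h) := by
  refine Measurable.iSup fun i => ?_
  have := measurable_pairSum (J := J) (hm i)
  fun_prop


/-- Jensen's inequality for the convex function `t ↦ exp (l * |t - a|)` applied to the sum over an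
independent ghost sample `y`, whose mean is `n ∫ h`. -/
theorem exp_abs_sub_integral_le (μ : Measure X) [IsProbabilityMeasure μ] {l B : ℝ} (hl : 0 ≤ l)
    {h : X → ℝ} (hm : Measurable h) (hB : ∀ x, |h x| ≤ B) (x : J → X) :
    ENNReal.ofReal (Real.exp (l * |Fintype.card J * ∫ x, h x ∂μ - ∑ j, h (x j)|))
      ≤ ∫⁻ y : J → X, ENNReal.ofReal (Real.exp (l * |pairSum h fun j => (x j, y j)|))
          ∂(Measure.pi fun _ : J => μ) := by
  set a := ∑ j, h (x j)
  set F : (J → X) → ℝ := fun y => ∑ j, h (y j)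
  have hint : ∀ j : J, Integrable (fun y : J → X => h (y j)) (Measure.pi fun _ : J => μ) := by
    intro j
    exact Integrable.of_bound (hm.comp (measurable_pi_apply j)).aestronglyMeasurable B
      (ae_of_all _ fun y => hB _)
  have hF : ∫ y, F y ∂(Measure.pi fun _ : J => μ) = Fintype.card J * ∫ x, h x ∂μ := by
    rw [integral_finsetSum _ fun j _ => hint j]
    have : ∀ j : J, ∫ y : J → X, h (y j) ∂(Measure.pi fun _ : J => μ) = ∫ x, h x ∂μ := fun j =>
      (measurePreserving_eval (fun _ : J => μ) j).hasLaw.integral_comp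
        (f := h) hm.aestronglyMeasurable
    simp [this]
  have hFm : Measurable F := by fun_prop
  have hFb : ∀ y, |F y| ≤ Fintype.card J * B := fun y => by
    refine (Finset.abs_sum_le_sum_abs _ _).trans
      ((Finset.sum_le_sum fun j _ => hB (y j)).trans (le_of_eq ?_))
    simp
  have hconv : ConvexOn ℝ univ (fun t : ℝ => Real.exp (l * |t - a|)) := by
    have h1 : ConvexOn ℝ univ (fun t : ℝ => l * |t - a|) :=
      (convexOn_dist a convex_univ).smul hl
    -- The range is connected, hence an interval; convexity of `exp` is needed on it for the
    -- composition.
    have h2 : Convex ℝ ((fun t : ℝ => l * |t - a|) '' univ) :=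
      (isPreconnected_univ.image _ (by fun_prop)).ordConnected.convex
    exact (convexOn_exp.subset (subset_univ _) h2).comp h1 (Real.exp_monotone.monotoneOn _)
  have hexp : ∀ y, Real.exp (l * |F y - a|) = Real.exp (l * |pairSum h fun j => (x j, y j)|) := by
    intro y
    rw [abs_sub_comm, pairSum, Finset.sum_sub_distrib]
  have hgi : Integrable (fun y => Real.exp (l * |F y - a|)) (Measure.pi fun _ : J => μ) := by
    refine Integrable.of_bound (by fun_prop) (Real.exp (l * (Fintype.card J * B + |a|)))
      (ae_of_all _ fun y => ?_)
    rw [Real.norm_eq_abs, Real.abs_exp]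
    refine Real.exp_le_exp.2 (mul_le_mul_of_nonneg_left ?_ hl)
    exact (abs_sub _ _).trans (add_le_add_left (hFb y) _)
  have key := hconv.map_integral_le (μ := Measure.pi fun _ : J => μ) (f := F)
    (by fun_prop) isClosed_univ (by simp) (integrable_finsetSum _ fun j _ => hint j) hgi
  rw [hF] at key
  refine (ENNReal.ofReal_le_ofReal key).trans (le_of_eq ?_)
  rw [ofReal_integral_eq_lintegral_ofReal hgi (ae_of_all _ fun y => (Real.exp_pos _).le)]
  simp_rw [hexp]

variable [Countable ι]

/-- Markov's inequality for the function of the first sample obtained by integrating the supremum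
over the ghost sample. By Jensen it dominates every single deviation at once. -/
theorem measure_exists_lt_abs_sub_le (μ : Measure X) [IsProbabilityMeasure μ] {l B : ℝ}
    (hl : 0 ≤ l) {h : ι → X → ℝ} (hm : ∀ i, Measurable (h i)) (hB : ∀ i x, |h i x| ≤ B) (T : ℝ) :
    (Measure.pi fun _ : J => μ)
        {x | ∃ i, T < |Fintype.card J * ∫ x, h i x ∂μ - ∑ j, h i (x j)|}
      ≤ (∫⁻ w, supExpPair l h w ∂(Measure.pi fun _ : J => μ.prod μ))
          / ENNReal.ofReal (Real.exp (l * T)) := by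
  set π := Measure.pi fun _ : J => μ
  set e := MeasurableEquiv.arrowProdEquivProdArrow X X J
  have he : MeasurePreserving e (Measure.pi fun _ : J => μ.prod μ) (π.prod π) :=
    measurePreserving_arrowProdEquivProdArrow X X J (fun _ => μ) (fun _ => μ)
  have hΦ := measurable_supExpPair (J := J) l hm
  have hΨ : Measurable fun p : (J → X) × (J → X) => supExpPair l h (e.symm p) :=
    hΦ.comp e.symm.measurable
  have h1 : ∫⁻ w, supExpPair l h w ∂(Measure.pi fun _ : J => μ.prod μ)
      = ∫⁻ x, ∫⁻ y, supExpPair l h (e.symm (x, y)) ∂π ∂π := by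
    rw [← lintegral_prod _ hΨ.aemeasurable, ← he.lintegral_comp hΨ]
    simp
  have hG : Measurable fun x => ∫⁻ y, supExpPair l h (e.symm (x, y)) ∂π :=
    hΨ.lintegral_prod_right'
  rw [h1]
  refine le_trans (measure_mono fun x hx => ?_) (meas_ge_le_lintegral_div hG.aemeasurable
    (by simpa using Real.exp_pos _) ENNReal.ofReal_ne_top)
  obtain ⟨i, hi⟩ := hx
  calc ENNReal.ofReal (Real.exp (l * T))
      ≤ ENNReal.ofReal (Real.exp (l * |Fintype.card J * ∫ x, h i x ∂μ - ∑ j, h i (x j)|)) :=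
        ENNReal.ofReal_le_ofReal
          (Real.exp_le_exp.2 (mul_le_mul_of_nonneg_left hi.le hl))
    _ ≤ _ := exp_abs_sub_integral_le μ hl (hm i) (hB i) x
    _ ≤ _ := lintegral_mono fun y => le_iSup (fun i => ENNReal.ofReal (Real.exp
          (l * |pairSum (h i) (e.symm (x, y))|))) i

/-- Uniform deviation inequality for a countable class of functions with values in `[0, B]` that,
on any finite sample, falls into at most `K` classes of diameter at most `η`. -/
theorem measure_exists_deviation_le [Nonempty J] (μ : Measure X) [IsProbabilityMeasure μ] {B η : ℝ}
    (hBpos : 0 < B) {h : ι → X → ℝ} (hm : ∀ i, Measurable (h i)) (h0 : ∀ i x, 0 ≤ h i x)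
    (hB : ∀ i x, h i x ≤ B) {K : ℕ} (hK : 1 ≤ K)
    (hc : ∀ w : J ⊕ J → X, ∃ c : ι → Fin K, ∀ i i', c i = c i' →
      ∀ j, |h i (w j) - h i' (w j)| ≤ η)
    {τ : ℝ} (hτ0 : 0 < τ) (hτ1 : τ < 1) :
    (Measure.pi fun _ : J => μ) {x | ∃ i, 2 * η + B * √(2 * Real.log (2 * K / τ) / Fintype.card J)
        < |∫ x, h i x ∂μ - (Fintype.card J : ℝ)⁻¹ * ∑ j, h i (x j)|} ≤ ENNReal.ofReal τ := by
  classical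
  set n := Fintype.card J with hn
  have hn0 : (0 : ℝ) < n := by exact_mod_cast Fintype.card_pos
  have hK' : (1 : ℝ) ≤ K := by exact_mod_cast hK
  -- The parameters balance the two exponents. With `l * B = r` and `n * r ^ 2 = 2 * ℓ`, the moment
  -- is at most `2 K exp (2 n l η + ℓ)` while the Markov denominator is `exp (2 n l η + 2 ℓ)`; the
  -- quotient `2 K exp (-ℓ)` equals `τ`.
  set ℓ := Real.log (2 * K / τ) with hℓ
  have hℓpos : 0 < ℓ := Real.log_pos (by rw [lt_div_iff₀ hτ0]; linarith)
  set r := √(2 * ℓ / n) with hr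
  have hr0 : 0 < r := Real.sqrt_pos.2 (by positivity)
  have hr2 : r ^ 2 = 2 * ℓ / n := Real.sq_sqrt (by positivity)
  have hr2' : n * r ^ 2 = 2 * ℓ := by rw [hr2]; field_simp
  set l := r / B with hl
  have hl0 : 0 < l := by positivity
  set T := n * (2 * η + B * r) with hT
  have hset : {x : J → X | ∃ i, 2 * η + B * r
        < |∫ x, h i x ∂μ - (n : ℝ)⁻¹ * ∑ j, h i (x j)|}
      ⊆ {x | ∃ i, T < |n * ∫ x, h i x ∂μ - ∑ j, h i (x j)|} := by
    rintro x ⟨i, hi⟩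
    refine ⟨i, ?_⟩
    have : n * ∫ x, h i x ∂μ - ∑ j, h i (x j)
        = n * (∫ x, h i x ∂μ - (n : ℝ)⁻¹ * ∑ j, h i (x j)) := by field_simp
    rw [this, abs_mul, abs_of_pos hn0]
    exact mul_lt_mul_of_pos_left hi hn0
  refine (measure_mono hset).trans ((measure_exists_lt_abs_sub_le μ hl0.le hm
    (fun i x => by rw [abs_of_nonneg (h0 i x)]; exact hB i x) T).trans ?_)
  -- The integral is rewritten as an average over all exchanges, and the Rademacher bound is applied
  -- pointwise. The classes may depend on the sample `w`, because only the signs are random at this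
  -- stage.
  have hbound : 2 ^ n * ∫⁻ w, supExpPair l h w ∂(Measure.pi fun _ : J => μ.prod μ)
      ≤ 2 ^ n * ENNReal.ofReal (2 * K * Real.exp (2 * n * (l * η) + n * (l * B) ^ 2 / 2)) := by
    rw [← sum_lintegral_swapPairs μ (measurable_supExpPair l hm)]
    refine le_of_le_of_eq (lintegral_mono (g := fun _ => 2 ^ n * ENNReal.ofReal
      (2 * K * Real.exp (2 * n * (l * η) + n * (l * B) ^ 2 / 2))) fun w => ?_)
      (by rw [lintegral_const, measure_univ, mul_one])
    obtain ⟨c, hc⟩ := hc (Sum.elim (fun j => (w j).1) fun j => (w j).2)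
    exact sum_supExpPair_swapPairs_le hl0.le h0 hB w c fun i i' hi j =>
      ⟨hc i i' hi (Sum.inl j), hc i i' hi (Sum.inr j)⟩
  have hbound' := (ENNReal.mul_le_mul_iff_right (by positivity) (by simp)).1 hbound
  rw [ENNReal.div_le_iff (by simpa using Real.exp_pos _) ENNReal.ofReal_ne_top,
    ← ENNReal.ofReal_mul hτ0.le]
  refine hbound'.trans (ENNReal.ofReal_le_ofReal (le_of_eq ?_))
  have hlB : l * B = r := by rw [hl]; field_simp
  have e1 : l * T = 2 * n * (l * η) + 2 * ℓ := by
    rw [hT, ← hr2']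
    calc l * (n * (2 * η + B * r)) = 2 * n * (l * η) + n * (l * B) * r := by ring
      _ = _ := by rw [hlB]; ring
  have e2 : 2 * n * (l * η) + n * (l * B) ^ 2 / 2 = 2 * n * (l * η) + ℓ := by rw [hlB, hr2']; ring
  have e3 : Real.exp ℓ = 2 * K / τ := Real.exp_log (by positivity)
  rw [e1, e2, Real.exp_add, Real.exp_add, two_mul ℓ, Real.exp_add, e3]
  field_simp

end Symmetrization

/-- Uniform Monte Carlo error bound for squared residuals `‖r θ ·‖²` depending continuously on a
parameter `θ`, when on any finite sample the residuals fall into at most `K` classes of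
diameter at most `ρ / n`. -/
theorem measure_exists_residual_deviation_le {X Θ E J : Type*} [MeasurableSpace X]
    [TopologicalSpace Θ] [SecondCountableTopology Θ] [NormedAddCommGroup E] [MeasurableSpace E]
    [BorelSpace E] [Fintype J] [Nonempty J] (μ : Measure X) [IsProbabilityMeasure μ]
    {r : Θ → X → E} (hm : ∀ θ, Measurable (r θ)) (hcont : ∀ x, Continuous fun θ => r θ x)
    {ρ : ℝ} (hρ : 0 < ρ) (hr : ∀ θ x, ‖r θ x‖ ≤ ρ) {K : ℕ} (hK : 1 ≤ K)
    (hc : ∀ w : J ⊕ J → X, ∃ c : Θ → Fin K, ∀ θ θ', c θ = c θ' →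
      ∀ j, ‖r θ (w j) - r θ' (w j)‖ ≤ ρ / Fintype.card J)
    {τ : ℝ} (hτ0 : 0 < τ) (hτ1 : τ < 1) :
    (Measure.pi fun _ : J => μ) {x | ∃ θ,
        ρ ^ 2 * (4 / Fintype.card J + √(2 * Real.log (2 * K / τ) / Fintype.card J))
        < |∫ x, ‖r θ x‖ ^ 2 ∂μ - (Fintype.card J : ℝ)⁻¹ * ∑ j, ‖r θ (x j)‖ ^ 2|}
      ≤ ENNReal.ofReal τ := by
  -- The deviation is continuous in `θ`, so the parameters with a deviation above the threshold form
  -- an open set; if it is nonempty, it meets the countable dense set `D`.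
  obtain ⟨D, hDc, hD⟩ := TopologicalSpace.exists_countable_dense Θ
  have : Countable D := hDc.to_subtype
  have hsq : ∀ θ x, ‖r θ x‖ ^ 2 ≤ ρ ^ 2 := fun θ x =>
    pow_le_pow_left₀ (norm_nonneg _) (hr θ x) 2
  have hη : ∀ θ θ' x, ‖r θ x - r θ' x‖ ≤ ρ / Fintype.card J →
      |‖r θ x‖ ^ 2 - ‖r θ' x‖ ^ 2| ≤ 2 * ρ ^ 2 / Fintype.card J := by
    intro θ θ' x h
    have h1 := abs_norm_sub_norm_le (r θ x) (r θ' x)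
    have h2 := hr θ x
    have h3 := hr θ' x
    have h4 := norm_nonneg (r θ x)
    have h5 := norm_nonneg (r θ' x)
    rw [sq_sub_sq, abs_mul, abs_of_nonneg (by linarith : 0 ≤ ‖r θ x‖ + ‖r θ' x‖)]
    calc (‖r θ x‖ + ‖r θ' x‖) * |‖r θ x‖ - ‖r θ' x‖| ≤ (2 * ρ) * (ρ / Fintype.card J) := by
          apply mul_le_mul <;> first | positivity | linarith
      _ = _ := by ring
  refine le_trans (measure_mono fun x hx => ?_) (measure_exists_deviation_le (J := J) (ι := D) μ
    (B := ρ ^ 2) (η := 2 * ρ ^ 2 / Fintype.card J) (by positivity)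
    (h := fun θ x => ‖r θ x‖ ^ 2) (fun θ => (hm θ).norm.pow_const 2) (fun θ x => by positivity)
    (fun θ x => hsq θ x) hK (fun w => ?_) hτ0 hτ1)
  · have hopen : IsOpen {θ : Θ |
        ρ ^ 2 * (4 / Fintype.card J + √(2 * Real.log (2 * K / τ) / Fintype.card J))
        < |∫ x, ‖r θ x‖ ^ 2 ∂μ - (Fintype.card J : ℝ)⁻¹ * ∑ j, ‖r θ (x j)‖ ^ 2|} := by
      refine isOpen_lt continuous_const (continuous_abs.comp (Continuous.sub ?_ ?_))
      · refine continuous_of_dominated (bound := fun _ => ρ ^ 2)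
          (fun θ => ((hm θ).norm.pow_const 2).aestronglyMeasurable)
          (fun θ => ae_of_all _ fun x => ?_) (integrable_const _)
          (ae_of_all _ fun x => (hcont x).norm.pow 2)
        rw [Real.norm_of_nonneg (by positivity)]
        exact hsq θ x
      · exact continuous_const.mul (continuous_finsetSum _ fun j _ => (hcont (x j)).norm.pow 2)
    obtain ⟨θ, hθ, hθD⟩ := hD.inter_open_nonempty _ hopen hx
    refine ⟨⟨θ, hθD⟩, lt_of_le_of_lt (le_of_eq ?_) hθ⟩
    ring
  · obtain ⟨c, hc⟩ := hc w
    exact ⟨fun θ => c θ, fun θ θ' h j => hη _ _ _ (hc _ _ h j)⟩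

/-- The form of the uniform error bound used for the loss terms: the class of integrands is
described by residuals up to a fixed null set, and the sample is given by random variables. -/
theorem exists_bad_set {X Θ E S : Type*} [MeasurableSpace X]
    [TopologicalSpace Θ] [SecondCountableTopology Θ] [NormedAddCommGroup E] [MeasurableSpace E]
    [BorelSpace E] {μ : Measure X} [IsProbabilityMeasure μ] [MeasurableSpace S] {P : Measure S}
    [IsProbabilityMeasure P] {n : ℕ} (hn : 1 ≤ n) {Y : Fin n → S → X}
    (hY : ∀ j, HasLaw (Y j) μ P) (hind : iIndepFun Y P)
    {r : Θ → X → E} (hm : ∀ θ, Measurable (r θ)) (hcont : ∀ x, Continuous fun θ => r θ x)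
    {ρ : ℝ} (hρ : 0 < ρ) (hr : ∀ θ x, ‖r θ x‖ ≤ ρ) {K : ℕ} (hK : 1 ≤ K)
    (hc : ∀ w : Fin n ⊕ Fin n → X, ∃ c : Θ → Fin K, ∀ θ θ', c θ = c θ' →
      ∀ j, ‖r θ (w j) - r θ' (w j)‖ ≤ ρ / n)
    {τ : ℝ} (hτ0 : 0 < τ) (hτ1 : τ < 1) {A : Set X} (hA : ∀ᵐ x ∂μ, x ∈ A)
    {V e : ℝ} (hV : 0 ≤ V)
    (he : (n = 1 ∧ V * ρ ^ 2 ≤ e) ∨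
      V * (ρ ^ 2 * (4 / n + √(2 * Real.log (2 * K / τ) / n))) ≤ e) :
    ∃ N : Set S, P N ≤ ENNReal.ofReal τ ∧ ∀ s ∉ N, ∀ h : X → ℝ,
      (∃ θ, ∀ x ∈ A, h x = ‖r θ x‖ ^ 2) →
        |V * ∫ x, h x ∂μ - (n : ℝ)⁻¹ * V * ∑ j, h (Y j s)| ≤ e := by
  have : Nonempty (Fin n) := ⟨⟨0, hn⟩⟩
  have hYm := fun j => (hY j).aemeasurable
  have hlaw : P.map (fun s j => Y j s) = Measure.pi fun _ : Fin n => μ := by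
    rw [(iIndepFun_iff_map_fun_eq_pi_map hYm).1 hind]
    simp_rw [(hY _).map_eq]
  set t := ρ ^ 2 * (4 / n + √(2 * Real.log (2 * K / τ) / n)) with ht
  set W : Set (Fin n → X) := {x | ∃ θ, t < |∫ x, ‖r θ x‖ ^ 2 ∂μ
    - (n : ℝ)⁻¹ * ∑ j, ‖r θ (x j)‖ ^ 2|} with hW
  have hWτ : (Measure.pi fun _ : Fin n => μ) W ≤ ENNReal.ofReal τ := by
    have := measure_exists_residual_deviation_le (J := Fin n) μ hm hcont hρ hr hK
      (by simpa using hc) hτ0 hτ1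
    simpa only [Fintype.card_fin] using this
  set N₁ : Set S := (fun s j => Y j s) ⁻¹' W
  set N₂ : Set S := {s | ¬ ∀ j, Y j s ∈ A}
  have hN₂ : P N₂ = 0 := by
    refine ae_iff.1 (ae_all_iff.2 fun j => ?_)
    have : ∀ᵐ x ∂(P.map (Y j)), x ∈ A := by rw [(hY j).map_eq]; exact hA
    exact ae_of_ae_map (hYm j) this
  refine ⟨N₁ ∪ N₂, ?_, ?_⟩
  · refine (measure_union_le _ _).trans ?_
    rw [hN₂, add_zero]
    refine le_trans ?_ hWτ
    rw [← hlaw]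
    -- This inequality holds for arbitrary sets, so `W`, a union over uncountably many parameters,
    -- need not be shown measurable.
    exact Measure.le_map_apply (aemeasurable_pi_lambda _ hYm) W
  · rintro s hs h ⟨θ, hθ⟩
    simp only [mem_union, not_or] at hs
    have hYA : ∀ j, Y j s ∈ A := not_not.1 hs.2
    have e1 : ∫ x, h x ∂μ = ∫ x, ‖r θ x‖ ^ 2 ∂μ :=
      integral_congr_ae (hA.mono fun x hx => hθ x hx)
    have e2 : ∑ j, h (Y j s) = ∑ j, ‖r θ (Y j s)‖ ^ 2 :=
      Finset.sum_congr rfl fun j _ => hθ _ (hYA j)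
    have hsq : ∀ x, ‖r θ x‖ ^ 2 ≤ ρ ^ 2 := fun x => pow_le_pow_left₀ (norm_nonneg _) (hr θ x) 2
    rw [e1, e2, show ∀ a b : ℝ, V * a - (n : ℝ)⁻¹ * V * b = V * (a - (n : ℝ)⁻¹ * b) by
      intros; ring, abs_mul, abs_of_nonneg hV]
    -- For one sample point the deviation inequality is not used: the mean and the sampled value
    -- both lie in `[0, ρ ^ 2]`.
    rcases he with ⟨rfl, he⟩ | he
    · refine le_trans (mul_le_mul_of_nonneg_left ?_ hV) he
      have i1 : 0 ≤ ∫ x, ‖r θ x‖ ^ 2 ∂μ := integral_nonneg fun x => by positivity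
      have i2 : ∫ x, ‖r θ x‖ ^ 2 ∂μ ≤ ρ ^ 2 := by
        refine (integral_mono_of_nonneg (ae_of_all _ fun x => by positivity)
          (integrable_const (ρ ^ 2)) (ae_of_all _ hsq)).trans (by simp)
      have i3 := hsq (Y 0 s)
      have i4 : 0 ≤ ‖r θ (Y 0 s)‖ ^ 2 := by positivity
      simp only [Nat.cast_one, inv_one, one_mul, Fin.sum_univ_one]
      rw [abs_le]; constructor <;> linarith
    · refine le_trans (mul_le_mul_of_nonneg_left ?_ hV) he
      by_contra hlt
      exact hs.1 ⟨θ, not_le.1 hlt⟩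

/-! ### Sign patterns of affine functionals -/

/-- Termwise comparison with the binomial expansion of `(q + 1) ^ D`. -/
theorem sum_choose_le (q D : ℕ) : ∑ k ∈ Finset.Iic D, q.choose k ≤ (q + 1) ^ D := by
  rw [add_pow, ← Nat.range_succ_eq_Iic]
  refine Finset.sum_le_sum fun k hk => ?_
  have hk' : k ≤ D := by simpa [Nat.lt_succ_iff] using hk
  rw [one_pow, mul_one, Nat.cast_id]
  calc q.choose k ≤ q ^ k := Nat.choose_le_pow _ _
    _ = q ^ k * 1 := (mul_one _).symm
    _ ≤ _ := Nat.mul_le_mul_left _ (Nat.choose_pos hk')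

/-- The sets on which a family of linear functionals on a space of dimension `D` is positive
shatter no set of more than `D` functionals. -/
theorem card_le_of_shatters_pos {Q κ : Type*} [Fintype κ] [DecidableEq Q]
    (a : Q → κ → ℝ) {𝒜 : Finset (Finset Q)}
    (h𝒜 : ∀ s ∈ 𝒜, ∃ y : κ → ℝ, ∀ q, q ∈ s ↔ 0 < ∑ k, a q k * y k) {s : Finset Q}
    (hs : 𝒜.Shatters s) : s.card ≤ Fintype.card κ := by
  classical
  by_contra hlt
  push Not at hlt
  have hdep : ¬ LinearIndependent ℝ (fun q : s => a q) := by
    intro hli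
    have := hli.fintype_card_le_finrank
    simp at this
    omega
  obtain ⟨g, hg, q₀, hq₀⟩ := Fintype.not_linearIndependent_iff.1 hdep
  -- If `s` is shattered, some `y` makes positive exactly those functionals whose coefficient in the
  -- linear relation is positive. Then every term of the relation evaluated at `y` is nonnegative
  -- and the sum is zero, which excludes a positive coefficient. Negating the relation excludes
  -- negative ones.
  have key : ∀ g : s → ℝ, ∑ q, g q • a q = 0 → ∀ q₀, ¬ 0 < g q₀ := by
    intro g hg q₀ hq₀
    obtain ⟨u, hu, hsu⟩ := hs (t := s.filter fun q => ∃ h : q ∈ s, 0 < g ⟨q, h⟩)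
      (Finset.filter_subset _ _)
    obtain ⟨y, hy⟩ := h𝒜 u hu
    have hpos : ∀ q : s, 0 < g q ↔ 0 < ∑ k, a q k * y k := by
      intro q
      rw [← hy]
      have := Finset.ext_iff.1 hsu q
      simp only [Finset.mem_inter, Finset.mem_filter, q.2, true_and] at this
      rw [this]
      simp
    have hsum : ∑ q, g q * ∑ k, a q k * y k = 0 := by
      have : ∑ q, g q * ∑ k, a q k * y k = ∑ k, (∑ q, g q • a q) k * y k := by
        simp_rw [Finset.sum_apply, Finset.mul_sum, Finset.sum_mul, Pi.smul_apply, smul_eq_mul]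
        rw [Finset.sum_comm]
        exact Finset.sum_congr rfl fun k _ => Finset.sum_congr rfl fun q _ => by ring
      rw [this, hg]; simp
    have hnn : ∀ q ∈ Finset.univ, 0 ≤ g q * ∑ k, a q k * y k := by
      intro q _
      by_cases h : 0 < g q
      · exact (mul_pos h ((hpos q).1 h)).le
      · exact mul_nonneg_of_nonpos_of_nonpos (not_lt.1 h) (not_lt.1 fun h' => h ((hpos q).2 h'))
    have := (Finset.sum_eq_zero_iff_of_nonneg hnn).1 hsum q₀ (Finset.mem_univ _)
    exact (mul_pos hq₀ ((hpos q₀).1 hq₀)).ne' this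
  rcases lt_or_gt_of_ne hq₀ with h | h
  · exact key (-g) (by simpa using hg) q₀ (by simpa using h)
  · exact key g hg q₀ h

/-- On a space of dimension `D`, the number of sign patterns of `q` linear functionals is at most
`(q + 1) ^ D`. -/
theorem exists_sign_pattern {Q κ : Type*} [Fintype Q] [Fintype κ] (a : Q → κ → ℝ) :
    ∃ c : (κ → ℝ) → Fin ((Fintype.card Q + 1) ^ Fintype.card κ), ∀ y y', c y = c y' →
      ∀ q, (0 < ∑ k, a q k * y k ↔ 0 < ∑ k, a q k * y' k) := by
  classical
  set pat : (κ → ℝ) → Finset Q := fun y => Finset.univ.filter fun q => 0 < ∑ k, a q k * y k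
  set 𝒜 : Finset (Finset Q) := Finset.univ.filter fun s => s ∈ Set.range pat
  -- Sauer–Shelah: the number of patterns is at most the number of shattered sets, which have at
  -- most `Fintype.card κ` elements.
  have hcard : 𝒜.card ≤ (Fintype.card Q + 1) ^ Fintype.card κ := by
    refine (Finset.card_le_card_shatterer 𝒜).trans ?_
    have hvc : 𝒜.vcDim ≤ Fintype.card κ := by
      refine Finset.sup_le fun s hs => card_le_of_shatters_pos a (fun t ht => ?_)
        (Finset.mem_shatterer.1 hs)
      obtain ⟨y, rfl⟩ := (Finset.mem_filter.1 ht).2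
      exact ⟨y, fun q => by simp [pat]⟩
    refine Finset.card_shatterer_le_sum_vcDim.trans ((sum_choose_le _ _).trans ?_)
    exact Nat.pow_le_pow_right (Nat.succ_pos _) hvc
  refine ⟨fun y => Fin.castLE hcard (𝒜.equivFin ⟨pat y, by simp [𝒜]⟩), fun y y' h q => ?_⟩
  have h' : pat y = pat y' := by simpa using h
  simpa [pat] using Finset.ext_iff.1 h' q

/-! ### Networks of constant width -/

/-- The linear functional with coefficients `w (some j)`. -/
def lin {a : ℕ} (w : Option (Fin a) → ℝ) (u : Fin a → ℝ) : ℝ := ∑ j, w (some j) * u j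

/-- The affine functional with coefficients `w (some j)` and constant term `w none`. -/
def aff {a : ℕ} (w : Option (Fin a) → ℝ) (u : Fin a → ℝ) : ℝ := w none + lin w u

/-- A `tanh` layer. -/
def act {k a : ℕ} (W : Fin k → Option (Fin a) → ℝ) (u : Fin a → ℝ) : Fin k → ℝ :=
  fun i => Real.tanh (aff (W i) u)

/-- The derivative of a `tanh` layer at `u` in the direction `p`. -/
def dact {k a : ℕ} (W : Fin k → Option (Fin a) → ℝ) (u p : Fin a → ℝ) : Fin k → ℝ :=
  fun i => (1 - act W u i ^ 2) * lin (W i) p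

/-- A composition of `M` `tanh` layers of width `N`. -/
def hid {N : ℕ} : (M : ℕ) → (Fin M → Fin N → Option (Fin N) → ℝ) → (Fin N → ℝ) → Fin N → ℝ
  | 0, _, u => u
  | M + 1, Ws, u => hid M (fun l => Ws l.succ) (act (Ws 0) u)

/-- The derivative of a composition of `tanh` layers at `u` in the direction `p`. -/
def dhid {N : ℕ} : (M : ℕ) → (Fin M → Fin N → Option (Fin N) → ℝ) → (Fin N → ℝ) → (Fin N → ℝ) →
    Fin N → ℝ
  | 0, _, _, p => p
  | M + 1, Ws, u, p => dhid M (fun l => Ws l.succ) (act (Ws 0) u) (dact (Ws 0) u p)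

/-- Positions of the weights of a scalar network with input dimension `d` and `M + 1` hidden layers
of width `N`. -/
abbrev Pos (d N M : ℕ) : Type :=
  (Fin N × Option (Fin d)) ⊕ (Fin M × Fin N × Option (Fin N)) ⊕ Option (Fin N)

/-- The number of nonzero values of `f`. -/
def nz {α : Type*} [Fintype α] (f : α → ℝ) : ℕ := ∑ p, if f p ≠ 0 then 1 else 0

/-- Weights bounded by `R`, at most `N` of them nonzero. -/
abbrev SparseParam (d N M : ℕ) (R : ℝ) : Type :=
  {θ : Pos d N M → ℝ // (∀ p, |θ p| ≤ R) ∧ nz θ ≤ N}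

section Net

variable {d N M : ℕ}

/-- Weights of the first layer. -/
def inputWeights (θ : Pos d N M → ℝ) (i : Fin N) (o : Option (Fin d)) : ℝ := θ (.inl (i, o))

/-- Weights of the further hidden layers. -/
def hiddenWeights (θ : Pos d N M → ℝ) (l : Fin M) (i : Fin N) (o : Option (Fin N)) : ℝ :=
  θ (.inr (.inl (l, i, o)))

/-- Weights of the output layer. -/
def outputWeights (θ : Pos d N M → ℝ) (o : Option (Fin N)) : ℝ := θ (.inr (.inr o))

/-- The output of the first layer. -/
def firstAct (θ : Pos d N M → ℝ) (x : Pt d) : Fin N → ℝ := act (inputWeights θ) fun i => x i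

/-- The network with weights `θ`. -/
def net (θ : Pos d N M → ℝ) (x : Pt d) : ℝ :=
  aff (outputWeights θ) (hid M (hiddenWeights θ) (firstAct θ x))

/-- The partial derivative in the direction of the `c`-th coordinate of the network with
weights `θ`. -/
def dnet (θ : Pos d N M → ℝ) (x : Pt d) (c : Fin d) : ℝ :=
  lin (outputWeights θ) (dhid M (hiddenWeights θ) (firstAct θ x)
    (dact (inputWeights θ) (fun i => x i) (Pi.single c 1)))

end Net

/-! ### Removing inactive neurons -/

/-- `ρ` is injective where it is defined. -/
def PartialInj {α β : Type*} (ρ : α → Option β) : Prop :=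
  ∀ i i' r, ρ i = some r → ρ i' = some r → i = i'

/-- A partial injection is used as a numbering of the neurons or weights to be kept; slots without a
target carry the value zero. Injectivity ensures that nothing is counted twice. -/
theorem sum_elim_eq {α β A : Type*} [Fintype α] [Fintype β] [AddCommMonoid A] {ρ : α → Option β}
    (hρ : PartialInj ρ) (f : β → A) [DecidablePred fun r => ∃ i, ρ i = some r] :
    ∑ i, (ρ i).elim 0 f = ∑ r, if ∃ i, ρ i = some r then f r else 0 := by
  classical
  have h1 : ∀ i, (ρ i).elim 0 f = ∑ r, if ρ i = some r then f r else 0 := by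
    intro i
    cases h : ρ i with
    | none => simp
    | some r => simp
  simp_rw [h1]
  rw [Finset.sum_comm]
  refine Finset.sum_congr rfl fun r _ => ?_
  split_ifs with h
  · obtain ⟨i, hi⟩ := h
    rw [Finset.sum_eq_single i]
    · simp [hi]
    · intro i' _ hne
      rw [if_neg fun h => hne (hρ _ _ _ h hi)]
    · simp
  · push Not at h
    exact Finset.sum_eq_zero fun i _ => if_neg (h i)

theorem sum_elim_le {α β : Type*} [Fintype α] [Fintype β] {ρ : α → Option β}
    (hρ : PartialInj ρ) (f : β → ℕ) : ∑ i, (ρ i).elim 0 f ≤ ∑ r, f r := by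
  classical
  rw [sum_elim_eq hρ]
  exact Finset.sum_le_sum fun r _ => by split_ifs <;> simp

theorem exists_partialInj {κ : Type*} {N : ℕ} (S : Finset κ) (hS : S.card ≤ N) :
    ∃ ρ : Fin N → Option κ, PartialInj ρ ∧ ∀ r ∈ S, ∃ i, ρ i = some r := by
  refine ⟨fun i => if h : (i : ℕ) < S.card then some (S.equivFin.symm ⟨i, h⟩ : κ) else none,
    fun i i' r hi hi' => ?_, fun r hr => ⟨Fin.castLE hS (S.equivFin ⟨r, hr⟩), ?_⟩⟩
  · by_cases h : (i : ℕ) < S.card <;> by_cases h' : (i' : ℕ) < S.card <;>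
      simp only [h, h', dif_pos, dif_neg, not_false_eq_true, reduceCtorEq, Option.some.injEq]
        at hi hi'
    have := S.equivFin.symm.injective (Subtype.ext (hi.trans hi'.symm))
    simpa [Fin.ext_iff] using this
  · simp

theorem ncard_ne_zero_eq {α : Type*} [Fintype α] (f : α → ℝ) :
    Set.ncard {p | f p ≠ 0} = nz f := by
  classical
  rw [nz, Set.ncard_eq_toFinset_card', ← Finset.card_filter]
  congr 1
  ext; simp

theorem layerNnz_eq {a b : ℕ} (A : Matrix (Fin b) (Fin a) ℝ) (v : Fin b → ℝ) :
    layerNnz A v = nz (fun ij : Fin b × Fin a => A ij.1 ij.2) + nz v := by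
  rw [layerNnz, ncard_ne_zero_eq (fun ij : Fin b × Fin a => A ij.1 ij.2), ncard_ne_zero_eq]

theorem sum_elim_mul_elim {ι κ : Type*} [Fintype ι] [Fintype κ] {γ : ι → Option κ}
    (hγ : PartialInj γ) (A u : κ → ℝ) (hu : ∀ j, (¬ ∃ i, γ i = some j) → u j = 0) :
    ∑ j, (γ j).elim 0 A * (γ j).elim 0 u = ∑ c, A c * u c := by
  classical
  have : ∀ j, (γ j).elim 0 A * (γ j).elim 0 u = (γ j).elim 0 fun c => A c * u c := by
    intro j; cases γ j <;> simp
  simp_rw [this]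
  rw [sum_elim_eq hγ]
  refine Finset.sum_congr rfl fun c _ => ?_
  split_ifs with h
  · rfl
  · rw [hu c h, mul_zero]

/-- A neuron whose row and bias vanish outputs `tanh 0 = 0`, so only rows with a nonzero entry are
kept. There are at most as many of these as nonzero entries, so `N` slots suffice. The map `γ` is
the numbering of the incoming neurons and `ρ` that of the outgoing ones; the conclusion that
unnumbered outputs vanish is the hypothesis on `u` for the next layer. -/
theorem exists_layer_compressed {N k a n : ℕ} {R : ℝ} (hR : 0 ≤ R) (A : Matrix (Fin k) (Fin a) ℝ)
    (v : Fin k → ℝ) (hA : ∀ i j, |A i j| ≤ R) (hv : ∀ i, |v i| ≤ R) (hN : layerNnz A v ≤ N)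
    {γ : Fin n → Option (Fin a)} (hγ : PartialInj γ) :
    ∃ (ρ : Fin N → Option (Fin k)) (W : Fin N → Option (Fin n) → ℝ), PartialInj ρ ∧
      (∀ i o, |W i o| ≤ R) ∧ nz (fun p : Fin N × Option (Fin n) => W p.1 p.2) ≤ layerNnz A v ∧
      ∀ u : Fin a → ℝ, (∀ j, (¬ ∃ i, γ i = some j) → u j = 0) →
        (∀ r, (¬ ∃ i, ρ i = some r) → Real.tanh ((A.mulVec u + v) r) = 0) ∧
        (fun i => (ρ i).elim 0 fun r => Real.tanh ((A.mulVec u + v) r))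
          = act W fun j => (γ j).elim 0 u := by
  classical
  set S : Finset (Fin k) := Finset.univ.filter fun r => v r ≠ 0 ∨ ∃ c, A r c ≠ 0 with hS
  have hScard : S.card ≤ N := by
    refine le_trans ?_ hN
    rw [layerNnz_eq, hS, Finset.card_filter, nz, nz, Fintype.sum_prod_type,
      ← Finset.sum_add_distrib]
    refine Finset.sum_le_sum fun r _ => ?_
    split_ifs with h1 h2 h2
    · omega
    · obtain ⟨c, hc⟩ := h1.resolve_left h2
      have := Finset.single_le_sum (f := fun c => if A r c ≠ 0 then 1 else 0)
        (fun c _ => Nat.zero_le _) (Finset.mem_univ c)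
      simp only [hc, ne_eq, not_false_eq_true, if_true] at this
      simpa using this
    · omega
    · omega
  obtain ⟨ρ, hρ, hρS⟩ := exists_partialInj S hScard
  refine ⟨ρ, fun i o => (ρ i).elim 0 fun r => o.elim (v r) fun j => (γ j).elim 0 (A r), hρ,
    fun i o => ?_, ?_, fun u hu => ⟨fun r hr => ?_, ?_⟩⟩
  · beta_reduce
    rcases ρ i with _ | r
    · simpa using hR
    · rcases o with _ | j
      · exact hv r
      · show |(γ j).elim 0 (A r)| ≤ R
        rcases γ j with _ | c
        · simpa using hR
        · exact hA r c
  · rw [layerNnz_eq, nz, nz, nz, Fintype.sum_prod_type, Fintype.sum_prod_type,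
      ← Finset.sum_add_distrib]
    refine le_trans (Finset.sum_le_sum fun i _ => ?_) (sum_elim_le hρ _)
    show (∑ o : Option (Fin n), if ((ρ i).elim 0 fun r => o.elim (v r) fun j =>
      (γ j).elim 0 (A r)) ≠ 0 then 1 else 0) ≤ (ρ i).elim 0 _
    rcases ρ i with _ | r
    · simp
    · rw [Fintype.sum_option, add_comm]
      refine add_le_add ?_ (le_of_eq rfl)
      refine le_trans (Finset.sum_le_sum fun j _ => ?_)
        (sum_elim_le hγ fun c => if A r c ≠ 0 then 1 else 0)
      show (if (γ j).elim 0 (A r) ≠ 0 then 1 else 0) ≤ _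
      rcases γ j with _ | c
      · simp
      · exact le_of_eq rfl
  · have hrS : r ∉ S := fun h => hr (hρS r h)
    simp only [hS, Finset.mem_filter, Finset.mem_univ, true_and, not_or, not_not, not_exists] at hrS
    have : (A.mulVec u + v) r = 0 := by
      simp [Matrix.mulVec, dotProduct, hrS.1, hrS.2]
    rw [this, Real.tanh_zero]
  · funext i
    rw [act, aff, lin]
    rcases ρ i with _ | r
    · simp
    · simp only [Option.elim]
      congr 1
      have := sum_elim_mul_elim hγ (A r) u hu
      simp only [Option.elim] at this
      rw [this, Pi.add_apply, add_comm]
      rfl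

theorem isEmpty_param_zero {a b : ℕ} : Param 0 a b → False := fun θ => nomatch θ

theorem nz_sum {α β : Type*} [Fintype α] [Fintype β] (f : α ⊕ β → ℝ) :
    nz f = nz (fun p => f (.inl p)) + nz fun p => f (.inr p) :=
  Fintype.sum_sum_type _

theorem nz_fin_succ {M : ℕ} {α : Type*} [Fintype α] (f : Fin (M + 1) × α → ℝ) :
    nz f = nz (fun p => f (0, p)) + nz fun p : Fin M × α => f (p.1.succ, p.2) := by
  rw [nz, nz, nz, Fintype.sum_prod_type, Fin.sum_univ_succ, Fintype.sum_prod_type]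

/-- Layer-by-layer compression, with the numbering of each layer handed to the next. The output
layer is kept as it is, with its columns renumbered. -/
theorem exists_tail_compressed {N : ℕ} {R : ℝ} (hR : 0 ≤ R) : ∀ (M k : ℕ) (θ : Param (M + 1) k 1)
    (γ : Fin N → Option (Fin k)), PartialInj γ → θ.BoundedBy R → θ.nnz ≤ N →
    ∃ (Ws : Fin M → Fin N → Option (Fin N) → ℝ) (w : Option (Fin N) → ℝ),
      (∀ l i o, |Ws l i o| ≤ R) ∧ (∀ o, |w o| ≤ R) ∧
      nz (fun p : Fin M × Fin N × Option (Fin N) => Ws p.1 p.2.1 p.2.2) + nz w ≤ θ.nnz ∧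
      ∀ u : Fin k → ℝ, (∀ j, (¬ ∃ i, γ i = some j) → u j = 0) →
        θ.realize u 0 = aff w (hid M Ws fun i => (γ i).elim 0 u) := by
  intro M
  induction M with
  | zero =>
    intro k θ γ hγ hb hn
    cases θ with
    | hidden A v rest => exact (isEmpty_param_zero rest).elim
    | output A v =>
      refine ⟨fun l => l.elim0, fun o => o.elim (v 0) fun j => (γ j).elim 0 (A 0),
        fun l => l.elim0, fun o => ?_, ?_, fun u hu => ?_⟩
      · rcases o with _ | j
        · exact hb.2 0
        · show |(γ j).elim 0 (A 0)| ≤ R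
          rcases γ j with _ | c
          · simpa using hR
          · exact hb.1 0 c
      · rw [Param.nnz, layerNnz_eq, nz, nz, nz, nz, Fintype.sum_prod_type]
        simp only [Finset.univ_eq_empty, Finset.sum_empty, Fintype.sum_prod_type, Fintype.sum_option,
          Fin.sum_univ_one, zero_add]
        rw [add_comm]
        refine add_le_add ?_ le_rfl
        refine le_trans (Finset.sum_le_sum fun j _ => ?_)
          (sum_elim_le hγ fun c => if A 0 c ≠ 0 then 1 else 0)
        show (if (γ j).elim 0 (A 0) ≠ 0 then 1 else 0) ≤ _
        rcases γ j with _ | c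
        · simp
        · exact le_of_eq rfl
      · rw [Param.realize, hid, aff, lin]
        have := sum_elim_mul_elim hγ (A 0) u hu
        simp only [Option.elim] at this ⊢
        rw [this, Pi.add_apply, add_comm]
        rfl
  | succ M ih =>
    intro k θ γ hγ hb hn
    cases θ with
    | hidden A v rest =>
      obtain ⟨⟨hA, hv⟩, hrest⟩ := hb
      rw [Param.nnz] at hn
      obtain ⟨ρ, W, hρ, hW, hWn, hWu⟩ := exists_layer_compressed hR A v hA hv
        (by omega : layerNnz A v ≤ N) hγ
      obtain ⟨Ws, w, hWs, hw, hWsn, hWsu⟩ := ih _ rest ρ hρ hrest (by omega)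
      refine ⟨Fin.cons W Ws, w, fun l => ?_, hw, ?_, fun u hu => ?_⟩
      · refine Fin.cases ?_ (fun l => ?_) l
        · exact hW
        · exact hWs l
      · rw [nz_fin_succ, Param.nnz]
        simp only [Fin.cons_zero, Fin.cons_succ]
        omega
      · obtain ⟨h1, h2⟩ := hWu u hu
        rw [Param.realize, hWsu _ h1, hid, h2]
        simp only [Fin.cons_zero, Fin.cons_succ]

/-- Every network of the class `𝒩(M + 2, N, R)` is realized with hidden layers of width `N`. -/
theorem exists_sparseParam {d N M : ℕ} {R : ℝ} (hR : 0 ≤ R) {q : Pt d → ℝ}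
    (hq : q ∈ netClass d (M + 2) N R) : ∃ θ : SparseParam d N M R, q = net θ.1 := by
  obtain ⟨θ, hn, hb, hθ⟩ := hq
  cases θ with
  | hidden A v rest =>
    obtain ⟨⟨hA, hv⟩, hrest⟩ := hb
    rw [Param.nnz] at hn
    have hγ : PartialInj (some : Fin d → Option (Fin d)) := fun i i' r h h' => by
      simp only [Option.some.injEq] at h h'; rw [h, h']
    obtain ⟨ρ, W, hρ, hW, hWn, hWu⟩ := exists_layer_compressed hR A v hA hv
      (by omega : layerNnz A v ≤ N) hγ
    obtain ⟨Ws, w, hWs, hw, hWsn, hWsu⟩ :=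
      exists_tail_compressed hR M _ rest ρ hρ hrest (by omega)
    refine ⟨⟨Sum.elim (fun p => W p.1 p.2) (Sum.elim (fun p => Ws p.1 p.2.1 p.2.2) w), ?_, ?_⟩, ?_⟩
    · rintro (p | p | p)
      · exact hW _ _
      · exact hWs _ _ _
      · exact hw _
    · rw [nz_sum, nz_sum]
      refine le_trans (add_le_add hWn hWsn) hn
    · funext x
      obtain ⟨h1, h2⟩ := hWu (fun i => x i) fun j hj => absurd ⟨j, rfl⟩ hj
      rw [hθ x, Param.realize, hWsu _ h1, h2]
      rfl

/-! ### The hyperbolic tangent -/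

theorem hasDerivAt_tanh (t : ℝ) : HasDerivAt Real.tanh (1 - Real.tanh t ^ 2) t := by
  have hc := (Real.cosh_pos t).ne'
  have h := (Real.hasDerivAt_sinh t).div (Real.hasDerivAt_cosh t) hc
  have e : Real.tanh = fun t => Real.sinh t / Real.cosh t := funext Real.tanh_eq_sinh_div_cosh
  rw [e]
  refine h.congr_deriv ?_
  field_simp

theorem abs_tanh_le_one (t : ℝ) : |Real.tanh t| ≤ 1 := (Real.abs_tanh_lt_one t).le

theorem continuous_tanh : Continuous Real.tanh :=
  continuous_iff_continuousAt.2 fun t => (hasDerivAt_tanh t).continuousAt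

theorem one_sub_tanh_sq_nonneg (t : ℝ) : 0 ≤ 1 - Real.tanh t ^ 2 := by
  linarith [Real.tanh_sq_lt_one t]

theorem abs_tanh_sub_le (s t : ℝ) : |Real.tanh s - Real.tanh t| ≤ |s - t| := by
  have := convex_univ.norm_image_sub_le_of_norm_hasDerivWithin_le (f := Real.tanh)
    (f' := fun t => 1 - Real.tanh t ^ 2) (C := 1) (x := t) (y := s)
    (fun x _ => (hasDerivAt_tanh x).hasDerivWithinAt) (fun x _ => ?_) (mem_univ _) (mem_univ _)
  · simpa using this
  · rw [Real.norm_of_nonneg (one_sub_tanh_sq_nonneg x)]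
    linarith [sq_nonneg (Real.tanh x)]

/-- The true decay is exponential, but the rate `1 / t` suffices for the saturation argument: larger
thresholds only cost logarithms. -/
theorem one_sub_tanh_le {t : ℝ} (ht : 0 < t) : 1 - Real.tanh t ≤ 1 / t := by
  have h1 : 1 - Real.tanh t = 2 * Real.exp (-t) / (Real.exp t + Real.exp (-t)) := by
    rw [Real.tanh_eq]; field_simp; ring
  have h2 := Real.add_one_le_exp (2 * t)
  have h3 : Real.exp (2 * t) = Real.exp t * Real.exp t := by rw [two_mul, Real.exp_add]
  have h4 : Real.exp t * Real.exp (-t) = 1 := by rw [← Real.exp_add]; simp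
  have h5 := Real.exp_pos (-t)
  rw [h1, div_le_div_iff₀ (by positivity) ht]
  have : 2 * t * Real.exp (-t) ≤ Real.exp t := by
    calc 2 * t * Real.exp (-t) ≤ Real.exp (2 * t) * Real.exp (-t) := by gcongr; linarith
      _ = Real.exp t * (Real.exp t * Real.exp (-t)) := by rw [h3]; ring
      _ = Real.exp t := by rw [h4, mul_one]
  linarith

theorem abs_tanh_sub_le_of_le {T s t : ℝ} (hT : 0 < T) (hs : T ≤ s) (ht : T ≤ t) :
    |Real.tanh s - Real.tanh t| ≤ 1 / T := by
  have h1 := one_sub_tanh_le (hT.trans_le hs)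
  have h2 := one_sub_tanh_le (hT.trans_le ht)
  have h3 := one_div_le_one_div_of_le hT hs
  have h4 := one_div_le_one_div_of_le hT ht
  have h5 := (Real.tanh_lt_one s).le
  have h6 := (Real.tanh_lt_one t).le
  rw [abs_le]; constructor <;> linarith

theorem abs_tanh_sub_le_of_le_neg {T s t : ℝ} (hT : 0 < T) (hs : s ≤ -T) (ht : t ≤ -T) :
    |Real.tanh s - Real.tanh t| ≤ 1 / T := by
  have := abs_tanh_sub_le_of_le hT (le_neg.2 hs) (le_neg.2 ht)
  rwa [Real.tanh_neg, Real.tanh_neg, ← neg_sub', abs_neg] at this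

/-! ### Continuity and differentiability -/

theorem continuous_lin {a : ℕ} :
    Continuous fun p : (Option (Fin a) → ℝ) × (Fin a → ℝ) => lin p.1 p.2 := by
  unfold lin; fun_prop

theorem continuous_aff {a : ℕ} :
    Continuous fun p : (Option (Fin a) → ℝ) × (Fin a → ℝ) => aff p.1 p.2 := by
  unfold aff lin; fun_prop

theorem continuous_act {k a : ℕ} :
    Continuous fun p : (Fin k → Option (Fin a) → ℝ) × (Fin a → ℝ) => act p.1 p.2 := by
  unfold act aff lin
  have := continuous_tanh
  fun_prop

theorem continuous_dact {k a : ℕ} :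
    Continuous fun p : (Fin k → Option (Fin a) → ℝ) × (Fin a → ℝ) × (Fin a → ℝ) =>
      dact p.1 p.2.1 p.2.2 := by
  unfold dact act aff lin
  have := continuous_tanh
  fun_prop

theorem continuous_hid {N : ℕ} (M : ℕ) :
    Continuous fun p : (Fin M → Fin N → Option (Fin N) → ℝ) × (Fin N → ℝ) => hid M p.1 p.2 := by
  induction M with
  | zero => exact continuous_snd
  | succ M ih =>
    exact ih.comp (Continuous.prodMk (by fun_prop)
      (continuous_act.comp (Continuous.prodMk (by fun_prop) continuous_snd)))

theorem continuous_dhid {N : ℕ} (M : ℕ) :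
    Continuous fun p : (Fin M → Fin N → Option (Fin N) → ℝ) × (Fin N → ℝ) × (Fin N → ℝ) =>
      dhid M p.1 p.2.1 p.2.2 := by
  induction M with
  | zero => exact continuous_snd.comp continuous_snd
  | succ M ih =>
    exact ih.comp (Continuous.prodMk (by fun_prop) (Continuous.prodMk
      (continuous_act.comp (Continuous.prodMk (by fun_prop) (by fun_prop)))
      (continuous_dact.comp (Continuous.prodMk (by fun_prop) (by fun_prop)))))

section Net

variable {d N M : ℕ}

theorem continuous_weights :
    Continuous (inputWeights (d := d) (N := N) (M := M)) ∧
    Continuous (hiddenWeights (d := d) (N := N) (M := M)) ∧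
    Continuous (outputWeights (d := d) (N := N) (M := M)) := by
  unfold inputWeights hiddenWeights outputWeights
  refine ⟨?_, ?_, ?_⟩ <;> fun_prop

theorem continuous_coords : Continuous fun p : (Pos d N M → ℝ) × Pt d => (fun i => p.2 i) := by
  fun_prop

theorem continuous_firstAct :
    Continuous fun p : (Pos d N M → ℝ) × Pt d => firstAct p.1 p.2 :=
  Continuous.comp (f := fun p : (Pos d N M → ℝ) × Pt d => (inputWeights p.1, fun i => p.2 i))
    continuous_act ((continuous_weights.1.comp continuous_fst).prodMk continuous_coords)

theorem continuous_net : Continuous fun p : (Pos d N M → ℝ) × Pt d => net p.1 p.2 := by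
  have h := Continuous.comp
    (f := fun p : (Pos d N M → ℝ) × Pt d => (hiddenWeights p.1, firstAct p.1 p.2))
    (continuous_hid M) ((continuous_weights.2.1.comp continuous_fst).prodMk continuous_firstAct)
  exact Continuous.comp (f := fun p : (Pos d N M → ℝ) × Pt d =>
    (outputWeights p.1, hid M (hiddenWeights p.1) (firstAct p.1 p.2))) continuous_aff
    ((continuous_weights.2.2.comp continuous_fst).prodMk h)

theorem continuous_dnet (c : Fin d) :
    Continuous fun p : (Pos d N M → ℝ) × Pt d => dnet p.1 p.2 c := by
  have h1 := Continuous.comp (f := fun p : (Pos d N M → ℝ) × Pt d =>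
    (inputWeights p.1, (fun i => p.2 i : Fin d → ℝ), (Pi.single c 1 : Fin d → ℝ))) continuous_dact
    ((continuous_weights.1.comp continuous_fst).prodMk
      (continuous_coords.prodMk continuous_const))
  have h2 := Continuous.comp (f := fun p : (Pos d N M → ℝ) × Pt d =>
    (hiddenWeights p.1, firstAct p.1 p.2,
      dact (inputWeights p.1) (fun i => p.2 i) (Pi.single c 1))) (continuous_dhid M)
    ((continuous_weights.2.1.comp continuous_fst).prodMk (continuous_firstAct.prodMk h1))
  exact Continuous.comp (f := fun p : (Pos d N M → ℝ) × Pt d =>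
    (outputWeights p.1, dhid M (hiddenWeights p.1) (firstAct p.1 p.2)
      (dact (inputWeights p.1) (fun i => p.2 i) (Pi.single c 1)))) continuous_lin
    ((continuous_weights.2.2.comp continuous_fst).prodMk h2)

theorem hasFDerivAt_aff {E : Type*} [NormedAddCommGroup E] [NormedSpace ℝ E] {a : ℕ}
    (w : Option (Fin a) → ℝ) {u : E → Fin a → ℝ} {u' : Fin a → E →L[ℝ] ℝ} {x : E}
    (hu : ∀ j, HasFDerivAt (fun x => u x j) (u' j) x) :
    HasFDerivAt (fun x => aff w (u x)) (∑ j, w (some j) • u' j) x := by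
  unfold aff lin
  exact (HasFDerivAt.fun_sum fun j _ => (hu j).const_mul _).const_add _

theorem sum_smul_apply_eq_lin {E : Type*} [NormedAddCommGroup E] [NormedSpace ℝ E] {a : ℕ}
    (w : Option (Fin a) → ℝ) (u' : Fin a → E →L[ℝ] ℝ) (e : E) :
    (∑ j, w (some j) • u' j) e = lin w fun j => u' j e := by
  simp [lin]

theorem hasFDerivAt_act {E : Type*} [NormedAddCommGroup E] [NormedSpace ℝ E] {k a : ℕ}
    (W : Fin k → Option (Fin a) → ℝ) {u : E → Fin a → ℝ} {u' : Fin a → E →L[ℝ] ℝ} {x : E}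
    (hu : ∀ j, HasFDerivAt (fun x => u x j) (u' j) x) :
    ∃ v' : Fin k → E →L[ℝ] ℝ, (∀ i, HasFDerivAt (fun x => act W (u x) i) (v' i) x) ∧
      ∀ e, (fun i => v' i e) = dact W (u x) fun j => u' j e := by
  refine ⟨fun i => (1 - act W (u x) i ^ 2) • ∑ j, W i (some j) • u' j, fun i => ?_, fun e => ?_⟩
  · exact (hasDerivAt_tanh _).comp_hasFDerivAt x (hasFDerivAt_aff (W i) hu)
  · funext i
    rw [_root_.smul_apply, sum_smul_apply_eq_lin, dact, smul_eq_mul]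

/-- The chain rule, stated for an arbitrary inner function `u` so that the induction can absorb one
layer into it. -/
theorem hasFDerivAt_hid {E : Type*} [NormedAddCommGroup E] [NormedSpace ℝ E] {x : E} :
    ∀ (M : ℕ) (Ws : Fin M → Fin N → Option (Fin N) → ℝ) {u : E → Fin N → ℝ}
    {u' : Fin N → E →L[ℝ] ℝ}, (∀ j, HasFDerivAt (fun x => u x j) (u' j) x) →
    ∃ v' : Fin N → E →L[ℝ] ℝ, (∀ i, HasFDerivAt (fun x => hid M Ws (u x) i) (v' i) x) ∧
      ∀ e, (fun i => v' i e) = dhid M Ws (u x) fun j => u' j e := by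
  intro M
  induction M with
  | zero => exact fun _ u u' hu => ⟨u', hu, fun e => rfl⟩
  | succ M ih =>
    intro Ws u u' hu
    obtain ⟨v', hv, hv'⟩ := hasFDerivAt_act (Ws 0) hu
    obtain ⟨t', ht, ht'⟩ := ih (fun l => Ws l.succ) hv
    exact ⟨t', ht, fun e => by rw [ht', hv', dhid]⟩

theorem hasFDerivAt_net (θ : Pos d N M → ℝ) (x : Pt d) :
    ∃ v' : Pt d →L[ℝ] ℝ, HasFDerivAt (net θ) v' x ∧
      ∀ c, v' (EuclideanSpace.single c 1) = dnet θ x c := by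
  have h0 : ∀ j, HasFDerivAt (fun x : Pt d => (fun i => x i : Fin d → ℝ) j)
      (EuclideanSpace.proj (𝕜 := ℝ) j) x := fun j =>
    (EuclideanSpace.proj (𝕜 := ℝ) j : Pt d →L[ℝ] ℝ).hasFDerivAt
  obtain ⟨u', hu, hu'⟩ := hasFDerivAt_act (inputWeights θ) h0
  obtain ⟨v', hv, hv'⟩ := hasFDerivAt_hid M (hiddenWeights θ) hu
  refine ⟨_, hasFDerivAt_aff (outputWeights θ) hv, fun c => ?_⟩
  rw [sum_smul_apply_eq_lin, hv', hu', dnet, firstAct]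
  congr 2

theorem fderiv_net (θ : Pos d N M → ℝ) (x : Pt d) (c : Fin d) :
    fderiv ℝ (net θ) x (EuclideanSpace.single c 1) = dnet θ x c := by
  obtain ⟨v', hv, hv'⟩ := hasFDerivAt_net θ x
  rw [hv.fderiv, hv']

theorem gradient_net_apply (θ : Pos d N M → ℝ) (x : Pt d) (c : Fin d) :
    gradient (net θ) x c = dnet θ x c := by
  rw [← fderiv_net, gradient, ← InnerProductSpace.toDual_symm_apply (𝕜 := ℝ),
    EuclideanSpace.inner_single_right]
  simp

/-! ### Bounds and dependence on the weights -/

theorem abs_lin_le {a : ℕ} {R D : ℝ} (hR : 0 ≤ R) {w : Option (Fin a) → ℝ} {p : Fin a → ℝ}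
    (hw : ∀ o, |w o| ≤ R) (hp : ∀ j, |p j| ≤ D) : |lin w p| ≤ a * (R * D) := by
  refine (Finset.abs_sum_le_sum_abs _ _).trans ((Finset.sum_le_sum (g := fun _ => R * D)
    fun j _ => ?_).trans (le_of_eq (by simp)))
  rw [abs_mul]
  exact mul_le_mul (hw _) (hp j) (abs_nonneg _) hR

theorem abs_lin_sub_le {a : ℕ} {R D δ ζ : ℝ} (hR : 0 ≤ R) (hδ : 0 ≤ δ)
    {w w' : Option (Fin a) → ℝ} {p p' : Fin a → ℝ} (hw' : ∀ o, |w' o| ≤ R)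
    (hww : ∀ o, |w o - w' o| ≤ δ) (hp : ∀ j, |p j| ≤ D) (hpp : ∀ j, |p j - p' j| ≤ ζ) :
    |lin w p - lin w' p'| ≤ a * (δ * D + R * ζ) := by
  rw [lin, lin, ← Finset.sum_sub_distrib]
  refine (Finset.abs_sum_le_sum_abs _ _).trans ((Finset.sum_le_sum (g := fun _ => δ * D + R * ζ)
    fun j _ => ?_).trans (le_of_eq (by simp [mul_add])))
  have e : w (some j) * p j - w' (some j) * p' j
      = (w (some j) - w' (some j)) * p j + w' (some j) * (p j - p' j) := by ring
  rw [e]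
  refine (abs_add_le _ _).trans (add_le_add ?_ ?_)
  · rw [abs_mul]; exact mul_le_mul (hww _) (hp j) (abs_nonneg _) hδ
  · rw [abs_mul]; exact mul_le_mul (hw' _) (hpp j) (abs_nonneg _) hR

theorem abs_act_le {k a : ℕ} (W : Fin k → Option (Fin a) → ℝ) (u : Fin a → ℝ) (i : Fin k) :
    |act W u i| ≤ 1 := abs_tanh_le_one _

theorem abs_mul_one_sub_sq_le {s t : ℝ} (hs : |s| ≤ 1) : |(1 - s ^ 2) * t| ≤ |t| := by
  have h := abs_le.1 hs
  rw [abs_mul]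
  refine mul_le_of_le_one_left (abs_nonneg _) ?_
  rw [abs_le]; constructor <;> nlinarith

theorem abs_hid_le : ∀ (M : ℕ) (Ws : Fin M → Fin N → Option (Fin N) → ℝ) {u : Fin N → ℝ},
    (∀ j, |u j| ≤ 1) → ∀ i, |hid M Ws u i| ≤ 1 := by
  intro M
  induction M with
  | zero => exact fun _ u hu => hu
  | succ M ih => exact fun Ws u _ => ih _ (abs_act_le _ _)

theorem abs_dhid_le {R : ℝ} (hR : 0 ≤ R) :
    ∀ (M : ℕ) (Ws : Fin M → Fin N → Option (Fin N) → ℝ) {u p : Fin N → ℝ} {D : ℝ},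
    (∀ l i o, |Ws l i o| ≤ R) → (∀ j, |p j| ≤ D) → ∀ i, |dhid M Ws u p i| ≤ (N * R) ^ M * D := by
  intro M
  induction M with
  | zero => intro Ws u p D _ hp i; simpa [dhid] using hp i
  | succ M ih =>
    intro Ws u p D hW hp i
    have := ih (fun l => Ws l.succ) (u := act (Ws 0) u) (p := dact (Ws 0) u p) (D := N * (R * D))
      (fun l => hW l.succ) (fun j => (abs_mul_one_sub_sq_le (abs_act_le _ _ _)).trans
        (abs_lin_le hR (hW 0 j) hp)) i
    refine this.trans (le_of_eq ?_)
    ring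

theorem abs_dact_sub_le {k a : ℕ} {R D δ ζ η : ℝ} (hR : 0 ≤ R) (hδ : 0 ≤ δ)
    {W W' : Fin k → Option (Fin a) → ℝ} {u u' p p' : Fin a → ℝ}
    (hW : ∀ i o, |W i o| ≤ R) (hW' : ∀ i o, |W' i o| ≤ R) (hWW : ∀ i o, |W i o - W' i o| ≤ δ)
    (hp : ∀ j, |p j| ≤ D) (hpp : ∀ j, |p j - p' j| ≤ ζ) (i : Fin k)
    (hu : |act W u i - act W' u' i| ≤ η) :
    |dact W u p i - dact W' u' p' i| ≤ a * (δ * D + R * ζ) + 2 * η * (a * (R * D)) := by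
  have h1 := abs_lin_sub_le hR hδ (hW' i) (hWW i) hp hpp
  have h2 := abs_lin_le hR (hW i) hp
  set s := act W u i
  set s' := act W' u' i
  have hs := abs_le.1 (abs_act_le W u i)
  have hs' := abs_le.1 (abs_act_le W' u' i)
  have e : dact W u p i - dact W' u' p' i
      = (1 - s' ^ 2) * (lin (W i) p - lin (W' i) p') + (s' ^ 2 - s ^ 2) * lin (W i) p := by
    simp only [dact, s, s']; ring
  rw [e]
  refine (abs_add_le _ _).trans (add_le_add ?_ ?_)
  · exact (abs_mul_one_sub_sq_le (abs_act_le W' u' i)).trans h1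
  · rw [abs_mul]
    refine mul_le_mul ?_ h2 (abs_nonneg _) (by linarith [(abs_nonneg _).trans hu])
    rw [sq_sub_sq, abs_mul, abs_sub_comm s' s]
    refine mul_le_mul ?_ hu (abs_nonneg _) zero_le_two
    rw [abs_le]; constructor <;> linarith [hs.1, hs.2, hs'.1, hs'.2]

/-- Values and derivatives are treated in one induction. The derivative error is kept in the product
form `D * E`, where `D` bounds the tangent vector and `E` the error of the values; a layer turns `D`
into `N * R * D` and `E` into `8 * N * R * E`, so the form is preserved. -/
theorem hid_sub_le {R δ : ℝ} (hN : 1 ≤ N) (hR : 1 ≤ R) (hδ : 0 ≤ δ) :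
    ∀ (M : ℕ) (Ws Ws' : Fin M → Fin N → Option (Fin N) → ℝ) {u u' p p' : Fin N → ℝ} {D E : ℝ},
    (∀ l i o, |Ws l i o| ≤ R) → (∀ l i o, |Ws' l i o| ≤ R) →
    (∀ l i o, |Ws l i o - Ws' l i o| ≤ δ) → (∀ j, |u j| ≤ 1) → (∀ j, |p j| ≤ D) →
    (∀ j, |u j - u' j| ≤ E) → (∀ j, |p j - p' j| ≤ D * E) → 0 ≤ D → δ ≤ E →
    ∀ i, |hid M Ws u i - hid M Ws' u' i| ≤ (8 * N * R) ^ M * E ∧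
      |dhid M Ws u p i - dhid M Ws' u' p' i| ≤ ((N * R) ^ M * D) * ((8 * N * R) ^ M * E) := by
  have hN' : (1 : ℝ) ≤ N := by exact_mod_cast hN
  have hNR : 1 ≤ N * R := one_le_mul_of_one_le_of_one_le hN' hR
  have hR0 : 0 ≤ R := zero_le_one.trans hR
  intro M
  induction M with
  | zero => intro Ws Ws' u u' p p' D E _ _ _ _ _ huu hpp _ _ i; simpa [hid, dhid] using
      ⟨huu i, hpp i⟩
  | succ M ih =>
    intro Ws Ws' u u' p p' D E hW hW' hWW hu hp huu hpp hD hE i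
    have hE0 : 0 ≤ E := hδ.trans hE
    have hact : ∀ j, |act (Ws 0) u j - act (Ws' 0) u' j| ≤ 3 * (N * R * E) := by
      intro j
      refine (abs_tanh_sub_le _ _).trans ?_
      have h1 := abs_lin_sub_le hR0 hδ (hW' 0 j) (hWW 0 j) hu huu
      have h2 := hWW 0 j none
      have e : aff (Ws 0 j) u - aff (Ws' 0 j) u'
          = (Ws 0 j none - Ws' 0 j none) + (lin (Ws 0 j) u - lin (Ws' 0 j) u') := by
        simp only [aff]; ring
      rw [e]
      refine (abs_add_le _ _).trans ((add_le_add h2 h1).trans ?_)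
      have h3 : E ≤ N * R * E := le_mul_of_one_le_left hE0 hNR
      have h4 : N * δ ≤ N * R * E := by
        rw [mul_assoc]
        exact mul_le_mul_of_nonneg_left (hE.trans (le_mul_of_one_le_left hE0 hR)) (by linarith)
      linarith
    have hNRE : E ≤ N * R * E := le_mul_of_one_le_left hE0 hNR
    -- The factor `8` is `1 + 1 + 6`: the change of the weights, the change of the tangent vector,
    -- and twice the error `3 * (N * R * E)` of the activations, from the factor `1 - s ^ 2`.
    have hdact : ∀ j, |dact (Ws 0) u p j - dact (Ws' 0) u' p' j|
        ≤ (N * R * D) * (8 * N * R * E) := by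
      intro j
      refine (abs_dact_sub_le hR0 hδ (hW 0) (hW' 0) (hWW 0) hp hpp j (hact j)).trans ?_
      have h1 : N * (δ * D) ≤ (N * R * D) * (N * R * E) := by
        have : δ * D ≤ (R * D) * (N * R * E) := by
          rw [mul_comm δ]
          exact mul_le_mul (le_mul_of_one_le_left hD hR) (hE.trans hNRE) hδ (by positivity)
        calc N * (δ * D) ≤ N * ((R * D) * (N * R * E)) :=
              mul_le_mul_of_nonneg_left this (by linarith)
          _ = _ := by ring
      have h2 : N * (R * (D * E)) ≤ (N * R * D) * (N * R * E) := by
        calc N * (R * (D * E)) = (N * R * D) * E := by ring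
          _ ≤ _ := mul_le_mul_of_nonneg_left hNRE (by positivity)
      nlinarith
    have := ih (fun l => Ws l.succ) (fun l => Ws' l.succ) (D := N * R * D) (E := 8 * N * R * E)
      (fun l => hW l.succ) (fun l => hW' l.succ) (fun l => hWW l.succ) (abs_act_le (Ws 0) u)
      (fun j => ((abs_mul_one_sub_sq_le (abs_act_le (Ws 0) u j)).trans
        (abs_lin_le hR0 (hW 0 j) hp)).trans (le_of_eq (by ring)))
      (fun j => (hact j).trans (by nlinarith)) hdact (by positivity)
      (hE.trans (by nlinarith)) i
    refine ⟨this.1.trans (le_of_eq (by ring)), this.2.trans (le_of_eq (by ring))⟩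

theorem abs_net_le {R : ℝ} (hN : 1 ≤ N) (hR : 1 ≤ R) {θ : Pos d N M → ℝ} (hθ : ∀ p, |θ p| ≤ R)
    (x : Pt d) : |net θ x| ≤ 2 * (N * R) := by
  have hN' : (1 : ℝ) ≤ N := by exact_mod_cast hN
  have h1 := abs_lin_le (by linarith : 0 ≤ R) (w := outputWeights θ) (fun o => hθ _)
    (abs_hid_le M (hiddenWeights θ) (u := firstAct θ x) (abs_act_le _ _))
  rw [net, aff]
  refine (abs_add_le _ _).trans ((add_le_add (hθ _) h1).trans ?_)
  nlinarith

theorem abs_lin_single_le {a : ℕ} {R : ℝ} {w : Option (Fin a) → ℝ} (hw : ∀ o, |w o| ≤ R)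
    (c : Fin a) : |lin w (Pi.single c 1)| ≤ R := by
  simpa [lin, Pi.single_apply] using hw (some c)

theorem abs_dact_single_le {k a : ℕ} {R : ℝ} {W : Fin k → Option (Fin a) → ℝ}
    (hW : ∀ i o, |W i o| ≤ R) (u : Fin a → ℝ) (c : Fin a) (i : Fin k) :
    |dact W u (Pi.single c 1) i| ≤ R :=
  (abs_mul_one_sub_sq_le (abs_act_le _ _ _)).trans (abs_lin_single_le (hW i) c)

/-- As `tanh' ≤ 1`, each of the `M + 2` weight layers contributes a factor `R`, and each sum over
neurons a factor `N`. The input layer acts on a coordinate vector, so it contributes no sum and no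
factor depending on `d`. -/
theorem abs_dnet_le {R : ℝ} (hR : 1 ≤ R) {θ : Pos d N M → ℝ} (hθ : ∀ p, |θ p| ≤ R) (x : Pt d)
    (c : Fin d) : |dnet θ x c| ≤ R ^ (M + 2) * N ^ (M + 1) := by
  have hR0 : 0 ≤ R := by linarith
  refine (abs_lin_le hR0 (w := outputWeights θ) (fun o => hθ _)
    (abs_dhid_le hR0 M (hiddenWeights θ) (fun l i o => hθ _)
      (abs_dact_single_le (W := inputWeights θ) (fun i o => hθ _) _ c))).trans (le_of_eq ?_)
  ring

/-- Networks with close weights and close first layers are close, and so are their derivatives. -/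
theorem net_sub_le {R δ : ℝ} (hN : 1 ≤ N) (hR : 1 ≤ R) (hδ : 0 ≤ δ) {θ θ' : Pos d N M → ℝ}
    (hθ : ∀ p, |θ p| ≤ R) (hθ' : ∀ p, |θ' p| ≤ R) (hθθ : ∀ p, |θ p - θ' p| ≤ δ) (x : Pt d)
    (hx : ∀ i, |firstAct θ x i - firstAct θ' x i| ≤ δ) :
    |net θ x - net θ' x| ≤ 3 * (8 * N * R) ^ (2 * (M + 2)) * δ ∧
      ∀ c, |dnet θ x c - dnet θ' x c| ≤ 3 * (8 * N * R) ^ (2 * (M + 2)) * δ := by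
  have hN' : (1 : ℝ) ≤ N := by exact_mod_cast hN
  have hNR : 1 ≤ N * R := one_le_mul_of_one_le_of_one_le hN' hR
  have h8 : 1 ≤ 8 * N * R := by linarith
  have hR0 : 0 ≤ R := zero_le_one.trans hR
  -- The factor `3` accommodates the derivative of the first layer, whose error is at most `δ + 2 *
  -- δ * R ≤ R * E`.
  set E := 3 * δ with hE
  have hE0 : 0 ≤ E := by positivity
  set Q := (8 * N * R) ^ M * E with hQ
  have hEQ : E ≤ Q := le_mul_of_one_le_left hE0 (one_le_pow₀ h8)
  have hdQ : δ ≤ Q := by linarith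
  have hQ0 : 0 ≤ Q := hE0.trans hEQ
  -- In a coordinate direction this derivative is `(1 - s ^ 2)` times a single weight, with `s` the
  -- neuron's output; the size of `x` does not enter.
  have hfirst : ∀ c i, |dact (inputWeights θ) (fun i => x i) (Pi.single c 1) i
      - dact (inputWeights θ') (fun i => x i) (Pi.single c 1) i| ≤ R * E := by
    intro c i
    have hs := abs_le.1 (abs_act_le (inputWeights θ) (fun i => x i) i)
    have hs' := abs_le.1 (abs_act_le (inputWeights θ') (fun i => x i) i)
    have hi := hx i
    simp only [firstAct] at hi
    set s := act (inputWeights θ) (fun i => x i) i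
    set s' := act (inputWeights θ') (fun i => x i) i
    have hl : ∀ W : Fin N → Option (Fin d) → ℝ, lin (W i) (Pi.single c 1) = W i (some c) := by
      intro W; simp [lin, Pi.single_apply]
    have e : dact (inputWeights θ) (fun i => x i) (Pi.single c 1) i
        - dact (inputWeights θ') (fun i => x i) (Pi.single c 1) i
        = (1 - s' ^ 2) * (inputWeights θ i (some c) - inputWeights θ' i (some c))
          + (s' ^ 2 - s ^ 2) * inputWeights θ i (some c) := by
      simp only [dact, hl, s, s']; ring
    rw [e]
    have h1 : |(1 - s' ^ 2) * (inputWeights θ i (some c) - inputWeights θ' i (some c))| ≤ δ :=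
      (abs_mul_one_sub_sq_le (abs_act_le _ _ _)).trans (hθθ _)
    have h2 : |(s' ^ 2 - s ^ 2) * inputWeights θ i (some c)| ≤ (2 * δ) * R := by
      rw [abs_mul]
      refine mul_le_mul ?_ (hθ _) (abs_nonneg _) (by positivity)
      rw [sq_sub_sq, abs_mul, abs_sub_comm s' s]
      refine mul_le_mul ?_ hi (abs_nonneg _) zero_le_two
      rw [abs_le]; constructor <;> linarith [hs.1, hs.2, hs'.1, hs'.2]
    refine (abs_add_le _ _).trans ((add_le_add h1 h2).trans ?_)
    have : δ ≤ δ * R := le_mul_of_one_le_right hδ hR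
    rw [hE]; linarith
  have key := fun c => hid_sub_le hN hR hδ M (hiddenWeights θ) (hiddenWeights θ')
    (u := firstAct θ x) (u' := firstAct θ' x)
    (p := dact (inputWeights θ) (fun i => x i) (Pi.single c 1))
    (p' := dact (inputWeights θ') (fun i => x i) (Pi.single c 1)) (D := R) (E := E)
    (fun l i o => hθ _) (fun l i o => hθ' _) (fun l i o => hθθ _) (abs_act_le _ _)
    (abs_dact_single_le (fun i o => hθ _) _ c) (fun j => (hx j).trans (by linarith))
    (hfirst c) hR0 (by linarith)
  have hpow : 2 * ((N * R) ^ (M + 1) * R) ≤ (8 * N * R) ^ (M + 2) := by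
    calc 2 * ((N * R) ^ (M + 1) * R) = (N * R) ^ (M + 1) * (2 * R) := by ring
      _ ≤ (8 * N * R) ^ (M + 1) * (8 * N * R) := by gcongr <;> nlinarith
      _ = _ := by ring
  have hnet : |net θ x - net θ' x| ≤ 3 * (N * R) * Q := by
    have key := hid_sub_le hN hR hδ M (hiddenWeights θ) (hiddenWeights θ')
      (u := firstAct θ x) (u' := firstAct θ' x) (p := 0) (p' := 0) (D := 0) (E := E)
      (fun l i o => hθ _) (fun l i o => hθ' _) (fun l i o => hθθ _) (abs_act_le _ _)
      (fun j => by simp) (fun j => (hx j).trans (by linarith)) (fun j => by simp) le_rfl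
      (by linarith)
    have h1 := abs_lin_sub_le hR0 hδ (w := outputWeights θ) (w' := outputWeights θ')
      (fun o => hθ' _) (fun o => hθθ _)
      (abs_hid_le M (hiddenWeights θ) (u := firstAct θ x) (abs_act_le _ _))
      (fun j => (key j).1)
    have e : net θ x - net θ' x = (outputWeights θ none - outputWeights θ' none)
        + (lin (outputWeights θ) (hid M (hiddenWeights θ) (firstAct θ x))
          - lin (outputWeights θ') (hid M (hiddenWeights θ') (firstAct θ' x))) := by
      simp only [net, aff]; ring
    rw [e]
    refine (abs_add_le _ _).trans ((add_le_add (hθθ _) h1).trans ?_)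
    have h3 : N * (δ * 1) ≤ N * R * Q := by
      rw [mul_assoc, mul_one]
      exact mul_le_mul_of_nonneg_left (hdQ.trans (le_mul_of_one_le_left hQ0 hR)) (by linarith)
    have h4 : δ ≤ N * R * Q := hdQ.trans (le_mul_of_one_le_left hQ0 hNR)
    linarith
  have e1 : 3 * (N * R) * Q ≤ 3 * (8 * N * R) ^ (2 * (M + 2)) * δ := by
    have h1 : (8 * N * R) ^ (M + 1) ≤ (8 * N * R) ^ (2 * (M + 2)) :=
      pow_le_pow_right₀ h8 (by omega)
    have h2 : 3 * (N * R) * (8 * N * R) ^ M ≤ (8 * N * R) ^ (M + 1) := by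
      rw [pow_succ']
      exact mul_le_mul_of_nonneg_right (by linarith) (by positivity)
    calc 3 * (N * R) * Q = (3 * (N * R) * (8 * N * R) ^ M) * E := by rw [hQ]; ring
      _ ≤ (8 * N * R) ^ (2 * (M + 2)) * E := mul_le_mul_of_nonneg_right (h2.trans h1) hE0
      _ = _ := by rw [hE]; ring
  refine ⟨hnet.trans e1, fun c => ?_⟩
  have h1 := abs_lin_sub_le hR0 hδ (w := outputWeights θ) (w' := outputWeights θ')
    (fun o => hθ' _) (fun o => hθθ _)
    (abs_dhid_le hR0 M (hiddenWeights θ) (u := firstAct θ x) (fun l i o => hθ _)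
      (abs_dact_single_le (W := inputWeights θ) (fun i o => hθ _) (fun i => x i) c))
    (fun j => (key c j).2)
  have h2 : δ ≤ R * Q := hdQ.trans (le_mul_of_one_le_left hQ0 hR)
  have h3 : (8 * N * R) ^ M ≤ (8 * N * R) ^ (M + 2) := pow_le_pow_right₀ h8 (by omega)
  calc |dnet θ x c - dnet θ' x c|
      ≤ N * (δ * ((N * R) ^ M * R) + R * ((N * R) ^ M * R * Q)) := h1
    _ ≤ N * ((R * Q) * ((N * R) ^ M * R) + R * ((N * R) ^ M * R * Q)) := by gcongr
    _ = (2 * ((N * R) ^ (M + 1) * R)) * (8 * N * R) ^ M * E := by rw [hQ]; ring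
    _ ≤ (8 * N * R) ^ (M + 2) * (8 * N * R) ^ (M + 2) * E := by gcongr
    _ = _ := by rw [hE]; ring

end Net

/-! ### Classes of close networks on a sample -/

/-- Two numbers in the same position with respect to the grid `(r - Q) / k`, `r ≤ 2 Q`, are close or
both beyond the same end of the grid. -/
theorem abs_sub_le_or_of_grid {k Q : ℕ} (hk : 1 ≤ k) {s s' : ℝ}
    (h : ∀ r : Fin (2 * Q + 1), ((r : ℝ) - Q) / k < s ↔ ((r : ℝ) - Q) / k < s') :
    |s - s'| ≤ 1 / k ∨ ((Q : ℝ) / k ≤ s ∧ (Q : ℝ) / k ≤ s') ∨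
      (s ≤ -((Q : ℝ) / k) ∧ s' ≤ -((Q : ℝ) / k)) := by
  have hk0 : (0 : ℝ) < k := by exact_mod_cast hk
  by_cases h1 : (Q : ℝ) / k < s
  · refine Or.inr (Or.inl ⟨h1.le, ?_⟩)
    have := h ⟨2 * Q, by omega⟩
    push_cast at this
    rw [show (2 * (Q : ℝ) - Q) = Q by ring] at this
    exact (this.1 h1).le
  by_cases h2 : s ≤ -((Q : ℝ) / k)
  · refine Or.inr (Or.inr ⟨h2, ?_⟩)
    have := h ⟨0, by omega⟩
    simp only [Nat.cast_zero, zero_sub, neg_div] at this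
    exact not_lt.1 fun h3 => not_lt.2 h2 (this.2 h3)
  left
  push Not at h1 h2
  rw [le_div_iff₀ hk0] at h1
  rw [← neg_div, div_lt_iff₀ hk0] at h2
  -- The grid cell `(m / k, (m + 1) / k]` containing `s`; both of its ends are grid points, so `s'`
  -- lies in it too.
  set m : ℤ := ⌈s * k⌉ - 1 with hm
  have hm1 : (m : ℝ) < s * k := by
    have := Int.ceil_lt_add_one (s * k)
    rw [hm]; push_cast; linarith
  have hm2 : s * k ≤ m + 1 := by
    have := Int.le_ceil (s * k)
    rw [hm]; push_cast; linarith
  have hm3 : -(Q : ℤ) ≤ m := by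
    have : -(Q : ℤ) < ⌈s * k⌉ := Int.lt_ceil.2 (by push_cast; exact h2)
    omega
  have hm4 : m + 1 ≤ Q := by
    have : ⌈s * k⌉ ≤ (Q : ℤ) := Int.ceil_le.2 (by push_cast; exact h1)
    omega
  obtain ⟨a, ha⟩ := Int.eq_ofNat_of_zero_le (by omega : 0 ≤ m + Q)
  have haR : (a : ℝ) = m + Q := by exact_mod_cast ha.symm
  have ha1 := h ⟨a, by omega⟩
  have ha2 := h ⟨a + 1, by omega⟩
  push_cast at ha1 ha2
  rw [haR] at ha1 ha2
  rw [div_lt_iff₀ hk0, div_lt_iff₀ hk0] at ha1 ha2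
  have h5 := ha1.1 (by linarith)
  have h6 : ¬ (m + Q + 1 - Q : ℝ) < s' * k := fun h => absurd (ha2.2 h) (by linarith)
  have : |s - s'| * k ≤ 1 := by
    have e : |s - s'| * k = |s * k - s' * k| := by rw [← sub_mul, abs_mul, abs_of_pos hk0]
    rw [e, abs_le]
    constructor <;> linarith
  rwa [le_div_iff₀ hk0]

section Cover

variable {d N M : ℕ}

/-- The coefficients, as functionals of the weights, of the preactivations of the first layer at
the points `w j` and of the weights themselves. -/
def functionalCoeff {I : Type*} (w : I → Pt d) : (Fin N × I) ⊕ Pos d N M → Pos d N M → ℝ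
  | .inl (i, j), .inl (i', o) => if i' = i then o.elim 1 fun c => w j c else 0
  | .inl _, .inr _ => 0
  | .inr p, p' => if p' = p then 1 else 0

theorem sum_functionalCoeff_inl {I : Type*} (w : I → Pt d) (θ : Pos d N M → ℝ) (i : Fin N)
    (j : I) : ∑ p, functionalCoeff w (.inl (i, j)) p * θ p
      = aff (inputWeights θ i) fun c => w j c := by
  rw [Fintype.sum_sum_type, Fintype.sum_prod_type]
  simp only [functionalCoeff, zero_mul, Finset.sum_const_zero, add_zero]
  rw [Finset.sum_eq_single i]
  · rw [Fintype.sum_option, aff, lin]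
    simp only [if_true, Option.elim, one_mul]
    congr 1
    exact Finset.sum_congr rfl fun c _ => mul_comm _ _
  · intro i' _ hne; simp [hne]
  · simp

theorem sum_functionalCoeff_inr {I : Type*} (w : I → Pt d) (θ : Pos d N M → ℝ) (p : Pos d N M) :
    ∑ p', functionalCoeff w (.inr p) p' * θ p' = θ p := by
  simp [functionalCoeff]

/-- On `m` points, sparse networks fall into at most this number of classes of networks with close
weights and close first layers. -/
def classBound (p N m Q : ℕ) : ℕ := (p + 1) ^ N * ((N * m + p) * (2 * Q + 1) + 1) ^ (N + 1)

/-- A class records the support of the weights and the position of every weight and every first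
preactivation relative to the grid. Once the support is fixed, these data are signs of linear
functionals on a space of dimension `N + 1`. Supports number at most `(p + 1) ^ N`, and sign
patterns are counted by `exists_sign_pattern`. -/
theorem exists_classes {R : ℝ} {k Q : ℕ} (hk : 1 ≤ k) (hQ : k ^ 2 ≤ Q)
    (hQR : R * k ≤ Q) {I : Type*} [Fintype I] (w : I → Pt d) :
    ∃ c : SparseParam d N M R → Fin (classBound (Fintype.card (Pos d N M)) N (Fintype.card I) Q),
      ∀ θ θ', c θ = c θ' → (∀ p, |θ.1 p - θ'.1 p| ≤ 1 / k) ∧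
        ∀ j i, |firstAct θ.1 (w j) i - firstAct θ'.1 (w j) i| ≤ 1 / k := by
  classical
  have hk0 : (0 : ℝ) < k := by exact_mod_cast hk
  have hρ : ∀ θ : SparseParam d N M R, ∃ ρ : Fin N → Option (Pos d N M), PartialInj ρ ∧
      ∀ p, θ.1 p ≠ 0 → ∃ i, ρ i = some p := by
    intro θ
    obtain ⟨ρ, h1, h2⟩ := exists_partialInj (Finset.univ.filter fun p => θ.1 p ≠ 0)
      (N := N) (by rw [Finset.card_filter]; exact θ.2.2)
    exact ⟨ρ, h1, fun p hp => h2 p (by simpa using hp)⟩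
  choose ρ hρinj hρ using hρ
  -- The thresholds are made homogeneous: the additional coordinate `none`, on which `y` equals `1`,
  -- carries minus the threshold.
  let a : (Fin N → Option (Pos d N M)) → ((Fin N × I) ⊕ Pos d N M) × Fin (2 * Q + 1) →
      Option (Fin N) → ℝ := fun ρ q o =>
    o.elim (-(((q.2 : ℝ) - Q) / k)) fun i => (ρ i).elim 0 (functionalCoeff w q.1)
  let y : SparseParam d N M R → Option (Fin N) → ℝ := fun θ o =>
    o.elim 1 fun i => (ρ θ i).elim 0 θ.1
  have hay : ∀ θ q, ∑ o, a (ρ θ) q o * y θ o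
      = ∑ p, functionalCoeff w q.1 p * θ.1 p - ((q.2 : ℝ) - Q) / k := by
    intro θ q
    rw [Fintype.sum_option]
    have := sum_elim_mul_elim (hρinj θ) (functionalCoeff w q.1) θ.1
      fun j hj => not_not.1 fun h0 => hj (hρ θ j h0)
    simp only [a, y, Option.elim] at this ⊢
    rw [this]; ring
  choose pat hpat using fun ρ => exists_sign_pattern (a ρ)
  have hcard : Fintype.card ((Fin N → Option (Pos d N M)) ×
      Fin ((Fintype.card (((Fin N × I) ⊕ Pos d N M) × Fin (2 * Q + 1)) + 1)
        ^ Fintype.card (Option (Fin N))))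
      = classBound (Fintype.card (Pos d N M)) N (Fintype.card I) Q := by
    simp only [classBound, Fintype.card_prod, Fintype.card_fun, Fintype.card_option,
      Fintype.card_fin, Fintype.card_sum]
  refine ⟨fun θ => Fintype.equivFinOfCardEq hcard (ρ θ, pat (ρ θ) (y θ)), fun θ θ' h => ?_⟩
  have h' := Prod.ext_iff.1 ((Fintype.equivFinOfCardEq hcard).injective h)
  obtain ⟨h1, h2⟩ := h'
  simp only at h1 h2
  rw [← h1] at h2
  have hsign : ∀ q (r : Fin (2 * Q + 1)),
      ((r : ℝ) - Q) / k < ∑ p, functionalCoeff w q p * θ.1 p ↔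
      ((r : ℝ) - Q) / k < ∑ p, functionalCoeff w q p * θ'.1 p := by
    intro q r
    have := hpat (ρ θ) _ _ h2 (q, r)
    rw [hay] at this
    have e := hay θ' (q, r)
    rw [← h1] at e
    rw [e, sub_pos, sub_pos] at this
    exact this
  -- The grid reaches beyond `k`, where `tanh` is constant up to `1 / k`, and at least to `R`, so
  -- that two weights at the same end of it coincide.
  have hQk : (k : ℝ) ≤ Q / k := by
    rw [le_div_iff₀ hk0, ← sq]; exact_mod_cast hQ
  have hRk : R ≤ Q / k := by rwa [le_div_iff₀ hk0]
  constructor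
  · intro p
    have hb := abs_le.1 (θ.2.1 p)
    have hb' := abs_le.1 (θ'.2.1 p)
    have := abs_sub_le_or_of_grid hk (hsign (.inr p))
    rw [sum_functionalCoeff_inr, sum_functionalCoeff_inr] at this
    have hpos : (0 : ℝ) ≤ 1 / k := by positivity
    rcases this with h | ⟨h, h'⟩ | ⟨h, h'⟩
    · exact h
    · rw [abs_le]; constructor <;> linarith
    · rw [abs_le]; constructor <;> linarith
  · intro j i
    have := abs_sub_le_or_of_grid hk (hsign (.inl (i, j)))
    rw [sum_functionalCoeff_inl, sum_functionalCoeff_inl] at this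
    have hT : (0 : ℝ) < Q / k := hk0.trans_le hQk
    have hTk : 1 / ((Q : ℝ) / k) ≤ 1 / k := one_div_le_one_div_of_le hk0 hQk
    rcases this with h | ⟨h, h'⟩ | ⟨h, h'⟩
    · exact (abs_tanh_sub_le _ _).trans h
    · exact (abs_tanh_sub_le_of_le hT h h').trans hTk
    · exact (abs_tanh_sub_le_of_le_neg hT h h').trans hTk

/-- The fineness of the grid of weights. -/
def gridSize (N M : ℕ) (R : ℝ) (n : ℕ) : ℕ := ⌈3 * n * (8 * N * R) ^ (2 * (M + 2))⌉₊

/-- The number of classes of networks which, together with their derivatives, are `1 / n`-close on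
`2 n` points. -/
def netCount (d N M : ℕ) (R : ℝ) (n : ℕ) : ℕ :=
  classBound (Fintype.card (Pos d N M)) N (n + n) (gridSize N M R n ^ 2 * ⌈R⌉₊)

theorem one_le_netCount (d N M : ℕ) (R : ℝ) (n : ℕ) : 1 ≤ netCount d N M R n :=
  Nat.mul_pos (Nat.pow_pos (Nat.succ_pos _)) (Nat.pow_pos (Nat.succ_pos _))

theorem exists_net_classes {R : ℝ} (hN : 1 ≤ N) (hR : 1 ≤ R) {n : ℕ} (hn : 1 ≤ n)
    (w : Fin n ⊕ Fin n → Pt d) :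
    ∃ c : SparseParam d N M R → Fin (netCount d N M R n), ∀ θ θ', c θ = c θ' → ∀ j,
      |net θ.1 (w j) - net θ'.1 (w j)| ≤ 1 / n ∧
      ∀ i, |dnet θ.1 (w j) i - dnet θ'.1 (w j) i| ≤ 1 / n := by
  have hN' : (1 : ℝ) ≤ N := by exact_mod_cast hN
  have hn' : (1 : ℝ) ≤ n := by exact_mod_cast hn
  set k := gridSize N M R n with hk
  have hB : 0 < 3 * n * (8 * N * R) ^ (2 * (M + 2)) := by positivity
  have hk1 : 1 ≤ k := Nat.ceil_pos.2 hB
  have hk0 : (0 : ℝ) < k := by exact_mod_cast hk1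
  have hRc : R ≤ ⌈R⌉₊ := Nat.le_ceil R
  have hRc1 : 1 ≤ ⌈R⌉₊ := Nat.ceil_pos.2 (by linarith)
  -- The value `k ^ 2 * ⌈R⌉₊` is a simple choice of `Q` that dominates both `k ^ 2` and `R * k`.
  obtain ⟨c, hc⟩ := exists_classes (N := N) (M := M) (R := R) (Q := k ^ 2 * ⌈R⌉₊) hk1
    (Nat.le_mul_of_pos_right _ hRc1) (by
      push_cast
      have h1 : (k : ℝ) ≤ k ^ 2 := by exact_mod_cast Nat.le_self_pow two_ne_zero k
      rw [mul_comm]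
      exact mul_le_mul h1 hRc (by linarith) (by positivity)) w
  have hnn : Fintype.card (Fin n ⊕ Fin n) = n + n := by simp
  rw [netCount, ← hnn]
  refine ⟨c, fun θ θ' h j => ?_⟩
  obtain ⟨h1, h2⟩ := hc θ θ' h
  have h3 := net_sub_le hN hR (by positivity) θ.2.1 θ'.2.1 h1 (w j) (h2 j)
  have h4 : 3 * (8 * N * R) ^ (2 * (M + 2)) * (1 / k) ≤ 1 / n := by
    rw [mul_one_div, div_le_div_iff₀ hk0 (by linarith), one_mul]
    refine le_trans (le_of_eq ?_) (Nat.le_ceil _)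
    ring
  exact ⟨h3.1.trans h4, fun i => (h3.2 i).trans h4⟩

/-! ### Size of the number of classes -/

theorem log_classBound_le {p N m Q : ℕ} (hN : 1 ≤ N) :
    Real.log (classBound p N m Q)
      ≤ 3 * N * Real.log (((N * m + p) * (2 * Q + 1) + 1 : ℕ) : ℝ) := by
  set big := (N * m + p) * (2 * Q + 1) + 1 with hbig
  have hN' : (1 : ℝ) ≤ N := by exact_mod_cast hN
  have hbig1 : (1 : ℝ) ≤ big := by exact_mod_cast Nat.succ_le_of_lt (Nat.succ_pos _)
  have hpbig : (p + 1 : ℝ) ≤ big := by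
    have : p + 1 ≤ big := by
      rw [hbig]
      have : p ≤ (N * m + p) * (2 * Q + 1) :=
        (Nat.le_add_left _ _).trans (Nat.le_mul_of_pos_right _ (Nat.succ_pos _))
      omega
    exact_mod_cast this
  have h0 : 0 ≤ Real.log big := Real.log_nonneg hbig1
  have h1 : Real.log (p + 1) ≤ Real.log big := Real.log_le_log (by positivity) hpbig
  have e : ((classBound p N m Q : ℕ) : ℝ) = (p + 1 : ℝ) ^ N * (big : ℝ) ^ (N + 1) := by
    rw [classBound, ← hbig]; push_cast; rfl
  rw [e, Real.log_mul (by positivity) (by positivity), Real.log_pow, Real.log_pow]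
  push_cast
  nlinarith [mul_le_mul_of_nonneg_left h1 (by linarith : (0 : ℝ) ≤ N),
    mul_le_mul_of_nonneg_right hN' h0]

theorem card_pos_le {b : ℝ} (hd : 1 ≤ d) (hN : 1 ≤ N) (hb : 8 * N ≤ b) :
    (Fintype.card (Pos d N M) : ℝ) ≤ (d + (M + 2)) * b ^ 2 := by
  have hN' : (1 : ℝ) ≤ N := by exact_mod_cast hN
  have hd' : (1 : ℝ) ≤ d := by exact_mod_cast hd
  have hM : (0 : ℝ) ≤ M := Nat.cast_nonneg _
  have hpval : (Fintype.card (Pos d N M) : ℝ)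
      = N * (d + 1) + (M * (N * (N + 1)) + (N + 1)) := by
    simp only [Fintype.card_prod, Fintype.card_option, Fintype.card_fin, Fintype.card_sum]
    push_cast; ring
  have hNN : (N : ℝ) ≤ N * N := le_mul_of_one_le_left (by linarith) hN'
  have h64 : 2 * (N * N : ℝ) ≤ b ^ 2 := by nlinarith
  have h1 : (Fintype.card (Pos d N M) : ℝ) ≤ (d + (M + 2)) * (2 * (N * N)) := by
    rw [hpval]
    nlinarith [mul_le_mul_of_nonneg_left hNN hM, mul_le_mul_of_nonneg_left hNN
      (by linarith : (0 : ℝ) ≤ d), mul_le_mul_of_nonneg_left hd' (by linarith : (0 : ℝ) ≤ N)]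
  exact h1.trans (mul_le_mul_of_nonneg_left h64 (by positivity))

theorem gridSize_le {R b : ℝ} (hN : 1 ≤ N) (hR : 1 ≤ R) {n : ℕ} (hn : 1 ≤ n)
    (hb : b = 8 * N * R * n) :
    (gridSize N M R n : ℝ) ≤ b ^ (2 * (M + 2) + 1) := by
  have hN' : (1 : ℝ) ≤ N := by exact_mod_cast hN
  have hn' : (1 : ℝ) ≤ n := by exact_mod_cast hn
  have hNR : 1 ≤ N * R := one_le_mul_of_one_le_of_one_le hN' hR
  have h8b : 8 * N * R ≤ b := hb ▸ le_mul_of_one_le_right (by positivity) hn'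
  have hn4 : 4 * n ≤ b := by
    have := le_mul_of_one_le_left (by linarith : (0 : ℝ) ≤ n) hNR
    rw [hb]; linarith
  have h1 : (1 : ℝ) ≤ n * (8 * N * R) ^ (2 * (M + 2)) :=
    one_le_mul_of_one_le_of_one_le hn' (one_le_pow₀ (by linarith))
  have h2 : (gridSize N M R n : ℝ) ≤ 3 * n * (8 * N * R) ^ (2 * (M + 2)) + 1 :=
    (Nat.ceil_lt_add_one (by positivity)).le
  have hb0 : 0 ≤ b := by linarith
  calc (gridSize N M R n : ℝ) ≤ (8 * N * R) ^ (2 * (M + 2)) * (4 * n) := by linarith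
    _ ≤ b ^ (2 * (M + 2)) * b := by gcongr
    _ = _ := (pow_succ _ _).symm

/-- Every quantity is compared with a power of the one base `b = 8 * N * R * n`, so that the
logarithm becomes a multiple of the depth times `log b`. -/
theorem functional_count_le {R b : ℝ} (hd : 1 ≤ d) (hN : 1 ≤ N) (hR : 1 ≤ R) {n : ℕ}
    (hn : 1 ≤ n) (hb : b = 8 * N * R * n) :
    (((N * (n + n) + Fintype.card (Pos d N M)) *
      (2 * (gridSize N M R n ^ 2 * ⌈R⌉₊) + 1) + 1 : ℕ) : ℝ)
      ≤ (d + (M + 2) + 2) * b ^ (4 * (M + 2) + 6) := by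
  have hN' : (1 : ℝ) ≤ N := by exact_mod_cast hN
  have hn' : (1 : ℝ) ≤ n := by exact_mod_cast hn
  have hNn : (1 : ℝ) ≤ N * n := one_le_mul_of_one_le_of_one_le hN' hn'
  have hRn : (1 : ℝ) ≤ R * n := one_le_mul_of_one_le_of_one_le hR hn'
  have hRb : 2 * R ≤ b := by
    have := le_mul_of_one_le_left (by linarith : (0 : ℝ) ≤ R) hNn
    rw [hb]; linarith
  have hNb : 8 * N ≤ b := by
    have := le_mul_of_one_le_left (by linarith : (0 : ℝ) ≤ N) hRn
    rw [hb]; linarith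
  have hNnb : N * (n + n) ≤ b := by
    have := le_mul_of_one_le_left (by positivity : (0 : ℝ) ≤ N * n) hR
    rw [hb]; linarith
  have hb8 : 8 ≤ b := by linarith
  have hb1 : 1 ≤ b := by linarith
  have hp := card_pos_le (M := M) hd hN hNb
  have hk := gridSize_le (M := M) hN hR hn hb
  have hceil : (⌈R⌉₊ : ℝ) ≤ b := by
    have := (Nat.ceil_lt_add_one (by linarith : 0 ≤ R)).le
    linarith
  generalize Fintype.card (Pos d N M) = p at hp ⊢
  generalize gridSize N M R n = k at hk ⊢
  generalize ⌈R⌉₊ = t at hceil ⊢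
  have hQb : (k : ℝ) ^ 2 * t ≤ b ^ (4 * (M + 2) + 3) := by
    calc (k : ℝ) ^ 2 * t ≤ (b ^ (2 * (M + 2) + 1)) ^ 2 * b := by gcongr
      _ = _ := by ring
  have hQ2 : 2 * ((k : ℝ) ^ 2 * t) + 1 ≤ b ^ (4 * (M + 2) + 4) := by
    have h1 : (1 : ℝ) ≤ b ^ (4 * (M + 2) + 3) := one_le_pow₀ hb1
    rw [pow_succ b (4 * (M + 2) + 3)]; nlinarith
  have h1 : (1 : ℝ) ≤ b ^ (4 * (M + 2) + 6) := one_le_pow₀ hb1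
  have h2 : (N * (n + n) + p : ℝ) ≤ (d + (M + 2) + 1) * b ^ 2 := by nlinarith
  push_cast
  calc (N * (n + n) + p : ℝ) * (2 * ((k : ℝ) ^ 2 * t) + 1) + 1
      ≤ ((d + (M + 2) + 1) * b ^ 2) * b ^ (4 * (M + 2) + 4) + b ^ (4 * (M + 2) + 6) := by gcongr
    _ = _ := by ring

/-- The points of the sample do not enter, only their number. The constant is `69 = 3 * 23`: the `3`
bounds the total exponent by `3 * N`, and `23 = 2 + 7 * 3` collects the prefactor and the power of
`b`, using `log 8 ≤ 3`. -/
theorem log_netCount_le {R : ℝ} (hd : 1 ≤ d) (hN : 1 ≤ N) (hR : 1 ≤ R) {n : ℕ} (hn : 1 ≤ n) :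
    Real.log (netCount d N M R n)
      ≤ 69 * N * d * (M + 2) * (1 + Real.log N + Real.log R + Real.log n) := by
  have hN' : (1 : ℝ) ≤ N := by exact_mod_cast hN
  have hn' : (1 : ℝ) ≤ n := by exact_mod_cast hn
  have hd' : (1 : ℝ) ≤ d := by exact_mod_cast hd
  have hM : (0 : ℝ) ≤ M := Nat.cast_nonneg _
  have hbb := functional_count_le (M := M) hd hN hR hn rfl
  have h0 := log_classBound_le (p := Fintype.card (Pos d N M)) (m := n + n)
    (Q := gridSize N M R n ^ 2 * ⌈R⌉₊) hN
  rw [netCount]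
  refine h0.trans ?_
  have hbig1 : (1 : ℝ) ≤ (((N * (n + n) + Fintype.card (Pos d N M)) *
      (2 * (gridSize N M R n ^ 2 * ⌈R⌉₊) + 1) + 1 : ℕ) : ℝ) := by
    exact_mod_cast Nat.succ_le_of_lt (Nat.succ_pos _)
  generalize (N * (n + n) + Fintype.card (Pos d N M)) *
      (2 * (gridSize N M R n ^ 2 * ⌈R⌉₊) + 1) + 1 = big at hbb hbig1 ⊢
  set b : ℝ := 8 * N * R * n with hb
  have hb1 : 1 ≤ b := by
    have h1 := one_le_mul_of_one_le_of_one_le (one_le_mul_of_one_le_of_one_le hN' hR) hn'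
    rw [hb]; linarith
  have hlogb : Real.log b ≤ 3 + Real.log N + Real.log R + Real.log n := by
    rw [hb, Real.log_mul (by positivity) (by positivity), Real.log_mul (by positivity)
      (by positivity), Real.log_mul (by positivity) (by positivity)]
    have : Real.log 8 ≤ 3 := by
      rw [show (8 : ℝ) = 2 ^ 3 by norm_num, Real.log_pow]
      have := Real.log_two_lt_d9
      push_cast; linarith
    linarith
  have hl : 0 ≤ Real.log N + Real.log R + Real.log n :=
    add_nonneg (add_nonneg (Real.log_nonneg hN') (Real.log_nonneg hR)) (Real.log_nonneg hn')
  have hdL : (0 : ℝ) ≤ d * (M + 2) := by positivity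
  have h1 : Real.log big ≤ Real.log (d + (M + 2) + 2) + (4 * (M + 2) + 6) * Real.log b := by
    refine (Real.log_le_log (by linarith) hbb).trans (le_of_eq ?_)
    rw [Real.log_mul (by positivity) (by positivity), Real.log_pow]
    push_cast; ring
  have h2 : Real.log (d + (M + 2) + 2) ≤ d + (M + 2) + 1 := by
    have := Real.log_le_sub_one_of_pos (by positivity : (0 : ℝ) < d + (M + 2) + 2)
    linarith
  have h3 : (4 * (M + 2) + 6) * Real.log b
      ≤ 7 * (d * (M + 2)) * (3 + Real.log N + Real.log R + Real.log n) := by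
    refine mul_le_mul ?_ hlogb (Real.log_nonneg hb1) (by positivity)
    nlinarith
  have h4 : (d : ℝ) + (M + 2) + 1 ≤ 2 * (d * (M + 2)) := by nlinarith
  have h5 := mul_nonneg hdL hl
  have h6 : Real.log big ≤ 23 * (d * (M + 2)) * (1 + Real.log N + Real.log R + Real.log n) := by
    nlinarith
  calc 3 * N * Real.log big
      ≤ 3 * N * (23 * (d * (M + 2)) * (1 + Real.log N + Real.log R + Real.log n)) := by gcongr
    _ = _ := by ring

end Cover

/-! ### From the uniform deviation inequality to the bounds -/

theorem sqrt_add_le_sqrt_add_sqrt {a b : ℝ} (ha : 0 ≤ a) (hb : 0 ≤ b) :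
    √(a + b) ≤ √a + √b := by
  rw [Real.sqrt_le_left (by positivity), add_sq, Real.sq_sqrt ha, Real.sq_sqrt hb]
  have : 0 ≤ 2 * √a * √b := by positivity
  linarith

theorem sqrtLog_nonneg (t : ℝ) : 0 ≤ sqrtLog t := Real.sqrt_nonneg _

theorem half_le_sqrtLog {n : ℕ} (hn : 2 ≤ n) : 1 / 2 ≤ sqrtLog n := by
  have h1 : Real.log 2 ≤ Real.log n := Real.log_le_log (by norm_num) (by exact_mod_cast hn)
  have h2 := Real.log_two_gt_d9
  exact Real.le_sqrt_of_sq_le (by linarith)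

theorem one_le_log_inv {τ : ℝ} (hτ0 : 0 < τ) (hτ1 : τ < 1 / 8) : 1 ≤ Real.log (1 / τ) := by
  have h1 : (8 : ℝ) ≤ 1 / τ := by rw [le_div_iff₀ hτ0]; linarith
  have h2 : Real.log 8 ≤ Real.log (1 / τ) := Real.log_le_log (by norm_num) h1
  have h3 : Real.log 8 = 3 * Real.log 2 := by
    rw [show (8 : ℝ) = 2 ^ 3 by norm_num, Real.log_pow]; norm_num
  have := Real.log_two_gt_d9
  linarith

/-- Here `ρ = 2 * m * S` and `T` is the sum of logarithms whose square root is dominated by `s`. The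
constants are `216 = 4 * 54` and `24 = 4 * (4 + 2)`, with `4` from `ρ ^ 2`. -/
theorem deviation_le_bound {V W m S d Lt Nn T s τ : ℝ} {n K : ℕ} (hn : 1 ≤ n) (hK : 1 ≤ K)
    (hV : 0 ≤ V) (hVW : V ≤ W) (hd : 1 ≤ d) (hLt : 1 ≤ Lt) (hNn : 1 ≤ Nn)
    (hT : 0 ≤ T) (hTs : √T ≤ s) (hns : sqrtLog n ≤ s) (hτ0 : 0 < τ) (hτ1 : τ < 1 / 8)
    (hlog : Real.log K ≤ 69 * (Nn * d ^ 2 * Lt) * (1 + T)) :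
    (n = 1 ∧ V * (2 * m * S) ^ 2 ≤ 216 * W * m ^ 2 * d * Lt * (S ^ 2 * √Nn * s / √n)
        + 24 * W * m ^ 2 * S ^ 2 * √(Real.log (1 / τ) / n)) ∨
      V * ((2 * m * S) ^ 2 * (4 / n + √(2 * Real.log (2 * K / τ) / n)))
        ≤ 216 * W * m ^ 2 * d * Lt * (S ^ 2 * √Nn * s / √n)
          + 24 * W * m ^ 2 * S ^ 2 * √(Real.log (1 / τ) / n) := by
  have hs0 : 0 ≤ s := (sqrtLog_nonneg _).trans hns
  have hτl := one_le_log_inv hτ0 hτ1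
  have hW : 0 ≤ W := hV.trans hVW
  -- For `n = 1` all the logarithms in `s` can vanish, so only the term with `τ` is available; it
  -- suffices since `log (1 / τ) ≥ 1`. For `n ≥ 2` one has `1 ≤ 2 * s`, which absorbs additive
  -- constants.
  rcases hn.eq_or_lt with rfl | hn2
  · left
    refine ⟨rfl, ?_⟩
    have h1 : 1 ≤ √(Real.log (1 / τ) / (1 : ℕ)) := by
      rw [Nat.cast_one, div_one]; exact Real.one_le_sqrt.2 hτl
    have h2 : 0 ≤ W * m ^ 2 * S ^ 2 := by positivity
    calc V * (2 * m * S) ^ 2 = 4 * (V * m ^ 2 * S ^ 2) := by ring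
      _ ≤ 24 * (W * m ^ 2 * S ^ 2) * 1 := by
          have : V * m ^ 2 * S ^ 2 ≤ W * m ^ 2 * S ^ 2 := by gcongr
          linarith
      _ ≤ 24 * (W * m ^ 2 * S ^ 2) * √(Real.log (1 / τ) / (1 : ℕ)) := by gcongr
      _ = 0 + 24 * W * m ^ 2 * S ^ 2 * √(Real.log (1 / τ) / (1 : ℕ)) := by ring
      _ ≤ _ := by gcongr; positivity
  · right
    have hn0 : (0 : ℝ) < n := by exact_mod_cast hn
    have hn1 : (1 : ℝ) ≤ n := by exact_mod_cast hn
    have hsn : 0 < √(n : ℝ) := Real.sqrt_pos.2 hn0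
    have hK' : (1 : ℝ) ≤ K := by exact_mod_cast hK
    have hlK := Real.log_nonneg hK'
    have hs1 : 1 ≤ 2 * s := by linarith [half_le_sqrtLog hn2]
    set H := Nn * d ^ 2 * Lt with hH
    have hH1 : 1 ≤ H := one_le_mul_of_one_le_of_one_le
      (one_le_mul_of_one_le_of_one_le hNn (one_le_pow₀ hd)) hLt
    have hsH : √H ≤ d * Lt * √Nn := by
      rw [hH, Real.sqrt_mul (by positivity), Real.sqrt_mul (by linarith),
        Real.sqrt_sq (by linarith)]
      have : √Lt ≤ Lt := by
        rw [Real.sqrt_le_left (by linarith)]; nlinarith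
      calc √Nn * d * √Lt ≤ √Nn * d * Lt := by gcongr
        _ = _ := by ring
    -- The constant `69` is rounded up to the square `81`, leaving room for `log 2`.
    have hlog2 : Real.log (2 * K) ≤ 81 * H * (1 + T) := by
      rw [Real.log_mul (by norm_num) (by positivity)]
      have := Real.log_two_lt_d9
      nlinarith
    have hlog2' : 0 ≤ Real.log (2 * K) := Real.log_nonneg (by linarith)
    have hsq : √(Real.log (2 * K)) ≤ 27 * (d * Lt * √Nn) * s := by
      calc √(Real.log (2 * K)) ≤ √(81 * H * (1 + T)) := Real.sqrt_le_sqrt hlog2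
        _ = 9 * √H * √(1 + T) := by
            rw [Real.sqrt_mul (by positivity), Real.sqrt_mul (by norm_num),
              show (81 : ℝ) = 9 ^ 2 by norm_num, Real.sqrt_sq (by norm_num)]
        _ ≤ 9 * (d * Lt * √Nn) * (3 * s) := by
            have h1 := sqrt_add_le_sqrt_add_sqrt zero_le_one hT
            rw [Real.sqrt_one] at h1
            gcongr
            linarith
        _ = _ := by ring
    have hsplit : √(2 * Real.log (2 * K / τ) / n)
        ≤ 2 * (27 * (d * Lt * √Nn) * s / √n) + 2 * √(Real.log (1 / τ) / n) := by
      have e : 2 * K / τ = (2 * K) * (1 / τ) := by ring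
      rw [e, Real.log_mul (by positivity) (by positivity), Real.sqrt_div (by positivity),
        Real.sqrt_div (by positivity) (n : ℝ), mul_div_assoc', mul_div_assoc', ← add_div]
      gcongr
      calc √(2 * (Real.log (2 * K) + Real.log (1 / τ)))
          ≤ √(2 ^ 2 * (Real.log (2 * K) + Real.log (1 / τ))) :=
            Real.sqrt_le_sqrt (by nlinarith)
        _ = 2 * √(Real.log (2 * K) + Real.log (1 / τ)) := by
            rw [Real.sqrt_mul (by norm_num), Real.sqrt_sq (by norm_num)]
        _ ≤ 2 * (√(Real.log (2 * K)) + √(Real.log (1 / τ))) := by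
            gcongr; exact sqrt_add_le_sqrt_add_sqrt hlog2' (by linarith)
        _ ≤ _ := by linarith
    have h4 : 4 / (n : ℝ) ≤ 4 * √(Real.log (1 / τ) / n) := by
      have h5 : (1 : ℝ) / n ≤ √(Real.log (1 / τ) / n) := by
        refine Real.le_sqrt_of_sq_le ?_
        rw [div_pow, one_pow, div_le_div_iff₀ (by positivity) hn0, one_mul]
        nlinarith
      rw [show 4 / (n : ℝ) = 4 * (1 / n) by ring]
      linarith
    calc V * ((2 * m * S) ^ 2 * (4 / n + √(2 * Real.log (2 * K / τ) / n)))
        ≤ W * ((2 * m * S) ^ 2 * (4 * √(Real.log (1 / τ) / n)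
          + (2 * (27 * (d * Lt * √Nn) * s / √n) + 2 * √(Real.log (1 / τ) / n)))) := by gcongr
      _ = _ := by ring

/-! ### Classes of stacked networks -/

section Flux

variable {d N M : ℕ} {R : ℝ}

/-- The vector field with components `net (θ i)`. -/
def fluxVec (θ : Fin d → SparseParam d N M R) (x : Pt d) : Pt d :=
  WithLp.toLp 2 fun i => net (θ i).1 x

/-- The divergence of `fluxVec θ`. -/
def fluxDiv (θ : Fin d → SparseParam d N M R) (x : Pt d) : ℝ := ∑ i, dnet (θ i).1 x i

/-- The gradient of `net θ`. -/
def gradVec (θ : SparseParam d N M R) (x : Pt d) : Pt d := WithLp.toLp 2 fun c => dnet θ.1 x c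

theorem continuous_net_right (θ : Pos d N M → ℝ) : Continuous (net θ) :=
  continuous_net.comp (Continuous.prodMk continuous_const continuous_id)

theorem continuous_dnet_right (θ : Pos d N M → ℝ) (c : Fin d) :
    Continuous fun x => dnet θ x c :=
  (continuous_dnet c).comp (Continuous.prodMk continuous_const continuous_id)

theorem continuous_net_left (x : Pt d) : Continuous fun θ : SparseParam d N M R => net θ.1 x :=
  continuous_net.comp (Continuous.prodMk continuous_subtype_val continuous_const)

theorem continuous_dnet_left (x : Pt d) (c : Fin d) :
    Continuous fun θ : SparseParam d N M R => dnet θ.1 x c :=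
  (continuous_dnet c).comp (Continuous.prodMk continuous_subtype_val continuous_const)

theorem continuous_fluxVec_right (θ : Fin d → SparseParam d N M R) : Continuous (fluxVec θ) :=
  (PiLp.continuous_toLp 2 _).comp (continuous_pi fun i => continuous_net_right (θ i).1)

theorem continuous_fluxVec_left (x : Pt d) :
    Continuous fun θ : Fin d → SparseParam d N M R => fluxVec θ x :=
  (PiLp.continuous_toLp 2 _).comp
    (continuous_pi fun i => (continuous_net_left x).comp (continuous_apply i))

theorem continuous_fluxDiv_right (θ : Fin d → SparseParam d N M R) : Continuous (fluxDiv θ) :=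
  continuous_finsetSum _ fun i _ => continuous_dnet_right (θ i).1 i

theorem continuous_fluxDiv_left (x : Pt d) :
    Continuous fun θ : Fin d → SparseParam d N M R => fluxDiv θ x :=
  continuous_finsetSum _ fun i _ => (continuous_dnet_left x i).comp (continuous_apply i)

theorem continuous_gradVec_right (θ : SparseParam d N M R) : Continuous (gradVec θ) :=
  (PiLp.continuous_toLp 2 _).comp (continuous_pi fun i => continuous_dnet_right θ.1 i)

theorem continuous_gradVec_left (x : Pt d) :
    Continuous fun θ : SparseParam d N M R => gradVec θ x :=
  (PiLp.continuous_toLp 2 _).comp (continuous_pi fun i => continuous_dnet_left x i)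

/-- The weaker factor `d` in place of `√d` keeps the final constants polynomial. -/
theorem norm_le_of_forall_abs_le {v : Pt d} {C : ℝ} (hC : 0 ≤ C) (h : ∀ i, |v i| ≤ C) :
    ‖v‖ ≤ d * C := by
  have h1 : ‖v‖ ^ 2 ≤ d * C ^ 2 := by
    rw [EuclideanSpace.real_norm_sq_eq]
    refine (Finset.sum_le_sum (g := fun _ => C ^ 2) fun i _ => ?_).trans (le_of_eq (by simp))
    exact sq_le_sq' (abs_le.1 (h i)).1 (abs_le.1 (h i)).2
  have h2 : (d : ℝ) ≤ d ^ 2 := by exact_mod_cast Nat.le_self_pow two_ne_zero d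
  refine le_of_sq_le_sq ?_ (by positivity)
  rw [mul_pow]
  exact h1.trans (mul_le_mul_of_nonneg_right h2 (by positivity))

theorem norm_fluxVec_le (hN : 1 ≤ N) (hR : 1 ≤ R) (θ : Fin d → SparseParam d N M R) (x : Pt d) :
    ‖fluxVec θ x‖ ≤ d * (2 * (N * R)) :=
  norm_le_of_forall_abs_le (by positivity) fun i => abs_net_le hN hR (θ i).2.1 x

theorem norm_gradVec_le (hR : 1 ≤ R) (θ : SparseParam d N M R) (x : Pt d) :
    ‖gradVec θ x‖ ≤ d * (R ^ (M + 2) * N ^ (M + 1)) :=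
  norm_le_of_forall_abs_le (by positivity) fun i => abs_dnet_le hR θ.2.1 x i

theorem abs_fluxDiv_le (hR : 1 ≤ R) (θ : Fin d → SparseParam d N M R) (x : Pt d) :
    |fluxDiv θ x| ≤ d * (R ^ (M + 2) * N ^ (M + 1)) := by
  refine (Finset.abs_sum_le_sum_abs _ _).trans ((Finset.sum_le_sum fun i _ =>
    abs_dnet_le hR (θ i).2.1 x i).trans (le_of_eq (by simp)))

theorem norm_fluxVec_sub_le {θ θ' : Fin d → SparseParam d N M R} {x : Pt d} {C : ℝ} (hC : 0 ≤ C)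
    (h : ∀ i, |net (θ i).1 x - net (θ' i).1 x| ≤ C) : ‖fluxVec θ x - fluxVec θ' x‖ ≤ d * C :=
  norm_le_of_forall_abs_le hC h

theorem norm_gradVec_sub_le {θ θ' : SparseParam d N M R} {x : Pt d} {C : ℝ} (hC : 0 ≤ C)
    (h : ∀ i, |dnet θ.1 x i - dnet θ'.1 x i| ≤ C) : ‖gradVec θ x - gradVec θ' x‖ ≤ d * C :=
  norm_le_of_forall_abs_le hC h

theorem abs_fluxDiv_sub_le {θ θ' : Fin d → SparseParam d N M R} {x : Pt d} {C : ℝ}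
    (h : ∀ i, |dnet (θ i).1 x i - dnet (θ' i).1 x i| ≤ C) :
    |fluxDiv θ x - fluxDiv θ' x| ≤ d * C := by
  rw [fluxDiv, fluxDiv, ← Finset.sum_sub_distrib]
  exact (Finset.abs_sum_le_sum_abs _ _).trans ((Finset.sum_le_sum fun i _ => h i).trans
    (le_of_eq (by simp)))

theorem exists_flux_param (hR : 0 ≤ R) {σ : Pt d → Pt d} (hσ : σ ∈ fluxClass d (M + 2) N R) :
    ∃ θ : Fin d → SparseParam d N M R, (∀ x, σ x = fluxVec θ x) ∧
      ∀ x, divergence σ x = fluxDiv θ x := by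
  choose θ hθ using fun i => exists_sparseParam hR (hσ i)
  refine ⟨θ, fun x => ?_, fun x => ?_⟩
  · ext i
    exact congrFun (hθ i) x
  · exact Finset.sum_congr rfl fun i _ => by rw [hθ i, fderiv_net]

theorem exists_grad_param (hR : 0 ≤ R) {q : Pt d → ℝ} (hq : q ∈ netClass d (M + 2) N R) :
    ∃ θ : SparseParam d N M R, ∀ x, gradient q x = gradVec θ x := by
  obtain ⟨θ, rfl⟩ := exists_sparseParam hR hq
  exact ⟨θ, fun x => by ext c; exact gradient_net_apply θ.1 x c⟩

theorem exists_flux_classes (hN : 1 ≤ N) (hR : 1 ≤ R) {n : ℕ} (hn : 1 ≤ n)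
    (w : Fin n ⊕ Fin n → Pt d) :
    ∃ c : (Fin d → SparseParam d N M R) → Fin (netCount d N M R n ^ d),
      ∀ θ θ', c θ = c θ' → ∀ j i,
        |net (θ i).1 (w j) - net (θ' i).1 (w j)| ≤ 1 / n ∧
        ∀ l, |dnet (θ i).1 (w j) l - dnet (θ' i).1 (w j) l| ≤ 1 / n := by
  obtain ⟨c, hc⟩ := exists_net_classes (M := M) hN hR hn w
  refine ⟨fun θ => finFunctionFinEquiv fun i => c (θ i), fun θ θ' h j i => ?_⟩
  exact hc _ _ (congrFun (finFunctionFinEquiv.injective h) i) j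

end Flux

/-! ### Bounded representatives -/

/-- The deviation inequality needs data measurable and bounded everywhere; a measurable
representative is set to zero where it exceeds the bound. -/
theorem exists_bounded_representative {X F : Type*} [MeasurableSpace X] [NormedAddCommGroup F]
    [MeasurableSpace F] [BorelSpace F] {μ : Measure X} {v : X → F} {C : ℝ}
    (hC : 0 ≤ C) (hv : AEStronglyMeasurable v μ) (hb : ∀ᵐ x ∂μ, ‖v x‖ ≤ C) :
    ∃ w : X → F, Measurable w ∧ (∀ x, ‖w x‖ ≤ C) ∧ ∀ᵐ x ∂μ, v x = w x := by
  classical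
  have hm := hv.stronglyMeasurable_mk
  refine ⟨Set.indicator {x | ‖hv.mk v x‖ ≤ C} (hv.mk v),
    hm.measurable.indicator (measurableSet_le hm.norm.measurable measurable_const), fun x => ?_, ?_⟩
  · by_cases hx : ‖hv.mk v x‖ ≤ C
    · rw [Set.indicator_of_mem (by exact hx)]; exact hx
    · rw [Set.indicator_of_notMem (by exact hx), norm_zero]; exact hC
  · filter_upwards [hv.ae_eq_mk, hb] with x hx hbx
    rw [Set.indicator_of_mem (by rw [mem_ofPred_eq, ← hx]; exact hbx), ← hx]

theorem supNorm_nonneg {d : ℕ} {F : Type*} [NormedAddCommGroup F] (v : Pt d → F)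
    (μ : Measure (Pt d)) : 0 ≤ supNorm v μ := ENNReal.toReal_nonneg

theorem ae_norm_le_supNorm {d : ℕ} {F : Type*} [NormedAddCommGroup F] {v : Pt d → F}
    {μ : Measure (Pt d)} (hv : MemLp v ⊤ μ) : ∀ᵐ x ∂μ, ‖v x‖ ≤ supNorm v μ := by
  have h : ∀ᵐ x ∂μ, ‖v x‖ₑ ≤ eLpNorm v ⊤ μ := by
    rw [eLpNorm_exponent_top]; exact ae_le_eLpNormEssSup
  filter_upwards [h] with x hx
  have := ENNReal.toReal_mono hv.2.ne hx
  simpa [supNorm] using this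

theorem uniformIn_absolutelyContinuous {d : ℕ} (Ω : Set (Pt d)) :
    uniformIn Ω ≪ volume.restrict Ω := Measure.smul_absolutelyContinuous

theorem uniformBdry_absolutelyContinuous {d : ℕ} (Ω : Set (Pt d)) :
    uniformBdry Ω ≪ surfaceMeasure Ω :=
  Measure.smul_absolutelyContinuous.trans Measure.restrict_le_self.absolutelyContinuous

theorem ae_mem_frontier {d : ℕ} (Ω : Set (Pt d)) : ∀ᵐ y ∂(surfaceMeasure Ω), y ∈ frontier Ω :=
  ae_restrict_mem isClosed_frontier.measurableSet

/-- A trace of a bounded function is bounded. -/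
theorem HasTrace.ae_norm_le {d : ℕ} {F : Type*} [NormedAddCommGroup F] {Ω : Set (Pt d)}
    (hΩ : IsOpen Ω) {v w : Pt d → F} {C : ℝ} (h : HasTrace Ω v w)
    (hv : ∀ᵐ x ∂(volume.restrict Ω), ‖v x‖ ≤ C) : ∀ᵐ y ∂(surfaceMeasure Ω), ‖w y‖ ≤ C := by
  filter_upwards [h.2, ae_mem_frontier Ω] with y hy hyΩ
  by_contra hlt
  push Not at hlt
  have hpos : 0 < ‖w y‖ - C := by linarith
  -- Near a boundary point the open set `Ω` has positive measure, and there `v` stays at distance at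
  -- least `‖w y‖ - C` from `w y`; the means cannot tend to zero.
  have hle : ∀ r : ℝ, 0 < r → ENNReal.ofReal (‖w y‖ - C)
      ≤ ⨍⁻ x in Ω ∩ Metric.ball y r, ‖v x - w y‖ₑ ∂volume := by
    intro r hr
    have hne : (Ω ∩ Metric.ball y r).Nonempty := by
      rw [inter_comm]
      exact mem_closure_iff.1 (frontier_subset_closure hyΩ) _ Metric.isOpen_ball
        (Metric.mem_ball_self hr)
    have hvol : volume (Ω ∩ Metric.ball y r) ≠ 0 :=
      ((hΩ.inter Metric.isOpen_ball).measure_pos volume hne).ne'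
    have hfin : volume (Ω ∩ Metric.ball y r) ≠ ⊤ :=
      ((measure_mono inter_subset_right).trans_lt measure_ball_lt_top).ne
    rw [← setLAverage_const hvol hfin (ENNReal.ofReal (‖w y‖ - C))]
    refine laverage_mono_ae ?_
    have : ∀ᵐ x ∂(volume.restrict (Ω ∩ Metric.ball y r)), ‖v x‖ ≤ C :=
      ae_mono (Measure.restrict_mono inter_subset_left le_rfl) hv
    filter_upwards [this] with x hx
    rw [← ofReal_norm]
    refine ENNReal.ofReal_le_ofReal ?_
    have := norm_sub_norm_le (w y) (v x)
    rw [norm_sub_rev] at this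
    linarith
  have := ge_of_tendsto hy (eventually_nhdsWithin_of_forall hle)
  exact (ENNReal.ofReal_pos.2 hpos).not_ge this

/-- The purpose is measurability of `ν` with respect to surface measure. -/
theorem IsUnitOutwardNormal.continuousOn {d : ℕ} {Ω : Set (Pt d)} {ν : Pt d → Pt d}
    (h : IsUnitOutwardNormal Ω ν) : ContinuousOn ν (frontier Ω) := by
  intro y hy
  obtain ⟨U, φ, hyU, hφ, hν⟩ := h y hy
  have hg : ContinuousOn (gradient φ) U :=
    (InnerProductSpace.toDual ℝ (Pt d)).symm.continuous.comp_continuousOn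
      (hφ.smooth.continuousOn_fderiv_of_isOpen hφ.isOpen (by simp))
  have hga : ContinuousAt (gradient φ) y := hg.continuousAt (hφ.isOpen.mem_nhds hyU)
  have hn : ContinuousAt (fun y' => ‖gradient φ y'‖⁻¹ • gradient φ y') y :=
    (hga.norm.inv₀ (norm_ne_zero_iff.2 (hφ.gradient_ne_zero y hyU))).smul hga
  refine hn.continuousWithinAt.congr_of_eventuallyEq ?_ (hν y ⟨hy, hyU⟩)
  filter_upwards [self_mem_nhdsWithin, mem_nhdsWithin_of_mem_nhds (hφ.isOpen.mem_nhds hyU)]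
    with y' h1 h2 using hν y' ⟨h1, h2⟩

theorem IsUnitOutwardNormal.norm_le_one {d : ℕ} {Ω : Set (Pt d)} {ν : Pt d → Pt d}
    (h : IsUnitOutwardNormal Ω ν) {y : Pt d} (hy : y ∈ frontier Ω) : ‖ν y‖ ≤ 1 := by
  obtain ⟨U, φ, hyU, hφ, hν⟩ := h y hy
  rw [hν y ⟨hy, hyU⟩, norm_smul, norm_inv, norm_norm,
    inv_mul_cancel₀ (norm_ne_zero_iff.2 (hφ.gradient_ne_zero y hyU))]

theorem abs_cutoff_le {c₀ c₁ : ℝ} (h0 : 0 < c₀) (h1 : c₀ < c₁) (t : ℝ) : |cutoff c₀ c₁ t| ≤ c₁ := by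
  unfold cutoff
  rw [abs_of_nonneg (le_min (h0.le.trans (le_max_left _ _)) (h0.trans h1).le)]
  exact min_le_right _ _

theorem abs_cutoff_sub_le (c₀ c₁ s t : ℝ) : |cutoff c₀ c₁ s - cutoff c₀ c₁ t| ≤ |s - t| :=
  (abs_inf_sub_inf_le_abs _ _ _).trans (by
    rw [show max c₀ s - max c₀ t = max s c₀ - max t c₀ by rw [max_comm, max_comm c₀ t]]
    exact abs_sup_sub_sup_le_abs _ _ _)

theorem continuous_cutoff (c₀ c₁ : ℝ) : Continuous (cutoff c₀ c₁) := by
  unfold cutoff; fun_prop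

/-! ### The quadrature errors -/

/-- The common form of the bounds. -/
def stdBound (W m d Lt S Nn s τ : ℝ) (n : ℕ) : ℝ :=
  216 * W * m ^ 2 * d * Lt * (S ^ 2 * √Nn * s / √n)
    + 24 * W * m ^ 2 * S ^ 2 * √(Real.log (1 / τ) / n)

/-- The factor `m` gathers the data and the dimension, `B` the size of the networks. Since `B ≥ 1`,
a class diameter `m / n` is below `ρ / n` for `ρ = 2 * m * B`. That `μ` is a probability measure
follows from its being the law of a sample point. -/
theorem exists_bad_set_stdBound {X Θ E S : Type*} [MeasurableSpace X]
    [TopologicalSpace Θ] [SecondCountableTopology Θ] [NormedAddCommGroup E] [MeasurableSpace E]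
    [BorelSpace E] {μ : Measure X} [MeasurableSpace S] {P : Measure S}
    [IsProbabilityMeasure P] {n : ℕ} (hn : 1 ≤ n) {Y : Fin n → S → X}
    (hY : ∀ j, HasLaw (Y j) μ P) (hind : iIndepFun Y P)
    {r : Θ → X → E} (hm : ∀ θ, Measurable (r θ)) (hcont : ∀ x, Continuous fun θ => r θ x)
    {m B : ℝ} (hm1 : 1 ≤ m) (hB : 1 ≤ B) (hr : ∀ θ x, ‖r θ x‖ ≤ 2 * m * B)
    {K : ℕ} (hK : 1 ≤ K)
    (hc : ∀ w : Fin n ⊕ Fin n → X, ∃ c : Θ → Fin K, ∀ θ θ', c θ = c θ' →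
      ∀ j, ‖r θ (w j) - r θ' (w j)‖ ≤ m * (1 / n))
    {A : Set X} (hA : ∀ᵐ x ∂μ, x ∈ A) {V W d Lt Nn T s τ : ℝ} (hV : 0 ≤ V) (hVW : V ≤ W)
    (hd : 1 ≤ d) (hLt : 1 ≤ Lt) (hNn : 1 ≤ Nn) (hT : 0 ≤ T) (hTs : √T ≤ s) (hns : sqrtLog n ≤ s)
    (hτ0 : 0 < τ) (hτ1 : τ < 1 / 8)
    (hlog : Real.log K ≤ 69 * (Nn * d ^ 2 * Lt) * (1 + T)) :
    ∃ N : Set S, P N ≤ ENNReal.ofReal τ ∧ ∀ s' ∉ N, ∀ h : X → ℝ,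
      (∃ θ, ∀ x ∈ A, h x = ‖r θ x‖ ^ 2) →
        ENNReal.ofReal |V * ∫ x, h x ∂μ - (n : ℝ)⁻¹ * V * ∑ j, h (Y j s')|
          ≤ ENNReal.ofReal (stdBound W m d Lt B Nn s τ n) := by
  have : IsProbabilityMeasure μ := (hY ⟨0, hn⟩).isProbabilityMeasure_iff.1 inferInstance
  have hmB : 1 ≤ m * B := one_le_mul_of_one_le_of_one_le hm1 hB
  obtain ⟨N, hN, hNs⟩ := exists_bad_set hn hY hind hm hcont (ρ := 2 * m * B) (by linarith) hr hK
    (fun w => (hc w).imp fun c hc θ θ' h j => (hc θ θ' h j).trans (by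
      rw [mul_one_div]; gcongr; nlinarith)) hτ0 (by linarith) hA hV
    (deviation_le_bound (W := W) (m := m) (S := B) hn hK hV hVW hd hLt hNn hT hTs hns hτ0 hτ1 hlog)
  exact ⟨N, hN, fun s' hs' h hh => ENNReal.ofReal_le_ofReal (hNs s' hs' h hh)⟩

theorem measure_not_le_of_bad_set {S : Type*} [MeasurableSpace S] {P : Measure S} {N : Set S}
    {t : ℝ≥0∞} (hN : P N ≤ t) {err : S → ℝ≥0∞} {e : ℝ≥0∞} (h : ∀ s ∉ N, err s ≤ e) :
    P {s | ¬ err s ≤ e} ≤ t :=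
  (measure_mono fun s (hs : ¬ err s ≤ e) => by_contra fun hsN => hs (h s hsN)).trans hN

theorem sqrt_sum_three_le {a b c : ℝ} (ha : 0 ≤ a) (hb : 0 ≤ b) (hc : 0 ≤ c) :
    √(a + b + c) ≤ √b + √a + √c := by
  have h1 := sqrt_add_le_sqrt_add_sqrt (add_nonneg ha hb) hc
  have h2 := sqrt_add_le_sqrt_add_sqrt ha hb
  linarith

section Bounds

variable {d : ℕ} {Ω : Set (Pt d)} {S : Type*} [MeasurableSpace S] {P : Measure S}
  [IsProbabilityMeasure P] {n : ℕ} {τ : ℝ}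

theorem one_le_mul_cast {N : ℕ} {R : ℝ} (hN : 1 ≤ N) (hR : 1 ≤ R) : 1 ≤ N * R :=
  one_le_mul_of_one_le_of_one_le (by exact_mod_cast hN) hR

theorem one_le_pow_mul_cast {N : ℕ} {R : ℝ} (hN : 1 ≤ N) (hR : 1 ≤ R) (a b : ℕ) :
    1 ≤ R ^ a * (N : ℝ) ^ b :=
  one_le_mul_of_one_le_of_one_le (one_le_pow₀ hR) (one_le_pow₀ (by exact_mod_cast hN))

/-- The uniform error bound for residuals depending on a stack of `d` networks. -/
theorem exists_bad_set_flux {E : Type*} [NormedAddCommGroup E] [MeasurableSpace E]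
    [BorelSpace E] {μ : Measure (Pt d)} {Y : Fin n → S → Pt d} (hd : 1 ≤ d) (hn : 1 ≤ n)
    (hY : ∀ j, HasLaw (Y j) μ P) (hind : iIndepFun Y P) {N M : ℕ} {R : ℝ} (hN : 1 ≤ N)
    (hR : 1 ≤ R) {r : (Fin d → SparseParam d N M R) → Pt d → E} (hm : ∀ θ, Measurable (r θ))
    (hcont : ∀ x, Continuous fun θ => r θ x) {m B : ℝ} (hm1 : 1 ≤ m) (hB : 1 ≤ B)
    (hr : ∀ θ x, ‖r θ x‖ ≤ 2 * m * B)
    (hdiff : ∀ (C : ℝ) θ θ' x, 0 ≤ C → (∀ i, |net (θ i).1 x - net (θ' i).1 x| ≤ C ∧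
      ∀ l, |dnet (θ i).1 x l - dnet (θ' i).1 x l| ≤ C) → ‖r θ x - r θ' x‖ ≤ m * C)
    {A : Set (Pt d)} (hA : ∀ᵐ x ∂μ, x ∈ A) {V W Lt : ℝ} (hV : 0 ≤ V) (hVW : V ≤ W)
    (hLt : (M + 2 : ℝ) ≤ Lt) (hτ0 : 0 < τ) (hτ1 : τ < 1 / 8) :
    ∃ N' : Set S, P N' ≤ ENNReal.ofReal τ ∧ ∀ s' ∉ N', ∀ h : Pt d → ℝ,
      (∃ θ, ∀ x ∈ A, h x = ‖r θ x‖ ^ 2) →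
        ENNReal.ofReal |V * ∫ x, h x ∂μ - (n : ℝ)⁻¹ * V * ∑ j, h (Y j s')|
          ≤ ENNReal.ofReal (stdBound W m d Lt B N (sqrtLog R + sqrtLog N + sqrtLog n) τ n) := by
  have hN' : (1 : ℝ) ≤ N := by exact_mod_cast hN
  have hn' : (1 : ℝ) ≤ n := by exact_mod_cast hn
  have hd' : (1 : ℝ) ≤ d := by exact_mod_cast hd
  have hM : (0 : ℝ) ≤ M := Nat.cast_nonneg _
  have l1 := Real.log_nonneg hN'
  have l2 := Real.log_nonneg hR
  have l3 := Real.log_nonneg hn'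
  refine exists_bad_set_stdBound hn hY hind hm hcont hm1 hB hr
    (K := netCount d N M R n ^ d) (Nat.one_le_pow _ _ (one_le_netCount d N M R n)) (fun w => ?_) hA
    hV hVW hd' (by linarith) hN' (T := Real.log N + Real.log R + Real.log n) (by linarith)
    (sqrt_sum_three_le l1 l2 l3)
    (by have := sqrtLog_nonneg R; have := sqrtLog_nonneg N; linarith) hτ0 hτ1 ?_
  · obtain ⟨c, hc⟩ := exists_flux_classes (M := M) hN hR hn w
    exact ⟨c, fun θ θ' h j => hdiff _ θ θ' _ (by positivity) (hc θ θ' h j)⟩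
  · push_cast
    rw [Real.log_pow]
    have h1 := log_netCount_le (M := M) hd hN hR hn
    calc d * Real.log (netCount d N M R n)
        ≤ d * (69 * N * d * (M + 2) * (1 + Real.log N + Real.log R + Real.log n)) := by gcongr
      _ ≤ d * (69 * N * d * Lt * (1 + Real.log N + Real.log R + Real.log n)) := by gcongr
      _ = _ := by ring

theorem vol_nonneg (Ω : Set (Pt d)) : 0 ≤ vol Ω := ENNReal.toReal_nonneg

theorem area_nonneg (Ω : Set (Pt d)) : 0 ≤ area Ω := ENNReal.toReal_nonneg

/-- The two network classes are covered separately and the counts multiply, whence `Nκ + Nθ`. The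
cutoff is bounded by `c₁`, so `q` adds nothing to the size of the residual, and it is 1-Lipschitz,
so closeness of the networks passes to it. -/
theorem errD_le (hd : 1 ≤ d) (hn : 1 ≤ n) {X : Fin n → S → Pt d}
    (hX : ∀ j, HasLaw (X j) (uniformIn Ω) P) (hind : iIndepFun X P) {c₀ c₁ z : ℝ} (h0 : 0 < c₀)
    (h1 : c₀ < c₁) (hz : 0 ≤ z) {G : Pt d → Pt d}
    (hGm : AEStronglyMeasurable G (volume.restrict Ω))
    (hG : ∀ᵐ x ∂(volume.restrict Ω), ‖G x‖ ≤ z) {Nκ Nθ Mσ Mq : ℕ} {Rσ Rq : ℝ} (hNκ : 1 ≤ Nκ)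
    (hNθ : 1 ≤ Nθ) (hRσ : 1 ≤ Rσ) (hRq : 1 ≤ Rq) {m W Lt : ℝ} (hm : d + c₁ * z + z ≤ m)
    (hW : vol Ω ≤ W) (hLt : (Mσ + 2 : ℝ) + (Mq + 2) ≤ Lt) (hτ0 : 0 < τ) (hτ1 : τ < 1 / 8) :
    P {s | ¬ errD Ω c₀ c₁ G (fluxClass d (Mσ + 2) Nκ Rσ) (netClass d (Mq + 2) Nθ Rq)
        (fun j => X j s) ≤ ENNReal.ofReal (stdBound W m d Lt (Nκ * Rσ) (Nκ + Nθ)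
          (sqrtLog Rσ + sqrtLog Nκ + sqrtLog Rq + sqrtLog Nθ + sqrtLog n) τ n)}
      ≤ ENNReal.ofReal τ := by
  have hNκ' : (1 : ℝ) ≤ Nκ := by exact_mod_cast hNκ
  have hNθ' : (1 : ℝ) ≤ Nθ := by exact_mod_cast hNθ
  have hn' : (1 : ℝ) ≤ n := by exact_mod_cast hn
  have hd' : (1 : ℝ) ≤ d := by exact_mod_cast hd
  have hMσ : (0 : ℝ) ≤ Mσ := Nat.cast_nonneg _
  have hMq : (0 : ℝ) ≤ Mq := Nat.cast_nonneg _
  have l1 := Real.log_nonneg hNκ'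
  have l2 := Real.log_nonneg hRσ
  have l3 := Real.log_nonneg hn'
  have l4 := Real.log_nonneg hNθ'
  have l5 := Real.log_nonneg hRq
  have hc1 : 0 < c₁ := h0.trans h1
  have hcz : 0 ≤ c₁ * z := by positivity
  obtain ⟨G', hG'm, hG'b, hG'⟩ := exists_bounded_representative hz hGm hG
  have hB := one_le_mul_cast hNκ hRσ
  refine Exists.elim (exists_bad_set_stdBound hn hX hind
    (Θ := (Fin d → SparseParam d Nκ Mσ Rσ) × SparseParam d Nθ Mq Rq)
    (r := fun θ x => fluxVec θ.1 x - cutoff c₀ c₁ (net θ.2.1 x) • G' x)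
    (fun θ => (continuous_fluxVec_right θ.1).measurable.sub
      (((continuous_cutoff c₀ c₁).comp (continuous_net_right θ.2.1)).measurable.smul hG'm))
    (fun x => ((continuous_fluxVec_left x).comp continuous_fst).sub
      (((continuous_cutoff c₀ c₁).comp ((continuous_net_left x).comp continuous_snd)).smul
        continuous_const))
    (m := m) (B := Nκ * Rσ) (by linarith) hB (fun θ x => ?_)
    (K := netCount d Nκ Mσ Rσ n ^ d * netCount d Nθ Mq Rq n)
    (Nat.mul_pos (Nat.pow_pos (one_le_netCount ..)) (one_le_netCount ..)) (fun w => ?_)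
    ((uniformIn_absolutelyContinuous Ω).ae_le hG')
    (V := vol Ω) (W := W) (d := d) (Lt := Lt) (Nn := Nκ + Nθ)
    (T := Real.log Rσ + Real.log Nκ + Real.log Rq + Real.log Nθ + Real.log n)
    (s := sqrtLog Rσ + sqrtLog Nκ + sqrtLog Rq + sqrtLog Nθ + sqrtLog n) (vol_nonneg Ω) hW hd'
    (by linarith) (by linarith) (by positivity) ?_ ?_ hτ0 hτ1 ?_)
    fun N h => ?_
  · have e1 := norm_fluxVec_le hNκ hRσ θ.1 x
    have e2 : ‖cutoff c₀ c₁ (net θ.2.1 x) • G' x‖ ≤ c₁ * z := by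
      rw [norm_smul]
      exact mul_le_mul (abs_cutoff_le h0 h1 _) (hG'b x) (norm_nonneg _) hc1.le
    refine (norm_sub_le _ _).trans ((add_le_add e1 e2).trans ?_)
    nlinarith
  · obtain ⟨c, hc⟩ := exists_flux_classes (M := Mσ) hNκ hRσ hn w
    obtain ⟨c', hc'⟩ := exists_net_classes (M := Mq) hNθ hRq hn w
    refine ⟨fun θ => finProdFinEquiv (c θ.1, c' θ.2), fun θ θ' h j => ?_⟩
    have h' := Prod.ext_iff.1 (finProdFinEquiv.injective h)
    have e1 := norm_fluxVec_sub_le (by positivity) fun i => (hc _ _ h'.1 j i).1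
    have e2 := (abs_cutoff_sub_le c₀ c₁ _ _).trans (hc' _ _ h'.2 j).1
    have e3 : fluxVec θ.1 (w j) - cutoff c₀ c₁ (net θ.2.1 (w j)) • G' (w j)
        - (fluxVec θ'.1 (w j) - cutoff c₀ c₁ (net θ'.2.1 (w j)) • G' (w j))
        = (fluxVec θ.1 (w j) - fluxVec θ'.1 (w j))
          - (cutoff c₀ c₁ (net θ.2.1 (w j)) - cutoff c₀ c₁ (net θ'.2.1 (w j))) • G' (w j) := by
      rw [sub_smul]; abel
    rw [e3]
    refine (norm_sub_le _ _).trans ?_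
    have e4 : ‖(cutoff c₀ c₁ (net θ.2.1 (w j)) - cutoff c₀ c₁ (net θ'.2.1 (w j))) • G' (w j)‖
        ≤ 1 / n * z := by
      rw [norm_smul]
      exact mul_le_mul e2 (hG'b _) (norm_nonneg _) (by positivity)
    calc _ ≤ (d : ℝ) * (1 / n) + 1 / n * z := add_le_add e1 e4
      _ = (d + z) * (1 / n) := by ring
      _ ≤ m * (1 / n) := by gcongr; linarith
  · have s1 := sqrt_add_le_sqrt_add_sqrt (by positivity :
      0 ≤ Real.log Rσ + Real.log Nκ + Real.log Rq + Real.log Nθ) l3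
    have s2 := sqrt_add_le_sqrt_add_sqrt (by positivity :
      0 ≤ Real.log Rσ + Real.log Nκ + Real.log Rq) l4
    have s3 := sqrt_add_le_sqrt_add_sqrt (by positivity : 0 ≤ Real.log Rσ + Real.log Nκ) l5
    have s4 := sqrt_add_le_sqrt_add_sqrt l2 l1
    simp only [sqrtLog]
    linarith
  · have := sqrtLog_nonneg Rσ; have := sqrtLog_nonneg Nκ
    have := sqrtLog_nonneg Rq; have := sqrtLog_nonneg Nθ
    linarith
  · have g1 := log_netCount_le (M := Mσ) hd hNκ hRσ hn
    have g2 := log_netCount_le (M := Mq) hd hNθ hRq hn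
    have p1 : (0 : ℝ) < netCount d Nκ Mσ Rσ n := by exact_mod_cast one_le_netCount ..
    have p2 : (0 : ℝ) < netCount d Nθ Mq Rq n := by exact_mod_cast one_le_netCount ..
    set T := Real.log Rσ + Real.log Nκ + Real.log Rq + Real.log Nθ + Real.log n with hT
    have hT0 : 0 ≤ T := by positivity
    have hLt0 : 0 ≤ Lt := by linarith
    push_cast
    rw [Real.log_mul (by positivity) p2.ne', Real.log_pow]
    calc d * Real.log (netCount d Nκ Mσ Rσ n) + Real.log (netCount d Nθ Mq Rq n)
        ≤ d * (69 * Nκ * d * Lt * (1 + T)) + d * (69 * Nθ * d * Lt * (1 + T)) := by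
          refine add_le_add (mul_le_mul_of_nonneg_left (g1.trans ?_) (by linarith))
            ((g2.trans ?_).trans (le_mul_of_one_le_left (by positivity) hd'))
          · exact mul_le_mul (mul_le_mul_of_nonneg_left (by linarith) (by positivity))
              (by rw [hT]; linarith) (by linarith) (by positivity)
          · exact mul_le_mul (mul_le_mul_of_nonneg_left (by linarith) (by positivity))
              (by rw [hT]; linarith) (by linarith) (by positivity)
      _ = _ := by ring
  · obtain ⟨hN, hNs⟩ := h
    refine measure_not_le_of_bad_set hN fun s hs => iSup₂_le fun σ hσ => iSup₂_le fun q hq => ?_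
    obtain ⟨θ, hθ, -⟩ := exists_flux_param (by linarith) hσ
    obtain ⟨θ', hθ'⟩ := exists_sparseParam (by linarith) hq
    refine hNs s hs _ ⟨(θ, θ'), fun x hx => ?_⟩
    have hx' : G x = G' x := hx
    rw [resD, hθ, hθ', hx']

theorem errσ_le (hd : 1 ≤ d) (hn : 1 ≤ n) {X : Fin n → S → Pt d}
    (hX : ∀ j, HasLaw (X j) (uniformIn Ω) P) (hind : iIndepFun X P) {C : ℝ} (hC : 0 ≤ C)
    {f : Pt d → ℝ} (hfm : AEStronglyMeasurable f (volume.restrict Ω))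
    (hf : ∀ᵐ x ∂(volume.restrict Ω), ‖f x‖ ≤ C) {N M : ℕ} {R : ℝ} (hN : 1 ≤ N) (hR : 1 ≤ R)
    {m W Lt : ℝ} (hm : d + C ≤ m) (hW : vol Ω ≤ W) (hLt : (M + 2 : ℝ) ≤ Lt) (hτ0 : 0 < τ)
    (hτ1 : τ < 1 / 8) :
    P {s | ¬ errσ Ω f (fluxClass d (M + 2) N R) (fun j => X j s)
        ≤ ENNReal.ofReal (stdBound W m d Lt (R ^ (M + 2) * N ^ (M + 1)) N
          (sqrtLog R + sqrtLog N + sqrtLog n) τ n)} ≤ ENNReal.ofReal τ := by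
  have hd' : (1 : ℝ) ≤ d := by exact_mod_cast hd
  have hB := one_le_pow_mul_cast hN hR (M + 2) (M + 1)
  obtain ⟨f', hfm', hfb', hf'⟩ := exists_bounded_representative hC hfm hf
  refine Exists.elim (exists_bad_set_flux hd hn hX hind hN hR (M := M)
    (r := fun θ x => fluxDiv θ x + f' x)
    (fun θ => (continuous_fluxDiv_right θ).measurable.add hfm')
    (fun x => (continuous_fluxDiv_left x).add continuous_const)
    (m := m) (B := R ^ (M + 2) * N ^ (M + 1)) (by linarith) hB (fun θ x => ?_)
    (fun D θ θ' x hD h => ?_) ((uniformIn_absolutelyContinuous Ω).ae_le hf') (vol_nonneg Ω) hW hLt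
    hτ0 hτ1)
    fun N' h => ?_
  · refine (norm_add_le _ _).trans ((add_le_add (abs_fluxDiv_le hR θ x) (hfb' x)).trans ?_)
    nlinarith
  · rw [add_sub_add_right_eq_sub]
    refine (abs_fluxDiv_sub_le fun i => (h i).2 i).trans ?_
    gcongr; linarith
  · obtain ⟨hN', hNs⟩ := h
    refine measure_not_le_of_bad_set hN' fun s hs => iSup₂_le fun σ hσ => ?_
    obtain ⟨θ, -, hθ⟩ := exists_flux_param (by linarith) hσ
    refine hNs s hs _ ⟨θ, fun x hx => ?_⟩
    have hx' : f x = f' x := hx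
    rw [resσ, hθ, hx', Real.norm_eq_abs, sq_abs]

/-- Both `g` and the normal are replaced by bounded measurable representatives; as the normal has
norm at most one, the residual inherits the bounds of the flux. -/
theorem errB_le (hd : 1 ≤ d) (hn : 1 ≤ n) {Y : Fin n → S → Pt d}
    (hY : ∀ j, HasLaw (Y j) (uniformBdry Ω) P) (hind : iIndepFun Y P) {C : ℝ} (hC : 0 ≤ C)
    {ν : Pt d → Pt d} (hν : IsUnitOutwardNormal Ω ν)
    {g : Pt d → ℝ} (hgm : AEStronglyMeasurable g (surfaceMeasure Ω))
    (hg : ∀ᵐ x ∂(surfaceMeasure Ω), ‖g x‖ ≤ C) {N M : ℕ} {R : ℝ} (hN : 1 ≤ N) (hR : 1 ≤ R)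
    {m W Lt : ℝ} (hm : d + C ≤ m) (hW : area Ω ≤ W) (hLt : (M + 2 : ℝ) ≤ Lt) (hτ0 : 0 < τ)
    (hτ1 : τ < 1 / 8) :
    P {s | ¬ errB Ω ν g (fluxClass d (M + 2) N R) (fun j => Y j s)
        ≤ ENNReal.ofReal (stdBound W m d Lt (N * R) N
          (sqrtLog R + sqrtLog N + sqrtLog n) τ n)} ≤ ENNReal.ofReal τ := by
  have hd' : (1 : ℝ) ≤ d := by exact_mod_cast hd
  have hB := one_le_mul_cast hN hR
  obtain ⟨g', hgm', hgb', hg'⟩ := exists_bounded_representative hC hgm hg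
  obtain ⟨ν', hνm', hνb', hν'⟩ := exists_bounded_representative (μ := surfaceMeasure Ω)
    zero_le_one (hν.continuousOn.aestronglyMeasurable isClosed_frontier.measurableSet)
    ((ae_mem_frontier Ω).mono fun y hy => hν.norm_le_one hy)
  refine Exists.elim (exists_bad_set_flux hd hn hY hind hN hR (M := M)
    (r := fun θ y => inner ℝ (fluxVec θ y) (ν' y) - g' y)
    (fun θ => ((continuous_fluxVec_right θ).measurable.inner hνm').sub hgm')
    (fun x => ((continuous_fluxVec_left x).inner continuous_const).sub continuous_const)
    (m := m) (B := N * R) (by linarith) hB (fun θ x => ?_)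
    (fun D θ θ' x hD h => ?_) ((uniformBdry_absolutelyContinuous Ω).ae_le (hg'.and hν'))
    (area_nonneg Ω) hW hLt hτ0 hτ1)
    fun N' h => ?_
  · have e1 : ‖(inner ℝ (fluxVec θ x) (ν' x) : ℝ)‖ ≤ d * (2 * (N * R)) :=
      (norm_inner_le_norm _ _).trans ((mul_le_of_le_one_right (norm_nonneg _) (hνb' x)).trans
        (norm_fluxVec_le hN hR θ x))
    refine (norm_sub_le _ _).trans ((add_le_add e1 (hgb' x)).trans ?_)
    nlinarith
  · rw [sub_sub_sub_cancel_right, ← inner_sub_left]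
    refine (norm_inner_le_norm _ _).trans ((mul_le_of_le_one_right (norm_nonneg _) (hνb' x)).trans
      ((norm_fluxVec_sub_le hD fun i => (h i).1).trans ?_))
    gcongr; linarith
  · obtain ⟨hN', hNs⟩ := h
    refine measure_not_le_of_bad_set hN' fun s hs => iSup₂_le fun σ hσ => ?_
    obtain ⟨θ, hθ, -⟩ := exists_flux_param (by linarith) hσ
    refine hNs s hs _ ⟨θ, fun x hx => ?_⟩
    have hx' : g x = g' x ∧ ν x = ν' x := hx
    rw [resB, hθ, hx'.1, hx'.2, Real.norm_eq_abs, sq_abs]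

theorem errB'_le (hd : 1 ≤ d) (hn : 1 ≤ n) {Y : Fin n → S → Pt d}
    (hY : ∀ j, HasLaw (Y j) (uniformBdry Ω) P) (hind : iIndepFun Y P) {c₁ z : ℝ} (hc : 0 ≤ c₁)
    (hz : 0 ≤ z) {qb : Pt d → ℝ} (hqm : AEStronglyMeasurable qb (surfaceMeasure Ω))
    (hq : ∀ᵐ x ∂(surfaceMeasure Ω), ‖qb x‖ ≤ c₁)
    {Gb : Pt d → Pt d} (hGm : AEStronglyMeasurable Gb (surfaceMeasure Ω))
    (hG : ∀ᵐ x ∂(surfaceMeasure Ω), ‖Gb x‖ ≤ z) {N M : ℕ} {R : ℝ} (hN : 1 ≤ N) (hR : 1 ≤ R)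
    {m W Lt : ℝ} (hm : d + c₁ * z ≤ m) (hW : area Ω ≤ W) (hLt : (M + 2 : ℝ) ≤ Lt) (hτ0 : 0 < τ)
    (hτ1 : τ < 1 / 8) :
    P {s | ¬ errB' Ω qb Gb (fluxClass d (M + 2) N R) (fun j => Y j s)
        ≤ ENNReal.ofReal (stdBound W m d Lt (N * R) N
          (sqrtLog R + sqrtLog N + sqrtLog n) τ n)} ≤ ENNReal.ofReal τ := by
  have hd' : (1 : ℝ) ≤ d := by exact_mod_cast hd
  have hB := one_le_mul_cast hN hR
  have hcz : 0 ≤ c₁ * z := by positivity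
  obtain ⟨q', hqm', hqb', hq'⟩ := exists_bounded_representative hc hqm hq
  obtain ⟨G', hGm', hGb', hG'⟩ := exists_bounded_representative hz hGm hG
  refine Exists.elim (exists_bad_set_flux hd hn hY hind hN hR (M := M)
    (r := fun θ y => fluxVec θ y - q' y • G' y)
    (fun θ => (continuous_fluxVec_right θ).measurable.sub (hqm'.smul hGm'))
    (fun x => (continuous_fluxVec_left x).sub continuous_const)
    (m := m) (B := N * R) (by linarith) hB (fun θ x => ?_)
    (fun D θ θ' x hD h => ?_) ((uniformBdry_absolutelyContinuous Ω).ae_le (hq'.and hG'))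
    (area_nonneg Ω) hW hLt hτ0 hτ1)
    fun N' h => ?_
  · have e2 : ‖q' x • G' x‖ ≤ c₁ * z := by
      rw [norm_smul]
      exact mul_le_mul (hqb' x) (hGb' x) (norm_nonneg _) hc
    refine (norm_sub_le _ _).trans ((add_le_add (norm_fluxVec_le hN hR θ x) e2).trans ?_)
    nlinarith
  · rw [sub_sub_sub_cancel_right]
    refine (norm_fluxVec_sub_le hD fun i => (h i).1).trans ?_
    gcongr; linarith
  · obtain ⟨hN', hNs⟩ := h
    refine measure_not_le_of_bad_set hN' fun s hs => iSup₂_le fun σ hσ => ?_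
    obtain ⟨θ, hθ, -⟩ := exists_flux_param (by linarith) hσ
    refine hNs s hs _ ⟨θ, fun x hx => ?_⟩
    have hx' : qb x = q' x ∧ Gb x = G' x := hx
    rw [resB', hθ, hx'.1, hx'.2]

/-- The bound for stacks is reused with a residual that depends on the first network only. The
surplus in the count is a power `d`, already allowed for in `stdBound`. -/
theorem errQ_le (hd : 1 ≤ d) (hn : 1 ≤ n) {X : Fin n → S → Pt d}
    (hX : ∀ j, HasLaw (X j) (uniformIn Ω) P) (hind : iIndepFun X P) {N M : ℕ} {R : ℝ}
    (hN : 1 ≤ N) (hR : 1 ≤ R) {m W Lt : ℝ} (hm : d ≤ m) (hW : vol Ω ≤ W)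
    (hLt : (M + 2 : ℝ) ≤ Lt) (hτ0 : 0 < τ) (hτ1 : τ < 1 / 8) :
    P {s | ¬ errQ Ω (netClass d (M + 2) N R) (fun j => X j s)
        ≤ ENNReal.ofReal (stdBound W m d Lt (R ^ (M + 2) * N ^ (M + 1)) N
          (sqrtLog R + sqrtLog N + sqrtLog n) τ n)} ≤ ENNReal.ofReal τ := by
  have hd' : (1 : ℝ) ≤ d := by exact_mod_cast hd
  have hB := one_le_pow_mul_cast hN hR (M + 2) (M + 1)
  refine Exists.elim (exists_bad_set_flux hd hn hX hind hN hR (M := M)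
    (r := fun θ x => gradVec (θ ⟨0, hd⟩) x)
    (fun θ => (continuous_gradVec_right _).measurable)
    (fun x => (continuous_gradVec_left x).comp (continuous_apply _))
    (m := m) (B := R ^ (M + 2) * N ^ (M + 1)) (by linarith) hB (fun θ x => ?_)
    (fun D θ θ' x hD h => ?_) (ae_of_all _ fun x => mem_univ x) (vol_nonneg Ω) hW hLt hτ0 hτ1)
    fun N' h => ?_
  · refine (norm_gradVec_le hR _ x).trans ?_
    nlinarith
  · refine (norm_gradVec_sub_le hD (h _).2).trans ?_
    gcongr
  · obtain ⟨hN', hNs⟩ := h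
    refine measure_not_le_of_bad_set hN' fun s hs => iSup₂_le fun q hq => ?_
    obtain ⟨θ, hθ⟩ := exists_grad_param (by linarith) hq
    refine hNs s hs _ ⟨fun _ => θ, fun x _ => ?_⟩
    rw [resQ, hθ]

end Bounds

/-! ### Comparison with the stated bounds -/

theorem stdBound_eq_boundD (W m d Lt Rσ Rq τ : ℝ) (Nκ Nθ n : ℕ) :
    stdBound W m d Lt (Nκ * Rσ) (Nκ + Nθ)
        (sqrtLog Rσ + sqrtLog Nκ + sqrtLog Rq + sqrtLog Nθ + sqrtLog n) τ n
      = boundD (216 * W * m ^ 2 * d * Lt) (24 * W * m ^ 2) Rσ Rq Nκ Nθ n τ := by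
  rw [stdBound, boundD]; ring

theorem stdBound_eq_boundB (W m d Lt R τ : ℝ) {N : ℕ} (hN : 1 ≤ N) (n : ℕ) :
    stdBound W m d Lt (N * R) N (sqrtLog R + sqrtLog N + sqrtLog n) τ n
      = boundB (216 * W * m ^ 2 * d * Lt) (24 * W * m ^ 2) R N n τ := by
  have hN' : (0 : ℝ) < N := by exact_mod_cast hN
  have e : (N : ℝ) ^ (5 / 2 : ℝ) = N ^ 2 * √N := by
    rw [show (5 / 2 : ℝ) = (2 : ℕ) + 1 / 2 by norm_num, Real.rpow_add hN', Real.rpow_natCast,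
      Real.sqrt_eq_rpow]
  rw [stdBound, boundB, e]; ring

/-- With `L = M + 2`, the square of `N ^ (M + 1)` is `N ^ (2 * L - 2)`, and the entropy factor `√N`
raises the exponent to `2 * L - 3 / 2`. -/
theorem stdBound_eq_boundDeriv (W m d Lt R τ : ℝ) (M : ℕ) {N : ℕ} (hN : 1 ≤ N) (n : ℕ) :
    stdBound W m d Lt (R ^ (M + 2) * N ^ (M + 1)) N (sqrtLog R + sqrtLog N + sqrtLog n) τ n
      = boundDeriv (216 * W * m ^ 2 * d * Lt) (24 * W * m ^ 2) (M + 2) R N n τ := by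
  have hN' : (0 : ℝ) < N := by exact_mod_cast hN
  have e1 : (N : ℝ) ^ (2 * ((M + 2 : ℕ) : ℝ) - 3 / 2) = (N ^ (M + 1)) ^ 2 * √N := by
    rw [show 2 * ((M + 2 : ℕ) : ℝ) - 3 / 2 = ((M + 1) * 2 : ℕ) + 1 / 2 by push_cast; ring,
      Real.rpow_add hN', Real.rpow_natCast, Real.sqrt_eq_rpow, pow_mul]
  have e2 : (N : ℝ) ^ (2 * ((M + 2 : ℕ) : ℝ) - 2) = (N ^ (M + 1)) ^ 2 := by
    rw [show 2 * ((M + 2 : ℕ) : ℝ) - 2 = ((M + 1) * 2 : ℕ) by push_cast; ring,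
      Real.rpow_natCast, pow_mul]
  rw [stdBound, boundDeriv, e1, e2]; ring

end FluxNet

end

/-! ### The theorem, with explicit polynomials -/

theorem mainTheorem2 :
    -- the constants are values of fixed polynomials
    ∃ (p : MvPolynomial (Fin 9) ℝ) (p' : MvPolynomial (Fin 7) ℝ),
    ∀ (d : ℕ) (_ : 1 ≤ d)
      -- the domain, with smooth boundary and outward normal
      (Ω : Set (Pt d)) (_ : IsOpen Ω) (_ : Bornology.IsBounded Ω)
      (ν : Pt d → Pt d) (_ : IsUnitOutwardNormal Ω ν)
      -- the data
      (c₀ c₁ : ℝ) (_ : 0 < c₀) (_ : c₀ < c₁)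
      (qdag : Pt d → ℝ) (_ : qdag ∈ admissibleSet Ω c₀ c₁)
      (f : Pt d → ℝ) (_ : MemLp f ⊤ (volume.restrict Ω))
      (g : Pt d → ℝ) (_ : MemLp g ⊤ (surfaceMeasure Ω))
      (z : Pt d → ℝ) (G : Pt d → Pt d) (_ : MemW1Inf Ω z G)
      -- the network classes
      (Lσ Lq Nκ Nθ : ℕ) (Rσ Rq : ℝ) (_ : 2 ≤ Lσ) (_ : 2 ≤ Lq) (_ : 1 ≤ Nκ) (_ : 1 ≤ Nθ)
      (_ : 1 ≤ Rσ) (_ : 1 ≤ Rq)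
      -- the random sample points
      (S : Type*) (_ : MeasurableSpace S) (P : Measure S) (_ : IsProbabilityMeasure P)
      (nr nb : ℕ) (_ : 1 ≤ nr) (_ : 1 ≤ nb)
      (X : Fin nr → S → Pt d) (_ : ∀ j, HasLaw (X j) (uniformIn Ω) P) (_ : iIndepFun X P)
      (Y : Fin nb → S → Pt d) (_ : ∀ j, HasLaw (Y j) (uniformBdry Ω) P) (_ : iIndepFun Y P)
      (τ : ℝ) (_ : 0 < τ) (_ : τ < 1 / 8),
    let c : ℝ := MvPolynomial.eval
      ![vol Ω, area Ω, (d : ℝ), c₁, normW1Inf Ω z G, supNorm f (volume.restrict Ω),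
        supNorm g (surfaceMeasure Ω), (Lσ : ℝ), (Lq : ℝ)] p
    let c' : ℝ := MvPolynomial.eval
      ![vol Ω, area Ω, (d : ℝ), c₁, normW1Inf Ω z G, supNorm f (volume.restrict Ω),
        supNorm g (surfaceMeasure Ω)] p'
    P {s | ¬ errD Ω c₀ c₁ G (fluxClass d Lσ Nκ Rσ) (netClass d Lq Nθ Rq) (fun j => X j s)
        ≤ ENNReal.ofReal (boundD c c' Rσ Rq Nκ Nθ nr τ)} ≤ ENNReal.ofReal τ ∧
    P {s | ¬ errσ Ω f (fluxClass d Lσ Nκ Rσ) (fun j => X j s)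
        ≤ ENNReal.ofReal (boundDeriv c c' Lσ Rσ Nκ nr τ)} ≤ ENNReal.ofReal τ ∧
    P {s | ¬ errB Ω ν g (fluxClass d Lσ Nκ Rσ) (fun j => Y j s)
        ≤ ENNReal.ofReal (boundB c c' Rσ Nκ nb τ)} ≤ ENNReal.ofReal τ ∧
    (∀ (qb : Pt d → ℝ) (Gb : Pt d → Pt d), HasTrace Ω qdag qb → HasTrace Ω G Gb →
      P {s | ¬ errB' Ω qb Gb (fluxClass d Lσ Nκ Rσ) (fun j => Y j s)
        ≤ ENNReal.ofReal (boundB c c' Rσ Nκ nb τ)} ≤ ENNReal.ofReal τ) ∧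
    P {s | ¬ errQ Ω (netClass d Lq Nθ Rq) (fun j => X j s)
        ≤ ENNReal.ofReal (boundDeriv c c' Lq Rq Nθ nr τ)} ≤ ENNReal.ofReal τ := by
  -- One choice serves all five errors: `W = |Ω| + |∂Ω|` dominates both measures, `m = (1 + c₁) * (1
  -- + ζ) + d + F + γ` dominates each sum of data bounds, with `ζ`, `F`, `γ` the norms of the data
  -- `z`, `f`, `g`, and `Lσ + Lq` dominates each depth. Then `p = 216 W m ^ 2 d (Lσ + Lq)` and `p' =
  -- 24 W m ^ 2`.
  refine ⟨MvPolynomial.C 216 * (MvPolynomial.X 0 + MvPolynomial.X 1) *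
    ((1 + MvPolynomial.X 3) * (1 + MvPolynomial.X 4) + MvPolynomial.X 2 + MvPolynomial.X 5
      + MvPolynomial.X 6) ^ 2 * MvPolynomial.X 2 * (MvPolynomial.X 7 + MvPolynomial.X 8),
    MvPolynomial.C 24 * (MvPolynomial.X 0 + MvPolynomial.X 1) *
    ((1 + MvPolynomial.X 3) * (1 + MvPolynomial.X 4) + MvPolynomial.X 2 + MvPolynomial.X 5
      + MvPolynomial.X 6) ^ 2, ?_⟩
  intro d hd Ω hΩ _ ν hν c₀ c₁ h0 h1 qdag hqdag f hf g hg z G hz Lσ Lq Nκ Nθ Rσ Rq hLσ hLq hNκ hNθ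
    hRσ hRq S _ P _ nr nb hnr hnb X hX hXi Y hY hYi τ hτ0 hτ1
  obtain ⟨Mσ, rfl⟩ := Nat.exists_eq_add_of_le' hLσ
  obtain ⟨Mq, rfl⟩ := Nat.exists_eq_add_of_le' hLq
  set ζ := normW1Inf Ω z G with hζ
  set F := supNorm f (volume.restrict Ω) with hF
  set γ := supNorm g (surfaceMeasure Ω) with hγ
  set m : ℝ := (1 + c₁) * (1 + ζ) + d + F + γ with hm
  set W : ℝ := vol Ω + area Ω with hW
  have hm' : m = 1 + c₁ + ζ + c₁ * ζ + d + F + γ := by rw [hm]; ring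
  set Lt : ℝ := ((Mσ + 2 : ℕ) : ℝ) + ((Mq + 2 : ℕ) : ℝ) with hLt
  have hc1 : 0 < c₁ := h0.trans h1
  have hζ0 : 0 ≤ ζ := (supNorm_nonneg _ _).trans (le_max_left _ _)
  have hF0 : 0 ≤ F := supNorm_nonneg _ _
  have hγ0 : 0 ≤ γ := supNorm_nonneg _ _
  have hcζ : 0 ≤ c₁ * ζ := by positivity
  have hV0 := vol_nonneg Ω
  have hA0 := area_nonneg Ω
  have hGb : ∀ᵐ x ∂(volume.restrict Ω), ‖G x‖ ≤ ζ :=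
    (ae_norm_le_supNorm hz.2.1).mono fun x hx => hx.trans (le_max_right _ _)
  have hqb : ∀ᵐ x ∂(volume.restrict Ω), ‖qdag x‖ ≤ c₁ := by
    filter_upwards [hqdag.2.2] with x hx
    rw [Real.norm_of_nonneg (h0.le.trans hx.1)]
    exact hx.2
  have hLσ' : (Mσ + 2 : ℝ) ≤ Lt := by rw [hLt]; push_cast; linarith [(Mq.cast_nonneg : (0 : ℝ) ≤ Mq)]
  have hLq' : (Mq + 2 : ℝ) ≤ Lt := by rw [hLt]; push_cast; linarith [(Mσ.cast_nonneg : (0 : ℝ) ≤ Mσ)]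
  intro c c'
  have hc : c = 216 * W * m ^ 2 * d * Lt := by simp [c, hW, hm, hLt]
  have hc' : c' = 24 * W * m ^ 2 := by simp [c', hW, hm]
  rw [hc, hc', ← stdBound_eq_boundD, ← stdBound_eq_boundDeriv _ _ _ _ _ _ _ hNκ,
    ← stdBound_eq_boundB _ _ _ _ _ _ hNκ, ← stdBound_eq_boundDeriv _ _ _ _ _ _ _ hNθ]
  refine ⟨?_, ?_, ?_, fun qb Gb hqt hGt => ?_, ?_⟩
  · exact errD_le hd hnr hX hXi h0 h1 hζ0 hz.2.1.1 hGb hNκ hNθ hRσ hRq (by linarith)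
      (by linarith) (by rw [hLt]; push_cast; linarith) hτ0 hτ1
  · exact errσ_le hd hnr hX hXi hF0 hf.1 (ae_norm_le_supNorm hf) hNκ hRσ (by linarith)
      (by linarith) hLσ' hτ0 hτ1
  · exact errB_le hd hnb hY hYi hγ0 hν hg.1 (ae_norm_le_supNorm hg) hNκ hRσ (by linarith)
      (by linarith) hLσ' hτ0 hτ1
  · exact errB'_le hd hnb hY hYi hc1.le hζ0 hqt.1 (hqt.ae_norm_le hΩ hqb) hGt.1
      (hGt.ae_norm_le hΩ hGb) hNκ hRσ (by linarith) (by linarith) hLσ' hτ0 hτ1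
  · exact errQ_le hd hnr hX hXi hNθ hRq (by linarith) (by linarith) hLq' hτ0 hτ1
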